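/- Let $\mathbb V$ be a one-dimensional complex vector space with a hermitian norm $\|\cdot\|$, let $\mathbb V^*$ be its dual with the dual norm, and let $\mathbb P=\mathbb V\cup\{\infty\}$, $\mathbb P^*=\mathbb V^*\cup\{\infty\}$ be the projective compactifications. Let $K\subset\mathbb V$ be a nonempty convex compact set. For $S\subset\mathbb V$ let $h_S(w)=\sup_{z\in S}\operatorname{Re}\langle z,w\rangle$ be the support function, and for $\varepsilon>0$ put $K_\varepsilon=K+\{z:\|z\|\le\varepsilon\}$. Assume that for every $\varepsilon>0$ the function $h_{K_\varepsilon}$ is almost $C^\infty$-subanalytic on $\mathbb P^*$, i.e. it is continuous and its (ASA)-class is nonempty; here the (ASA)-class of $f:\mathbb V^*\to\mathbb R$ is the set of $C^\infty$-functions $g:\mathbb V^*\to\mathbb R$ with $|f-g|$ bounded whose graph is subanalytic in $\mathbb P^*\times[-\infty,+\infty]$. Let $\Omega^{t}_{\mathbb P}(\mathbb V)$ be the space of holomorphic $1$-forms on $\mathbb V$ which extend to $\mathbb P$ as distributional $(1,0)$-forms. Let $\Omega^{t_\infty}_{\mathbb P}(\mathbb V\setminus K)$ be the space of holomorphic $1$-forms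 on $\mathbb V\setminus K$ which are tempered at infinity, i.e. whose restriction to some punctured neighbourhood of $\infty$ extends to $\mathbb P$ as a distributional $(1,0)$-form. Regard $\Omega^t_{\mathbb P}(\mathbb V)$ as a subspace of $\Omega^{t_\infty}_{\mathbb P}(\mathbb V\setminus K)$ by restriction. Let $\mathrm{Exp}^t(K)$ be the space of entire functions $v$ on $\mathbb V^*$ such that, for every $\varepsilon>0$, the function $e^{-g}v$ extends to $\mathbb P^*$ as a distribution for every $g$ in the (ASA)-class of $h_{K_\varepsilon}$ (the condition does not depend on the choice of $g$). Then there is an isomorphism of $\mathbb C$-vector spaces $$\Omega^{t_\infty}_{\mathbb P}(\mathbb V\setminus K)/\Omega^t_{\mathbb P}(\mathbb V)\;\xrightarrow{\ \sim\ }\;\mathrm{Exp}^t(K)$$ which, for every global $\mathbb C$-linear coordinate $z$ of $\mathbb V$ with dual coordinate $w$, is given by $$[u(z)\,dz]\longmapsto v,\qquad v(w)=\int_{C(0,r)^+}e^{zw}u(z)\,dz,$$ where $C(0,r)^+$ is any positively oriented circle of center $0$ and radius $r>0$ whose open disc contains $K$. Moreover, this recovers Pólya's theorem: let $\Omega^0(\mathbb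 V\setminus K)$ be the space of holomorphic $1$-forms $\omega$ on $\mathbb V\setminus K$ with $\lim_{z\to\infty}\omega(z)=0$, and let $\mathrm{Exp}(K)$ be the space of entire functions $v$ on $\mathbb V^*$ with $\sup_{w}|v(w)|e^{-h_K(w)-\varepsilon\|w\|}<\infty$ for all $\varepsilon>0$. Then $\Omega^0(\mathbb V\setminus K)\subset\Omega^{t_\infty}_{\mathbb P}(\mathbb V\setminus K)$, the map $\omega\mapsto[\omega]$ from $\Omega^0(\mathbb V\setminus K)$ to $\Omega^{t_\infty}_{\mathbb P}(\mathbb V\setminus K)/\Omega^t_{\mathbb P}(\mathbb V)$ is bijective, and $\mathrm{Exp}(K)=\mathrm{Exp}^t(K)$. -/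

import Mathlib

open Set Filter Topology MeasureTheory
open scoped Pointwise

namespace Polya

noncomputable section

/-! ### Subanalytic sets -/

/-- A subset of a real normed space is semianalytic if, near every point of the space, it is a
finite union of sets defined by finitely many equations `f = 0` and inequalities `0 < g` with
`f`, `g` real analytic. -/
def IsSemianalytic {E : Type*} [NormedAddCommGroup E] [NormedSpace ℝ E] (A : Set E) : Prop :=
  ∀ x : E, ∃ U : Set E, IsOpen U ∧ x ∈ U ∧
    ∃ (p q : ℕ) (f g : Fin p → Fin q → E → ℝ),
      (∀ i j, AnalyticOnNhd ℝ (f i j) U ∧ AnalyticOnNhd ℝ (g i j) U) ∧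
      A ∩ U = {y | y ∈ U ∧ ∃ i, ∀ j, f i j y = 0 ∧ 0 < g i j y}

/-- A subset of a (finite-dimensional) real normed space is subanalytic if, near every point of the
space, it is the projection of a relatively compact semianalytic set. -/
def IsSubanalytic {E : Type*} [NormedAddCommGroup E] [NormedSpace ℝ E] (A : Set E) : Prop :=
  ∀ x : E, ∃ U : Set E, IsOpen U ∧ x ∈ U ∧
    ∃ (n : ℕ) (B : Set (E × (Fin n → ℝ))),
      IsSemianalytic B ∧ Bornology.IsBounded B ∧ A ∩ U = Prod.fst '' B

/-- The standard identification of `[-∞, ∞]` with `[-1, 1]`, restricted to `ℝ`. -/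
def compactify (t : ℝ) : ℝ := t / √(1 + t ^ 2)

/-- A function `g : W → ℝ` on a complex line `W` is subanalytic on the projective line
`P = W ∪ {∞}` if its graph is subanalytic in `P × [-∞, ∞]`. The manifold `P` is covered by the two
charts `z` and `ζ = 1 / z`, where `z` is a linear coordinate `e` on `W`. -/
def IsSubanalyticFun {W : Type*} [NormedAddCommGroup W] [NormedSpace ℂ W] (g : W → ℝ) : Prop :=
  ∀ e : W ≃L[ℂ] ℂ,
    IsSubanalytic {p : ℂ × ℝ | ∃ w : W, p = (e w, compactify (g w))} ∧
    IsSubanalytic {p : ℂ × ℝ | ∃ w : W, w ≠ 0 ∧ p = ((e w)⁻¹, compactify (g w))}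

/-- `g` is in the (ASA)-class of `f`: it is smooth, subanalytic on `P = W ∪ {∞}`, and at bounded
distance from `f`. -/
def InASAClass {W : Type*} [NormedAddCommGroup W] [NormedSpace ℂ W] (f g : W → ℝ) : Prop :=
  ContDiff ℝ (⊤ : ℕ∞) g ∧ IsSubanalyticFun g ∧ ∃ C : ℝ, 0 < C ∧ ∀ w, |f w - g w| < C

/-- `f : W → ℝ` is almost `C^∞`-subanalytic on `P = W ∪ {∞}`. -/
def IsAlmostSmoothSubanalytic {W : Type*} [NormedAddCommGroup W] [NormedSpace ℂ W]
    (f : W → ℝ) : Prop :=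
  Continuous f ∧ ∃ g : W → ℝ, InASAClass f g

/-! ### Distributions on the projective line

`ℂ ∪ {∞}` is covered by the charts `z` and `ζ = 1 / z`. A smooth section of a line bundle on it is a
pair of smooth functions on `ℂ` (one in each chart), related by the transition factor `c`. -/

/-- Smooth sections `(φ₀, φ₁)` over `ℂ ∪ {∞}` of the line bundle with transition factor `c`. -/
def testSections (c : ℂ → ℂ) : Submodule ℂ ((ℂ → ℂ) × (ℂ → ℂ)) where
  carrier := {φ | ContDiff ℝ (⊤ : ℕ∞) φ.1 ∧ ContDiff ℝ (⊤ : ℕ∞) φ.2 ∧ ∀ ζ : ℂ, ζ ≠ 0 → φ.2 ζ = c ζ * φ.1 ζ⁻¹}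
  zero_mem' := ⟨contDiff_const, contDiff_const, fun ζ _ => by simp⟩
  add_mem' := by
    rintro φ ψ ⟨h1, h2, h3⟩ ⟨k1, k2, k3⟩
    refine ⟨h1.add k1, h2.add k2, fun ζ hζ => ?_⟩
    simp [h3 ζ hζ, k3 ζ hζ, mul_add]
  smul_mem' := by
    rintro a φ ⟨h1, h2, h3⟩
    refine ⟨h1.const_smul a, h2.const_smul a, fun ζ hζ => ?_⟩
    simp [h3 ζ hζ, mul_left_comm]

/-- Transition factor of smooth `(1,1)`-forms: `dz ∧ dz̄ = |ζ|⁻⁴ dζ ∧ dζ̄`. The dual of these test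
forms consists of the distributions `Db`. -/
def cDensity (ζ : ℂ) : ℂ := ((‖ζ‖ ^ 4)⁻¹ : ℝ)

/-- Transition factor of smooth `(0,1)`-forms: `dz̄ = - ζ̄⁻² dζ̄`. The dual of these test forms
consists of the distributional `(1,0)`-forms `Db^{1,0}`. -/
def cAntiForm (ζ : ℂ) : ℂ := -(((starRingEnd ℂ) ζ) ^ 2)⁻¹

/-- A linear functional on the smooth sections over the compact manifold `ℂ ∪ {∞}` is a distribution
if it is continuous, i.e. bounded by finitely many derivatives; the two closed unit discs `|z| ≤ 1`
and `|ζ| ≤ 1` cover the manifold. -/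
def IsDistribution (c : ℂ → ℂ) (T : testSections c →ₗ[ℂ] ℂ) : Prop :=
  ∃ (N : ℕ) (C : ℝ), ∀ (φ : testSections c) (B : ℝ),
    (∀ k ≤ N, ∀ z : ℂ, ‖z‖ ≤ 1 →
      ‖iteratedFDeriv ℝ k φ.1.1 z‖ ≤ B ∧ ‖iteratedFDeriv ℝ k φ.1.2 z‖ ≤ B) →
    ‖T φ‖ ≤ C * B

/-- The function `f` on the open set `U ⊆ ℂ`, regarded as a distribution on `U`, extends to a
distribution on `ℂ ∪ {∞}`. (For `c = cAntiForm`, `f` stands for the form `f dz`, which pairs with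
`φ dz̄` through `∫ f φ dz ∧ dz̄`; the constant in `dz ∧ dz̄ = -2i dx ∧ dy` is normalized away.) -/
def ExtendsToProj (c : ℂ → ℂ) (U : Set ℂ) (f : ℂ → ℂ) : Prop :=
  ∃ T : testSections c →ₗ[ℂ] ℂ, IsDistribution c T ∧
    ∀ φ : testSections c, HasCompactSupport φ.1.1 → tsupport φ.1.1 ⊆ U →
      T φ = ∫ z : ℂ, f z * φ.1.1 z

theorem integrable_mul {U : Set ℂ} {f φ : ℂ → ℂ} (hf : ∀ z ∈ U, ContinuousAt f z)
    (hφ : Continuous φ) (hc : HasCompactSupport φ) (hs : tsupport φ ⊆ U) :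
    Integrable (fun z => f z * φ z) := by
  refine Continuous.integrable_of_hasCompactSupport ?_ hc.mul_left
  rw [continuous_iff_continuousAt]
  intro z
  by_cases hz : z ∈ tsupport φ
  · exact (hf z (hs hz)).mul hφ.continuousAt
  · have h0 : (fun y => f y * φ y) =ᶠ[𝓝 z] fun _ => 0 := by
      filter_upwards [notMem_tsupport_iff_eventuallyEq.1 hz] with y hy
      simp [hy]
    exact h0.continuousAt

theorem ExtendsToProj.zero (c : ℂ → ℂ) (U : Set ℂ) : ExtendsToProj c U 0 :=
  ⟨0, ⟨0, 0, fun φ B _ => by simp⟩, fun φ _ _ => by simp⟩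

theorem ExtendsToProj.add {c : ℂ → ℂ} {U : Set ℂ} {f g : ℂ → ℂ}
    (hf : ∀ z ∈ U, ContinuousAt f z) (hg : ∀ z ∈ U, ContinuousAt g z)
    (h : ExtendsToProj c U f) (k : ExtendsToProj c U g) : ExtendsToProj c U (f + g) := by
  obtain ⟨T, ⟨N, C, hT⟩, hTf⟩ := h
  obtain ⟨S, ⟨M, D, hS⟩, hSg⟩ := k
  refine ⟨T + S, ⟨max N M, C + D, fun φ B hB => ?_⟩, fun φ hc hs => ?_⟩
  · have h1 := hT φ B fun k hk => hB k (hk.trans (le_max_left _ _))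
    have h2 := hS φ B fun k hk => hB k (hk.trans (le_max_right _ _))
    calc ‖(T + S) φ‖ ≤ ‖T φ‖ + ‖S φ‖ := norm_add_le _ _
      _ ≤ (C + D) * B := by linarith
  · have hφ : Continuous φ.1.1 := φ.2.1.continuous
    rw [LinearMap.add_apply, hTf φ hc hs, hSg φ hc hs,
      ← integral_add (integrable_mul hf hφ hc hs) (integrable_mul hg hφ hc hs)]
    simp [add_mul]

theorem ExtendsToProj.smul {c : ℂ → ℂ} {U : Set ℂ} {f : ℂ → ℂ} (a : ℂ)
    (h : ExtendsToProj c U f) : ExtendsToProj c U (a • f) := by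
  obtain ⟨T, ⟨N, C, hT⟩, hTf⟩ := h
  refine ⟨a • T, ⟨N, ‖a‖ * C, fun φ B hB => ?_⟩, fun φ hc hs => ?_⟩
  · rw [LinearMap.smul_apply, norm_smul, mul_assoc]
    exact mul_le_mul_of_nonneg_left (hT φ B hB) (norm_nonneg a)
  · rw [LinearMap.smul_apply, hTf φ hc hs, smul_eq_mul, ← integral_const_mul]
    simp [mul_assoc]

theorem ExtendsToProj.mono {c : ℂ → ℂ} {U U' : Set ℂ} {f f' : ℂ → ℂ} (hU : U' ⊆ U)
    (hff : EqOn f f' U') (h : ExtendsToProj c U f) : ExtendsToProj c U' f' := by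
  obtain ⟨T, hT, hTf⟩ := h
  refine ⟨T, hT, fun φ hc hs => ?_⟩
  rw [hTf φ hc (hs.trans hU)]
  congr 1
  ext z
  by_cases hz : z ∈ tsupport φ.1.1
  · rw [hff (hs hz)]
  · simp [image_eq_zero_of_notMem_tsupport hz]

/-! ### Holomorphic forms on open subsets of a complex line -/

variable {V : Type*} [NormedAddCommGroup V] [NormedSpace ℂ V]

/-- The (not necessarily continuous) `(1,0)`-forms on `U ⊆ V`; the cotangent space is `V^*`. -/
def Forms (U : Set V) : Type _ := U → StrongDual ℂ V

instance (U : Set V) : AddCommGroup (Forms U) :=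
  inferInstanceAs (AddCommGroup (U → StrongDual ℂ V))

instance (U : Set V) : Module ℂ (Forms U) :=
  inferInstanceAs (Module ℂ (U → StrongDual ℂ V))

/-- Extension by zero of a form on `U` to `V`. -/
def extForm {U : Set V} (ω : Forms U) : V → StrongDual ℂ V :=
  Function.extend Subtype.val ω 0

theorem extForm_apply {U : Set V} (ω : Forms U) {z : V} (hz : z ∈ U) :
    extForm ω z = ω ⟨z, hz⟩ :=
  Subtype.val_injective.extend_apply ω 0 ⟨z, hz⟩

theorem extForm_of_notMem {U : Set V} (ω : Forms U) {z : V} (hz : z ∉ U) :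
    extForm ω z = 0 :=
  Function.extend_apply' ω (0 : V → StrongDual ℂ V) z fun ⟨a, h⟩ => hz (h ▸ a.2 : z ∈ U)

theorem extForm_zero {U : Set V} : extForm (0 : Forms U) = 0 := by
  funext z
  by_cases hz : z ∈ U
  · rw [extForm_apply _ hz]; rfl
  · rw [extForm_of_notMem _ hz]; rfl

theorem extForm_add {U : Set V} (ω η : Forms U) :
    extForm (ω + η) = extForm ω + extForm η := by
  funext z
  by_cases hz : z ∈ U
  · rw [Pi.add_apply, extForm_apply _ hz, extForm_apply _ hz, extForm_apply _ hz]; rfl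
  · simp [extForm_of_notMem _ hz]

theorem extForm_smul {U : Set V} (a : ℂ) (ω : Forms U) :
    extForm (a • ω) = a • extForm ω := by
  funext z
  by_cases hz : z ∈ U
  · rw [Pi.smul_apply, extForm_apply _ hz, extForm_apply _ hz]; rfl
  · rw [Pi.smul_apply, extForm_of_notMem _ hz, extForm_of_notMem _ hz]
    exact (smul_zero (A := StrongDual ℂ V) a).symm

/-- `Ω_V(U)`: the holomorphic one-forms on the open set `U`. -/
def holForms (U : Set V) : Submodule ℂ (Forms U) where
  carrier := {ω | ∀ z ∈ U, DifferentiableAt ℂ (extForm ω) z}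
  zero_mem' := fun z _ => by rw [extForm_zero]; exact differentiableAt_const 0
  add_mem' := fun {ω η} h k z hz => by
    rw [extForm_add]; exact (h z hz).add (k z hz)
  smul_mem' := fun a ω h z hz => by
    rw [extForm_smul]; exact (h z hz).const_smul a

/-- The coefficient `u` of `ω = u(z) dz` in the linear coordinate `z = e`. -/
def coeff (e : V ≃L[ℂ] ℂ) {U : Set V} (ω : Forms U) (z : ℂ) : ℂ :=
  extForm ω (e.symm z) (e.symm 1)

theorem coeff_zero (e : V ≃L[ℂ] ℂ) {U : Set V} : coeff e (0 : Forms U) = 0 := by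
  funext z; simp [coeff, extForm_zero]

theorem coeff_add (e : V ≃L[ℂ] ℂ) {U : Set V} (ω η : Forms U) :
    coeff e (ω + η) = coeff e ω + coeff e η := by
  funext z; simp [coeff, extForm_add]

theorem coeff_smul (e : V ≃L[ℂ] ℂ) {U : Set V} (a : ℂ) (ω : Forms U) :
    coeff e (a • ω) = a • coeff e ω := by
  funext z; simp [coeff, extForm_smul]

theorem continuousAt_coeff (e : V ≃L[ℂ] ℂ) {U : Set V} {ω : Forms U}
    (hω : ω ∈ holForms U) {z : ℂ} (hz : e.symm z ∈ U) : ContinuousAt (coeff e ω) z := by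
  have h : ContinuousAt (fun z : ℂ => extForm ω (e.symm z)) z :=
    ContinuousAt.comp (f := fun z : ℂ => e.symm z) (hω _ hz).continuousAt
      e.symm.continuous.continuousAt
  exact h.clm_apply continuousAt_const

/-- `Ω^t_P(U)` for `U ⊆ V` open: the holomorphic one-forms on `U` which extend, as distributional
`(1,0)`-forms, to `P = V ∪ {∞}`. -/
def temperedForms (U : Set V) : Submodule ℂ (Forms U) where
  carrier := {ω | ω ∈ holForms U ∧
    ∀ e : V ≃L[ℂ] ℂ, ExtendsToProj cAntiForm (e '' U) (coeff e ω)}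
  zero_mem' := ⟨zero_mem _, fun e => by rw [coeff_zero]; exact ExtendsToProj.zero _ _⟩
  add_mem' := by
    rintro ω η ⟨h, h'⟩ ⟨k, k'⟩
    refine ⟨add_mem h k, fun e => ?_⟩
    rw [coeff_add]
    refine ExtendsToProj.add ?_ ?_ (h' e) (k' e)
    · rintro _ ⟨z, hz, rfl⟩; exact continuousAt_coeff e h (by simpa using hz)
    · rintro _ ⟨z, hz, rfl⟩; exact continuousAt_coeff e k (by simpa using hz)
  smul_mem' := by
    rintro a ω ⟨h, h'⟩
    refine ⟨Submodule.smul_mem _ a h, fun e => ?_⟩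
    rw [coeff_smul]
    exact (h' e).smul a

/-- `Ω^{t_∞}_P(V \ K)`: the holomorphic one-forms on `V \ K` which are tempered at infinity, i.e.
whose restriction to some punctured neighbourhood `{|z| > R}` of `∞` extends, as a distributional
`(1,0)`-form, to `P = V ∪ {∞}`. (For bounded `K` and large `R`, the condition `z ∉ K` in the
neighbourhood holds automatically.) -/
def temperedAtInftyForms (K : Set V) : Submodule ℂ (Forms (Kᶜ : Set V)) where
  carrier := {ω | ω ∈ holForms Kᶜ ∧ ∀ e : V ≃L[ℂ] ℂ, ∃ R : ℝ,
    ExtendsToProj cAntiForm {z : ℂ | R < ‖z‖ ∧ e.symm z ∉ K} (coeff e ω)}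
  zero_mem' := ⟨zero_mem _, fun e => ⟨0, by rw [coeff_zero]; exact ExtendsToProj.zero _ _⟩⟩
  add_mem' := by
    rintro ω η ⟨h, h'⟩ ⟨k, k'⟩
    refine ⟨add_mem h k, fun e => ?_⟩
    obtain ⟨R, hR⟩ := h' e
    obtain ⟨S, hS⟩ := k' e
    refine ⟨max R S, ?_⟩
    rw [coeff_add]
    refine ExtendsToProj.add ?_ ?_
      (hR.mono (by rintro z ⟨h1, h2⟩; exact ⟨(le_max_left _ _).trans_lt h1, h2⟩) fun _ _ => rfl)
      (hS.mono (by rintro z ⟨h1, h2⟩; exact ⟨(le_max_right _ _).trans_lt h1, h2⟩) fun _ _ => rfl)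
    · rintro z ⟨-, hz⟩; exact continuousAt_coeff e h hz
    · rintro z ⟨-, hz⟩; exact continuousAt_coeff e k hz
  smul_mem' := by
    rintro a ω ⟨h, h'⟩
    refine ⟨Submodule.smul_mem _ a h, fun e => ?_⟩
    obtain ⟨R, hR⟩ := h' e
    refine ⟨R, ?_⟩
    rw [coeff_smul]
    exact hR.smul a

/-- Restriction of forms on `V` to `V \ K`. -/
def restrictForm (K : Set V) :
    Forms (univ : Set V) →ₗ[ℂ] Forms (Kᶜ : Set V) :=
  { toFun := fun ω z => ω ⟨z, mem_univ _⟩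
    map_add' := fun _ _ => rfl
    map_smul' := fun _ _ => rfl }

theorem extForm_restrictForm {K : Set V} (ω : Forms (univ : Set V)) {z : V}
    (hz : z ∉ K) : extForm (restrictForm K ω) z = extForm ω z := by
  rw [extForm_apply _ (show z ∈ Kᶜ from hz), extForm_apply _ (mem_univ z)]
  rfl

/-- Forms in `Ω^t_P(V)` restrict to forms in `Ω^{t_∞}_P(V \ K)`. -/
theorem map_restrictForm_le {K : Set V} (hK : IsClosed K) :
    (temperedForms (univ : Set V)).map (restrictForm K) ≤ temperedAtInftyForms K := by
  rintro _ ⟨ω, ⟨h, h'⟩, rfl⟩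
  refine ⟨fun z hz => ?_, fun e => ⟨0, ?_⟩⟩
  · refine (h z (mem_univ z)).congr_of_eventuallyEq ?_
    filter_upwards [hK.isOpen_compl.mem_nhds hz] with y hy
    exact extForm_restrictForm ω hy
  · refine (h' e).mono (fun z _ => by simp) fun z hz => ?_
    simp only [coeff]
    rw [extForm_restrictForm ω hz.2]

/-- The quotient `Ω^{t_∞}_P(V \ K) / Ω^t_P(V)`, where `Ω^t_P(V)` is viewed in
`Ω^{t_∞}_P(V \ K)` by restriction. -/
abbrev polyaQuotient (K : Set V) : Type _ :=
  temperedAtInftyForms K ⧸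
    (Submodule.submoduleOf ((temperedForms (univ : Set V)).map (restrictForm K)) (temperedAtInftyForms K))

/-- The class in `Ω^{t_∞}_P(V \ K) / Ω^t_P(V)` of a form `ω ∈ Ω^{t_∞}_P(V \ K)`. -/
def polyaClass {K : Set V} (ω : temperedAtInftyForms K) : polyaQuotient K :=
  Submodule.Quotient.mk ω

/-- `Ω^0(V \ K)`: the holomorphic one-forms on `V \ K` tending to `0` at infinity. -/
def formsVanishingAtInfty (K : Set V) : Submodule ℂ (Forms (Kᶜ : Set V)) where
  carrier := {ω | ω ∈ holForms Kᶜ ∧ Tendsto (extForm ω) (Bornology.cobounded V) (𝓝 0)}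
  zero_mem' := ⟨zero_mem _, by rw [extForm_zero]; exact tendsto_const_nhds⟩
  add_mem' := by
    rintro ω η ⟨h, h'⟩ ⟨k, k'⟩
    exact ⟨add_mem h k, by
      rw [extForm_add, ← add_zero (0 : StrongDual ℂ V)]; exact h'.add k'⟩
  smul_mem' := by
    rintro a ω ⟨h, h'⟩
    exact ⟨Submodule.smul_mem _ a h, by
      rw [extForm_smul, ← smul_zero a]; exact h'.const_smul a⟩

/-! ### Entire functions of exponential type on the dual line -/

/-- The support function `h_S(w) = sup_{z ∈ S} Re ⟨z, w⟩`. -/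
def supportFun (S : Set V) (w : StrongDual ℂ V) : ℝ :=
  sSup ((fun z : V => (w z).re) '' S)

/-- The thickening `K_ε = K + closed disc of radius ε`. -/
def thickening (K : Set V) (ε : ℝ) : Set V := K + Metric.closedBall (0 : V) ε

/-- The function `f : W → ℂ` on a complex line `W` is tempered, i.e. it extends, as a distribution,
to `W ∪ {∞}`. -/
def IsTemperedFun {W : Type*} [NormedAddCommGroup W] [NormedSpace ℂ W] (f : W → ℂ) : Prop :=
  ∀ e : W ≃L[ℂ] ℂ, ExtendsToProj cDensity univ (fun z => f (e.symm z))

/-- `v` belongs to `e^f Db^t(W)` for an almost `C^∞`-subanalytic function `f`: the function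
`e^{-g} v` is tempered for `g` in the (ASA)-class of `f`. (The condition does not depend on `g`.) -/
def InExpTempered {W : Type*} [NormedAddCommGroup W] [NormedSpace ℂ W] (f : W → ℝ)
    (v : W → ℂ) : Prop :=
  ∀ g : W → ℝ, InASAClass f g → IsTemperedFun (fun w => (Real.exp (-g w) : ℂ) * v w)

/-- `Exp^t(K)`: the entire functions on `V^*` which lie in `e^{h_{K_ε}} Db^t(V^*)` for all
`ε > 0`. -/
def expTempered (K : Set V) : Submodule ℂ (StrongDual ℂ V → ℂ) where
  carrier := {v | Differentiable ℂ v ∧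
    ∀ ε : ℝ, 0 < ε → InExpTempered (supportFun (thickening K ε)) v}
  zero_mem' := by
    refine ⟨differentiable_const 0, fun ε _ g _ e => ?_⟩
    convert ExtendsToProj.zero cDensity univ using 1
    ext z; simp
  add_mem' := by
    rintro v v' ⟨h, h'⟩ ⟨k, k'⟩
    refine ⟨h.add k, fun ε hε g hg e => ?_⟩
    have hgc : Continuous g := hg.1.continuous
    have hc : ∀ u : StrongDual ℂ V → ℂ, Differentiable ℂ u →
        Continuous fun z : ℂ => (Real.exp (-g (e.symm z)) : ℂ) * u (e.symm z) := fun u hu => by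
      have := hu.continuous
      have := e.symm.continuous
      fun_prop
    convert ExtendsToProj.add (fun z _ => (hc v h).continuousAt)
      (fun z _ => (hc v' k).continuousAt) (h' ε hε g hg e) (k' ε hε g hg e) using 1
    ext z; simp [mul_add]
  smul_mem' := by
    rintro a v ⟨h, h'⟩
    refine ⟨h.const_smul a, fun ε hε g hg e => ?_⟩
    convert (h' ε hε g hg e).smul a using 1
    ext z; simp [mul_left_comm]

/-- `Exp(K)`: the entire functions `v` on `V^*` such that `|v| e^{-h_K - ε ‖·‖}` is bounded for all
`ε > 0`. -/
def expType (K : Set V) : Set (StrongDual ℂ V → ℂ) :=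
  {v | Differentiable ℂ v ∧ ∀ ε : ℝ, 0 < ε →
    ∃ C : ℝ, ∀ w, ‖v w‖ * Real.exp (-supportFun K w - ε * ‖w‖) ≤ C}

end

end Polya

/-! The proof reduces the tempered statement to the classical one with pointwise bounds: for
holomorphic objects, extending across infinity as a distribution amounts to polynomial growth there.

From growth to extension (`ExtendsToProj.of_growth`): a function of size `|z|^n` is paired with a
test section after subtracting the degree `n` Taylor polynomial of the section at infinity. The
integral then converges absolutely, and nothing changes for sections supported away from infinity.
From extension to growth (`ExtendsToProj.exists_norm_le`): the distribution is tested on a small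
bump times the conjugate of the holomorphic function `p`. The pairing is a weighted integral of
`|p|²`, quadratic in the size of `p`, while continuity of order `N` bounds it linearly in that size
and by `N` powers of the inverse radius of the bump. Dividing leaves a pointwise bound for `p`. A
maximum argument (`exists_mem_ball_forall_le`) selects a nearby point around which `p` is controlled
by its own value, at the price of another power of `|z|`.

This has two consequences. A form tempered at infinity is a polynomial form plus a form vanishing at
infinity (`exists_sub_mem_map_restrictForm`), so every class of the quotient has a representative in
`Ω^0`. An entire `v` with `e^{-g} v` tempered is bounded by a polynomial times `e^{h_K + ε‖w‖}`;
since `h_{K_ε} = h_K + ε‖w‖` and polynomials are absorbed by an arbitrarily small exponential,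
`Exp^t(K) = Exp(K)` (`expTempered_eq_expType`).

What remains is Pólya's theorem in a coordinate. The contour integral kills restrictions of forms
holomorphic on `V`, by Cauchy. It lands in `Exp(K)` because the contour can be moved to a large
circle almost tangent to the support line of `K` in the direction of `w`
(`exists_norm_circleIntegral_exp_mul_le`). It is injective on `Ω^0`: if it vanishes, all moments of
`u` vanish, hence so does `u` near infinity by the exterior Cauchy formula, hence everywhere off the
convex set `K` (`eqOn_zero_of_circleIntegral_exp_mul_eq_zero`). It is surjective by the Borel
transform: the Laplace transforms of `v` along rays are holomorphic on the half-planes missing `K`,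
agree on overlaps, and glue to the required form (`exists_circleIntegral_exp_mul_eq`). -/

namespace Polya

noncomputable section

/-! ### Taylor polynomials at the origin. -/

/-- The Taylor polynomial of degree `n` at the origin, as a function. -/
def taylorAtZero (n : ℕ) (f : ℂ → ℂ) (x : ℂ) : ℂ :=
  ∑ k ∈ Finset.range (n + 1), ((k.factorial : ℝ)⁻¹) • iteratedFDeriv ℝ k f 0 (fun _ => x)

theorem iteratedDeriv_comp_smul_const {f : ℂ → ℂ} (hf : ContDiff ℝ (⊤ : ℕ∞) f) (x : ℂ) (k : ℕ)
    (t : ℝ) : iteratedDeriv k (fun s : ℝ => f (s • x)) t =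
      iteratedFDeriv ℝ k f (t • x) (fun _ => x) := by
  have h := ContinuousLinearMap.iteratedFDeriv_comp_right
    (ContinuousLinearMap.toSpanSingleton ℝ x) hf t (i := k) (by exact_mod_cast le_top)
  have h2 : (f ∘ (ContinuousLinearMap.toSpanSingleton ℝ x)) = fun s : ℝ => f (s • x) := by
    ext s; simp
  rw [iteratedDeriv_eq_iteratedFDeriv, ← h2, h]
  simp [ContinuousMultilinearMap.compContinuousLinearMap_apply]

/-- One-variable Taylor with remainder along the segment `s ↦ s • x`, `0 ≤ s ≤ 1`. The bound is
needed only on the unit disc, where the seminorms of `IsDistribution` live. -/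
theorem norm_sub_taylorAtZero_le {f : ℂ → ℂ} (hf : ContDiff ℝ (⊤ : ℕ∞) f) {n : ℕ} {B : ℝ}
    (hB : ∀ z : ℂ, ‖z‖ ≤ 1 → ‖iteratedFDeriv ℝ (n + 1) f z‖ ≤ B) {x : ℂ} (hx : ‖x‖ ≤ 1) :
    ‖f x - taylorAtZero n f x‖ ≤ B * ‖x‖ ^ (n + 1) := by
  have hg : ContDiff ℝ (⊤ : ℕ∞) (fun s : ℝ => f (s • x)) := by fun_prop
  have hD : ∀ k : ℕ, ∀ t ∈ Icc (0 : ℝ) 1,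
      iteratedDerivWithin k (fun s : ℝ => f (s • x)) (Icc 0 1) t =
        iteratedFDeriv ℝ k f (t • x) (fun _ => x) := fun k t ht => by
    rw [iteratedDerivWithin_eq_iteratedDeriv (uniqueDiffOn_Icc zero_lt_one)
      (hg.of_le (by exact_mod_cast le_top)).contDiffAt ht, iteratedDeriv_comp_smul_const hf]
  have h := taylor_mean_remainder_bound (f := fun s : ℝ => f (s • x)) (a := 0) (b := 1)
    (x := 1) (n := n) (C := B * ‖x‖ ^ (n + 1)) zero_le_one
    ((hg.of_le (by exact_mod_cast le_top)).contDiffOn) (by simp) (by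
      intro t ht
      rw [hD _ t ht]
      refine (ContinuousMultilinearMap.le_opNorm _ _).trans ?_
      simp only [Finset.prod_const, Finset.card_univ, Fintype.card_fin]
      gcongr
      refine hB _ ?_
      rw [norm_smul, Real.norm_eq_abs, abs_of_nonneg ht.1]
      exact mul_le_one₀ ht.2 (norm_nonneg _) hx)
  have h2 : taylorWithinEval (fun s : ℝ => f (s • x)) n (Icc 0 1) 0 1 = taylorAtZero n f x := by
    rw [taylor_within_apply, taylorAtZero]
    refine Finset.sum_congr rfl fun k _ => ?_
    rw [hD k 0 (by simp)]
    simp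
  rw [h2] at h
  simp only [one_smul, sub_zero, one_pow, mul_one] at h
  refine h.trans (div_le_self ?_ (by exact_mod_cast Nat.one_le_iff_ne_zero.2 n.factorial_ne_zero))
  exact mul_nonneg ((norm_nonneg _).trans (hB 0 (by simp))) (by positivity)

theorem taylorAtZero_add {f g : ℂ → ℂ} (hf : ContDiff ℝ (⊤ : ℕ∞) f) (hg : ContDiff ℝ (⊤ : ℕ∞) g)
    (n : ℕ) (x : ℂ) : taylorAtZero n (f + g) x = taylorAtZero n f x + taylorAtZero n g x := by
  simp only [taylorAtZero]
  rw [← Finset.sum_add_distrib]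
  refine Finset.sum_congr rfl fun k _ => ?_
  rw [iteratedFDeriv_add_apply (hf.of_le (by exact_mod_cast le_top)).contDiffAt
    (hg.of_le (by exact_mod_cast le_top)).contDiffAt]
  simp

theorem taylorAtZero_smul {f : ℂ → ℂ} (hf : ContDiff ℝ (⊤ : ℕ∞) f) (a : ℂ)
    (n : ℕ) (x : ℂ) : taylorAtZero n (a • f) x = a * taylorAtZero n f x := by
  simp only [taylorAtZero]
  rw [Finset.mul_sum]
  refine Finset.sum_congr rfl fun k _ => ?_
  rw [iteratedFDeriv_const_smul_apply (hf.of_le (by exact_mod_cast le_top)).contDiffAt]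
  simp only [smul_apply, smul_eq_mul, mul_smul_comm]

theorem taylorAtZero_of_eventuallyEq_zero {f : ℂ → ℂ} (hf : f =ᶠ[𝓝 0] 0) (n : ℕ) (x : ℂ) :
    taylorAtZero n f x = 0 := by
  refine Finset.sum_eq_zero fun k _ => ?_
  rw [(hf.iteratedFDeriv ℝ k).eq_of_nhds]
  simp

theorem continuous_taylorAtZero (n : ℕ) (f : ℂ → ℂ) : Continuous (taylorAtZero n f) := by
  unfold taylorAtZero
  refine continuous_finsetSum _ fun k _ => ?_
  have h : Continuous fun x : ℂ => iteratedFDeriv ℝ k f 0 fun _ => x :=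
    (ContinuousMultilinearMap.cont _).comp (by fun_prop)
  exact h.const_smul ((k.factorial : ℝ)⁻¹)

/-! ### Polynomial growth gives an extension across infinity. -/

theorem integrable_one_add_norm_pow_three : Integrable fun z : ℂ => ((1 + ‖z‖) ^ 3)⁻¹ := by
  have h : Integrable fun z : ℂ => (1 + ‖z‖) ^ (-3 : ℝ) :=
    integrable_one_add_norm (by rw [Complex.finrank_real_complex]; norm_num)
  refine h.congr (Eventually.of_forall fun z => ?_)
  have : (0 : ℝ) ≤ 1 + ‖z‖ := by positivity
  simp only
  rw [Real.rpow_neg this]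
  norm_cast

/-- A linear family of integrands which is bounded by finitely many derivatives of the test section
and decays like `|z|⁻³` defines a distribution. -/
theorem exists_isDistribution_integral {c : ℂ → ℂ} (A : testSections c →ₗ[ℂ] ℂ → ℂ)
    (hm : ∀ φ, AEStronglyMeasurable (A φ)) (N : ℕ) (C : ℝ)
    (hA : ∀ (φ : testSections c) (B : ℝ),
      (∀ k ≤ N, ∀ z : ℂ, ‖z‖ ≤ 1 →
        ‖iteratedFDeriv ℝ k φ.1.1 z‖ ≤ B ∧ ‖iteratedFDeriv ℝ k φ.1.2 z‖ ≤ B) →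
      ∀ z, ‖A φ z‖ ≤ C * B * ((1 + ‖z‖) ^ 3)⁻¹) :
    ∃ T : testSections c →ₗ[ℂ] ℂ, IsDistribution c T ∧ ∀ φ, T φ = ∫ z, A φ z := by
  have hB : ∀ φ : testSections c, ∃ B : ℝ, ∀ k ≤ N, ∀ z : ℂ, ‖z‖ ≤ 1 →
      ‖iteratedFDeriv ℝ k φ.1.1 z‖ ≤ B ∧ ‖iteratedFDeriv ℝ k φ.1.2 z‖ ≤ B := by
    intro φ
    have hk : ∀ k : ℕ, ∃ B : ℝ, 0 ≤ B ∧ ∀ z : ℂ, ‖z‖ ≤ 1 →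
        ‖iteratedFDeriv ℝ k φ.1.1 z‖ ≤ B ∧ ‖iteratedFDeriv ℝ k φ.1.2 z‖ ≤ B := by
      intro k
      obtain ⟨B₁, h₁⟩ := (isCompact_closedBall (0 : ℂ) 1).exists_bound_of_continuousOn
        (φ.2.1.continuous_iteratedFDeriv (m := k) (by exact_mod_cast le_top)).continuousOn
      obtain ⟨B₂, h₂⟩ := (isCompact_closedBall (0 : ℂ) 1).exists_bound_of_continuousOn
        (φ.2.2.1.continuous_iteratedFDeriv (m := k) (by exact_mod_cast le_top)).continuousOn
      refine ⟨max 0 (max B₁ B₂), le_max_left _ _, fun z hz => ⟨(h₁ z (by simpa using hz)).trans ?_,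
        (h₂ z (by simpa using hz)).trans ?_⟩⟩ <;> simp
    choose B hB0 hB using hk
    refine ⟨∑ k ∈ Finset.range (N + 1), B k, fun k hk z hz => ?_⟩
    have := Finset.single_le_sum (f := B) (fun i _ => hB0 i) (Finset.mem_range.2 (Nat.lt_succ_of_le hk))
    exact ⟨(hB k z hz).1.trans this, (hB k z hz).2.trans this⟩
  have hi : ∀ φ, Integrable (A φ) := by
    intro φ
    obtain ⟨B, hB⟩ := hB φ
    exact (integrable_one_add_norm_pow_three.const_mul (C * B)).mono' (hm φ)
      (Eventually.of_forall (hA φ B hB))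
  refine ⟨{ toFun := fun φ => ∫ z, A φ z
            map_add' := fun φ ψ => ?_
            map_smul' := fun a φ => ?_ }, ?_, fun φ => rfl⟩
  · rw [map_add]; exact integral_add (hi φ) (hi ψ)
  · rw [map_smul]; exact integral_const_mul a (A φ)
  · refine ⟨N, C * ∫ z : ℂ, ((1 + ‖z‖) ^ 3)⁻¹, fun φ B hB => ?_⟩
    have := norm_integral_le_of_norm_le (integrable_one_add_norm_pow_three.const_mul (C * B))
      (Eventually.of_forall (hA φ B hB))
    rw [integral_const_mul] at this
    refine this.trans (le_of_eq ?_)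
    ring

/-- A continuous function of polynomial growth extends to a distribution on `ℂ ∪ {∞}`. -/
theorem ExtendsToProj.of_growth {c : ℂ → ℂ} {U : Set ℂ} {f : ℂ → ℂ} (hcm : Measurable c)
    (hc : ∀ ζ, ζ ≠ 0 → ‖ζ‖ ≤ 1 → c ζ ≠ 0 ∧ ‖(c ζ)⁻¹‖ ≤ ‖ζ‖ ^ 2) (hU : IsOpen U)
    (hf : ContinuousOn f U) {C : ℝ} {n : ℕ} (hb : ∀ z ∈ U, ‖f z‖ ≤ C * (1 + ‖z‖) ^ n) :
    ExtendsToProj c U f := by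
  -- The factor carrying the chart at infinity to the chart `z`, cut off to `|z| > 1` so that the
  -- Taylor correction acts only near infinity.
  set b : ℂ → ℂ := (Metric.closedBall 0 1)ᶜ.indicator fun z => (c z⁻¹)⁻¹ with hbdef
  have hbm : Measurable b :=
    ((hcm.comp measurable_inv).inv).indicator Metric.isClosed_closedBall.measurableSet.compl
  have hb1 : ∀ z, ‖z‖ ≤ 1 → b z = 0 := fun z hz => by
    simp [hbdef, hz]
  have hb2 : ∀ z, 1 < ‖z‖ → b z = (c z⁻¹)⁻¹ := fun z hz => by
    simp [hbdef, hz]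
  -- Regularization: for `|z| > 1` the bracket is `(c z⁻¹)⁻¹` times a Taylor remainder in `z⁻¹`,
  -- hence `O(|z|⁻² |z|^{-(n+1)})`. Against a factor of size `|z|^n` this leaves `|z|⁻³`, integrable
  -- on the plane.
  let A : testSections c →ₗ[ℂ] ℂ → ℂ :=
    { toFun := fun φ z => U.indicator f z * (φ.1.1 z - b z * taylorAtZero n φ.1.2 z⁻¹)
      map_add' := fun φ ψ => by
        ext z
        simp only [Submodule.coe_add, Prod.fst_add, Prod.snd_add, Pi.add_apply]
        rw [taylorAtZero_add φ.2.2.1 ψ.2.2.1]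
        ring
      map_smul' := fun a φ => by
        ext z
        simp only [Submodule.coe_smul, Prod.smul_fst, Prod.smul_snd, Pi.smul_apply, smul_eq_mul,
          RingHom.id_apply]
        rw [taylorAtZero_smul φ.2.2.1]
        ring }
  have hfm : Measurable (U.indicator f) := by
    refine measurable_of_restrict_of_restrict_compl hU.measurableSet ?_ ?_
    · have : U.domRestrict (U.indicator f) = U.domRestrict f := by
        ext z; exact Set.indicator_of_mem z.2 f
      rw [this]
      exact (continuousOn_iff_continuous_domRestrict.1 hf).measurable
    · have : Uᶜ.domRestrict (U.indicator f) = fun _ => 0 := by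
        ext z; exact Set.indicator_of_notMem z.2 f
      rw [this]
      exact measurable_const
  have hC : ∀ z, ‖U.indicator f z‖ ≤ |C| * (1 + ‖z‖) ^ n := fun z => by
    by_cases hz : z ∈ U
    · rw [Set.indicator_of_mem hz]
      refine (hb z hz).trans ?_
      gcongr
      exact le_abs_self C
    · rw [Set.indicator_of_notMem hz, norm_zero]; positivity
  obtain ⟨T, hT, hTA⟩ := exists_isDistribution_integral A (fun φ => by
    have h1 : Measurable φ.1.1 := φ.2.1.continuous.measurable
    have h2 : Measurable fun z => taylorAtZero n φ.1.2 z⁻¹ :=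
      (continuous_taylorAtZero n _).measurable.comp measurable_inv
    exact (hfm.mul (h1.sub (hbm.mul h2))).aestronglyMeasurable) (n + 1) (|C| * 2 ^ n * 8) (by
    intro φ B hB z
    have hB0 : 0 ≤ B := (norm_nonneg _).trans (hB 0 (Nat.zero_le _) 0 (by simp)).1
    have hkey : ‖φ.1.1 z - b z * taylorAtZero n φ.1.2 z⁻¹‖ * (1 + ‖z‖) ^ n
        ≤ 2 ^ n * 8 * B * ((1 + ‖z‖) ^ 3)⁻¹ := by
      rcases le_or_gt ‖z‖ 1 with hz | hz
      · rw [hb1 z hz, zero_mul, sub_zero]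
        have h1 : ‖φ.1.1 z‖ ≤ B := by simpa using (hB 0 (Nat.zero_le _) z hz).1
        have h2 : (1 + ‖z‖) ^ n ≤ 2 ^ n := by gcongr; linarith
        have h3 : (1 : ℝ) ≤ 8 * ((1 + ‖z‖) ^ 3)⁻¹ := by
          rw [← div_eq_mul_inv, one_le_div (by positivity)]
          calc (1 + ‖z‖) ^ 3 ≤ 2 ^ 3 := by gcongr; linarith
            _ = 8 := by norm_num
        calc ‖φ.1.1 z‖ * (1 + ‖z‖) ^ n ≤ B * 2 ^ n := by gcongr
          _ ≤ B * 2 ^ n * (8 * ((1 + ‖z‖) ^ 3)⁻¹) := le_mul_of_one_le_right (by positivity) h3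
          _ = _ := by ring
      · have hz0 : z ≠ 0 := norm_pos_iff.1 (by linarith)
        have hzi : ‖z⁻¹‖ ≤ 1 := by rw [norm_inv]; exact inv_le_one_of_one_le₀ hz.le
        obtain ⟨hc0, hc1⟩ := hc z⁻¹ (inv_ne_zero hz0) hzi
        have hφ : φ.1.1 z = (c z⁻¹)⁻¹ * φ.1.2 z⁻¹ := by
          rw [φ.2.2.2 z⁻¹ (inv_ne_zero hz0), inv_inv, inv_mul_cancel_left₀ hc0]
        rw [hb2 z hz, hφ, ← mul_sub, norm_mul]
        have h1 := norm_sub_taylorAtZero_le φ.2.2.1 (n := n) (B := B)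
          (fun z hz => (hB (n + 1) le_rfl z hz).2) hzi
        have h2 : (1 + ‖z‖) ^ n ≤ (2 * ‖z‖) ^ n := by gcongr; linarith
        have h3 : (‖z‖ ^ 3)⁻¹ ≤ 8 * ((1 + ‖z‖) ^ 3)⁻¹ := by
          rw [← div_eq_mul_inv, inv_eq_one_div, div_le_div_iff₀ (by positivity) (by positivity)]
          calc 1 * (1 + ‖z‖) ^ 3 ≤ 1 * (2 * ‖z‖) ^ 3 := by gcongr; linarith
            _ = _ := by ring
        have hzp : 0 < ‖z‖ := by linarith
        calc ‖(c z⁻¹)⁻¹‖ * ‖φ.1.2 z⁻¹ - taylorAtZero n φ.1.2 z⁻¹‖ * (1 + ‖z‖) ^ n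
            ≤ ‖z⁻¹‖ ^ 2 * (B * ‖z⁻¹‖ ^ (n + 1)) * (2 * ‖z‖) ^ n := by gcongr
          _ = 2 ^ n * B * (‖z‖ ^ 3)⁻¹ := by
            rw [norm_inv, mul_pow, inv_pow, inv_pow]; field_simp; ring
          _ ≤ 2 ^ n * B * (8 * ((1 + ‖z‖) ^ 3)⁻¹) := by gcongr
          _ = _ := by ring
    calc ‖A φ z‖ = ‖U.indicator f z‖ * ‖φ.1.1 z - b z * taylorAtZero n φ.1.2 z⁻¹‖ := norm_mul _ _
      _ ≤ |C| * (1 + ‖z‖) ^ n * ‖φ.1.1 z - b z * taylorAtZero n φ.1.2 z⁻¹‖ := by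
        gcongr; exact hC z
      _ = |C| * (‖φ.1.1 z - b z * taylorAtZero n φ.1.2 z⁻¹‖ * (1 + ‖z‖) ^ n) := by ring
      _ ≤ |C| * (2 ^ n * 8 * B * ((1 + ‖z‖) ^ 3)⁻¹) := by gcongr
      _ = _ := by ring)
  refine ⟨T, hT, fun φ hφc hφU => ?_⟩
  -- For compactly supported `φ.1.1` the section vanishes near infinity, at the point itself by
  -- continuity. Its Taylor polynomial there is zero, so the correction disappears and `T` is
  -- integration against `f`.
  have h0 : φ.1.2 =ᶠ[𝓝 0] 0 := by
    obtain ⟨R, hR0, hR⟩ := hφc.isBounded.exists_pos_norm_le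
    have : Metric.ball (0 : ℂ) R⁻¹ ∈ 𝓝 (0 : ℂ) := Metric.ball_mem_nhds _ (by positivity)
    have hφ' : ∀ ζ ∈ Metric.ball (0 : ℂ) R⁻¹, ζ ≠ 0 → φ.1.2 ζ = 0 := by
      intro ζ hζ hζ0
      rw [φ.2.2.2 ζ hζ0, image_eq_zero_of_notMem_tsupport (f := φ.1.1), mul_zero]
      intro hmem
      have := hR _ hmem
      rw [norm_inv] at this
      rw [mem_ball_zero_iff] at hζ
      have h3 := (lt_inv_comm₀ (norm_pos_iff.2 hζ0) hR0).1 hζ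
      linarith
    filter_upwards [this] with ζ hζ
    by_cases hζ0 : ζ = 0
    · subst hζ0
      have hlim : Tendsto φ.1.2 (𝓝[≠] 0) (𝓝 (φ.1.2 0)) :=
        φ.2.2.1.continuous.continuousAt.tendsto.mono_left nhdsWithin_le_nhds
      refine tendsto_nhds_unique hlim (tendsto_const_nhds.congr' ?_)
      filter_upwards [mem_nhdsWithin_of_mem_nhds this, self_mem_nhdsWithin] with ξ h1 h2
      exact (hφ' ξ h1 h2).symm
    · exact hφ' ζ hζ hζ0
  rw [hTA]
  congr 1
  ext z
  change U.indicator f z * (φ.1.1 z - b z * taylorAtZero n φ.1.2 z⁻¹) = _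
  rw [taylorAtZero_of_eventuallyEq_zero h0, mul_zero, sub_zero]
  by_cases hz : z ∈ U
  · rw [Set.indicator_of_mem hz]
  · rw [image_eq_zero_of_notMem_tsupport fun h => hz (hφU h)]; simp

theorem measurable_cDensity : Measurable cDensity := by
  unfold cDensity; fun_prop

theorem measurable_cAntiForm : Measurable cAntiForm := by
  unfold cAntiForm
  exact ((Complex.continuous_conj.measurable.pow_const 2).inv).neg

theorem norm_inv_cDensity_le {ζ : ℂ} (h0 : ζ ≠ 0) (h1 : ‖ζ‖ ≤ 1) :
    cDensity ζ ≠ 0 ∧ ‖(cDensity ζ)⁻¹‖ ≤ ‖ζ‖ ^ 2 := by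
  have : ‖ζ‖ ≠ 0 := norm_ne_zero_iff.2 h0
  refine ⟨by unfold cDensity; exact_mod_cast inv_ne_zero (pow_ne_zero _ this), ?_⟩
  unfold cDensity
  rw [← Complex.ofReal_inv, inv_inv, Complex.norm_real, Real.norm_eq_abs, abs_of_nonneg (by positivity)]
  exact pow_le_pow_of_le_one (norm_nonneg _) h1 (by norm_num)

theorem norm_inv_cAntiForm_le {ζ : ℂ} (h0 : ζ ≠ 0) :
    cAntiForm ζ ≠ 0 ∧ ‖(cAntiForm ζ)⁻¹‖ ≤ ‖ζ‖ ^ 2 := by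
  refine ⟨by unfold cAntiForm; simpa using h0, ?_⟩
  unfold cAntiForm
  simp

/-! ### Cauchy estimates and bump test functions. -/

theorem fderiv_real_eq_mul_deriv {f : ℂ → ℂ} {z : ℂ} (hf : DifferentiableAt ℂ f z) :
    fderiv ℝ f z = ContinuousLinearMap.mul ℝ ℂ (deriv f z) := by
  rw [(hf.hasDerivAt.hasFDerivAt.restrictScalars ℝ).fderiv]
  ext x
  simp [mul_comm]

/-- Cauchy estimates for the real derivatives of a holomorphic function. -/
theorem exists_norm_iteratedFDeriv_le_of_holomorphic (k : ℕ) : ∀ r : ℝ, 0 < r →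
    ∃ A : ℝ, 0 ≤ A ∧ ∀ (f : ℂ → ℂ) (x : ℂ) (M : ℝ), DifferentiableOn ℂ f (Metric.ball x r) →
      (∀ z ∈ Metric.ball x r, ‖f z‖ ≤ M) → ‖iteratedFDeriv ℝ k f x‖ ≤ A * M := by
  induction k with
  | zero =>
    intro r hr
    refine ⟨1, zero_le_one, fun f x M _ hM => ?_⟩
    simpa using hM x (Metric.mem_ball_self hr)
  | succ k ih =>
    intro r hr
    obtain ⟨A, hA0, hA⟩ := ih (r / 2) (by positivity)
    -- The real derivative is multiplication by `deriv f`, so the induction applies to `deriv f` on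
    -- the half-size disc. There Cauchy's estimate may use circles of radius `r / 4`, since `r / 2 +
    -- r / 4 < r`.
    refine ⟨A * (r / 4)⁻¹, by positivity, fun f x M hf hM => ?_⟩
    have hd : DifferentiableOn ℂ (deriv f) (Metric.ball x r) := hf.deriv Metric.isOpen_ball
    have hxr : Metric.ball x (r / 2) ⊆ Metric.ball x r := Metric.ball_subset_ball (by linarith)
    have h1 := hA (deriv f) x (M / (r / 4)) (hd.mono hxr) (by
      intro y hy
      have hy' : Metric.closedBall y (r / 4) ⊆ Metric.ball x r := by
        intro w hw
        rw [Metric.mem_ball] at hy ⊢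
        rw [Metric.mem_closedBall] at hw
        linarith [dist_triangle w y x]
      refine Complex.norm_deriv_le_of_forall_mem_sphere_norm_le (by positivity) ?_
        fun w hw => hM w (hy' (Metric.sphere_subset_closedBall hw))
      refine DifferentiableOn.diffContOnCl ?_
      rw [closure_ball _ (by positivity)]
      exact hf.mono hy')
    rw [← norm_iteratedFDeriv_fderiv]
    have hev : fderiv ℝ f =ᶠ[𝓝 x] (ContinuousLinearMap.mul ℝ ℂ) ∘ deriv f := by
      filter_upwards [Metric.ball_mem_nhds x hr] with y hy
      exact fderiv_real_eq_mul_deriv (hf.differentiableAt (Metric.isOpen_ball.mem_nhds hy))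
    rw [(hev.iteratedFDeriv ℝ k).eq_of_nhds]
    have hc : ContDiffAt ℝ k (deriv f) x :=
      ((hd.analyticAt (Metric.ball_mem_nhds x hr)).contDiffAt (n := k)).restrict_scalars ℝ
    refine (ContinuousLinearMap.norm_iteratedFDeriv_comp_left _ hc le_rfl).trans ?_
    calc ‖ContinuousLinearMap.mul ℝ ℂ‖ * ‖iteratedFDeriv ℝ k (deriv f) x‖
        ≤ 1 * (A * (M / (r / 4))) := by
          gcongr
          exact ContinuousLinearMap.opNorm_mul_le ℝ ℂ
      _ = _ := by rw [one_mul, div_eq_mul_inv]; ring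

/-- A smooth bump function at the origin, equal to `1` on the disc of radius `1 / 2` and vanishing
outside of the unit disc. -/
def unitBump : ContDiffBump (0 : ℂ) := ⟨1 / 2, 1, by norm_num, by norm_num⟩

/-- The product of the unit bump function with the conjugate of `P`. -/
def bumpConj (P : ℂ → ℂ) (ξ : ℂ) : ℂ := (unitBump ξ : ℂ) * (starRingEnd ℂ) (P ξ)

theorem bumpConj_eq_zero {P : ℂ → ℂ} {ξ : ℂ} (h : 1 ≤ ‖ξ‖) : bumpConj P ξ = 0 := by
  rw [bumpConj, unitBump.zero_of_le_dist (by simpa [unitBump] using h)]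
  simp

theorem contDiffOn_conj_comp {P : ℂ → ℂ} {s : Set ℂ} (hs : IsOpen s) (hP : DifferentiableOn ℂ P s)
    {n : WithTop ℕ∞} : ContDiffOn ℝ n (fun z => (starRingEnd ℂ) (P z)) s :=
  Complex.conjCLE.contDiff.comp_contDiffOn ((hP.contDiffOn hs).restrict_scalars ℝ)

theorem contDiff_ofReal_unitBump {n : ℕ∞} : ContDiff ℝ n (fun ξ => (unitBump ξ : ℂ)) :=
  Complex.ofRealCLM.contDiff.comp unitBump.contDiff

theorem contDiff_bumpConj {P : ℂ → ℂ} (hP : DifferentiableOn ℂ P (Metric.ball 0 2)) :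
    ContDiff ℝ (⊤ : ℕ∞) (bumpConj P) := by
  rw [contDiff_iff_contDiffAt]
  intro ξ
  by_cases h : ξ ∈ Metric.ball (0 : ℂ) 2
  · exact contDiff_ofReal_unitBump.contDiffAt.mul
      ((contDiffOn_conj_comp Metric.isOpen_ball hP).contDiffAt (Metric.isOpen_ball.mem_nhds h))
  · have h0 : bumpConj P =ᶠ[𝓝 ξ] fun _ => 0 := by
      have : {y : ℂ | 1 < ‖y‖} ∈ 𝓝 ξ := by
        refine (isOpen_lt continuous_const continuous_norm).mem_nhds ?_
        simp only [mem_ball_zero_iff, not_lt] at h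
        simp only [mem_ofPred_eq]; linarith
      filter_upwards [this] with y hy
      exact bumpConj_eq_zero (le_of_lt hy)
    exact contDiffAt_const.congr_of_eventuallyEq h0

/-- The constant does not depend on `P`: by Leibniz, derivatives of the fixed bump are multiplied by
derivatives of `P`, which the Cauchy estimates on discs of radius 1 bound by the supremum of `P`.
The conjugate is there so that pairing with `P` produces `|P|²`, with no cancellation. -/
theorem exists_norm_iteratedFDeriv_bumpConj_le (k : ℕ) :
    ∃ A : ℝ, 0 ≤ A ∧ ∀ (P : ℂ → ℂ) (M : ℝ), DifferentiableOn ℂ P (Metric.ball 0 2) →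
      (∀ z ∈ Metric.ball (0 : ℂ) 2, ‖P z‖ ≤ M) → ∀ ξ, ‖iteratedFDeriv ℝ k (bumpConj P) ξ‖ ≤ A * M := by
  have hb : ∀ i : ℕ, ∃ D : ℝ, 0 ≤ D ∧ ∀ ξ ∈ Metric.closedBall (0 : ℂ) 1,
      ‖iteratedFDeriv ℝ i (fun ξ => (unitBump ξ : ℂ)) ξ‖ ≤ D := by
    intro i
    obtain ⟨D, hD⟩ := (isCompact_closedBall (0 : ℂ) 1).exists_bound_of_continuousOn
      ((contDiff_ofReal_unitBump (n := ⊤)).continuous_iteratedFDeriv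
        (m := i) (by exact_mod_cast le_top)).continuousOn
    exact ⟨D, (norm_nonneg _).trans (hD 0 (by simp)), hD⟩
  choose D hD0 hD using hb
  choose E hE0 hE using fun i => exists_norm_iteratedFDeriv_le_of_holomorphic i 1 one_pos
  have hA0 : 0 ≤ ∑ i ∈ Finset.range (k + 1), (k.choose i : ℝ) * D i * E (k - i) :=
    Finset.sum_nonneg fun i _ => mul_nonneg (mul_nonneg (by positivity) (hD0 i)) (hE0 _)
  refine ⟨_, hA0, fun P M hP hM ξ => ?_⟩
  have hM0 : 0 ≤ M := (norm_nonneg _).trans (hM 0 (by simp))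
  by_cases hξ : ξ ∈ Metric.closedBall (0 : ℂ) 1
  · have hξ2 : ξ ∈ Metric.ball (0 : ℂ) 2 := Metric.closedBall_subset_ball (by norm_num) hξ
    have h1 := norm_iteratedFDerivWithin_mul_le (𝕜 := ℝ) (N := (⊤ : ℕ∞))
      (contDiff_ofReal_unitBump.contDiffOn (s := Metric.ball (0 : ℂ) 2))
      (contDiffOn_conj_comp Metric.isOpen_ball hP) Metric.isOpen_ball.uniqueDiffOn hξ2
      (n := k) (by exact_mod_cast le_top)
    rw [iteratedFDerivWithin_of_isOpen k Metric.isOpen_ball hξ2] at h1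
    refine h1.trans ?_
    rw [Finset.sum_mul]
    refine Finset.sum_le_sum fun i _ => ?_
    rw [iteratedFDerivWithin_of_isOpen i Metric.isOpen_ball hξ2,
      iteratedFDerivWithin_of_isOpen (k - i) Metric.isOpen_ball hξ2]
    have h2 : ‖iteratedFDeriv ℝ (k - i) (fun z => (starRingEnd ℂ) (P z)) ξ‖ ≤ E (k - i) * M := by
      have := LinearIsometryEquiv.norm_iteratedFDeriv_comp_left (𝕜 := ℝ) Complex.conjLIE P ξ (k - i)
      have hball : Metric.ball ξ 1 ⊆ Metric.ball (0 : ℂ) 2 := by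
        intro y hy
        rw [Metric.mem_ball] at hy ⊢
        rw [Metric.mem_closedBall] at hξ
        linarith [dist_triangle y ξ 0]
      calc _ = ‖iteratedFDeriv ℝ (k - i) P ξ‖ := this
        _ ≤ _ := hE (k - i) P ξ M (hP.mono hball) fun z hz => hM z (hball hz)
    calc _ ≤ (k.choose i : ℝ) * D i * (E (k - i) * M) := by
          gcongr
          · exact mul_nonneg (by positivity) (hD0 i)
          · exact hD i ξ hξ
      _ = _ := by ring
  · have h0 : bumpConj P =ᶠ[𝓝 ξ] 0 := by
      filter_upwards [Metric.isClosed_closedBall.isOpen_compl.mem_nhds hξ] with y hy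
      refine bumpConj_eq_zero ?_
      simp only [mem_compl_iff, mem_closedBall_zero_iff, not_le] at hy
      exact hy.le
    rw [(h0.iteratedFDeriv ℝ k).eq_of_nhds]
    change ‖iteratedFDeriv ℝ k (fun _ => (0 : ℂ)) ξ‖ ≤ _
    rw [iteratedFDeriv_fun_zero, Pi.zero_apply, norm_zero]
    positivity

theorem norm_iteratedFDeriv_comp_affine {ψ : ℂ → ℂ} (hψ : ContDiff ℝ (⊤ : ℕ∞) ψ) (k : ℕ) (δ : ℝ)
    (hδ : 0 ≤ δ) (x ζ : ℂ) :
    ‖iteratedFDeriv ℝ k (fun ζ => ψ (δ • (ζ - x))) ζ‖ = δ ^ k * ‖iteratedFDeriv ℝ k ψ (δ • (ζ - x))‖ := by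
  have h1 := iteratedFDeriv_comp_const_smul (𝕜 := ℝ) (i := k) δ
    (hψ.of_le (by exact_mod_cast le_top))
  have h2 := iteratedFDeriv_comp_sub (𝕜 := ℝ) (f := fun z => ψ (δ • z)) k x ζ
  rw [h2, h1, norm_smul, norm_pow, Real.norm_eq_abs, abs_of_nonneg hδ]

/-! ### An extension across infinity gives polynomial growth. -/

/-- Given a positive function on a ball, there is a point of the ball at which the function is large
and around which it does not oscillate, on a scale comparable to the distance to the boundary. -/
theorem exists_mem_ball_forall_le {G : ℂ → ℝ} {x : ℂ} {ρ : ℝ} (hρ : 0 < ρ)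
    (hG : ContinuousOn G (Metric.closedBall x ρ)) (hG0 : ∀ z ∈ Metric.closedBall x ρ, 0 ≤ G z)
    (hx : 0 < G x) {L : ℕ} (hL : L ≠ 0) :
    ∃ (y : ℂ) (d : ℝ), 0 < d ∧ d ≤ ρ ∧ Metric.ball y d ⊆ Metric.ball x ρ ∧
      G x * ρ ^ L ≤ G y * d ^ L ∧ ∀ z ∈ Metric.ball y (d / 2), G z ≤ 2 ^ L * G y := by
  -- Maximize `G` times the `L`-th power of the distance to the boundary. Comparing the maximum with
  -- the center gives the lower bound at `y`. On the half-size disc around `y` the distance to the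
  -- boundary is at least half of that at `y`, whence the factor `2 ^ L`.
  obtain ⟨y, hy, hmax⟩ := (isCompact_closedBall x ρ).exists_isMaxOn
    ⟨x, Metric.mem_closedBall_self hρ.le⟩
    (hG.mul (((continuous_const (y := ρ)).sub (continuous_id.dist continuous_const)).continuousOn.pow L))
  have hmax' : ∀ z ∈ Metric.closedBall x ρ, G z * (ρ - dist z x) ^ L ≤ G y * (ρ - dist y x) ^ L :=
    fun z hz => hmax hz
  have h1 := hmax' x (Metric.mem_closedBall_self hρ.le)
  rw [dist_self, sub_zero] at h1
  have hd : 0 < ρ - dist y x := by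
    rcases (sub_nonneg.2 (Metric.mem_closedBall.1 hy)).lt_or_eq with h | h
    · exact h
    · exfalso
      rw [← h, zero_pow hL, mul_zero] at h1
      exact absurd h1 (not_le.2 (by positivity))
  have hsub : Metric.ball y (ρ - dist y x) ⊆ Metric.ball x ρ :=
    Metric.ball_subset_ball' (by linarith)
  refine ⟨y, ρ - dist y x, hd, by linarith [dist_nonneg (x := y) (y := x)], hsub, h1, fun z hz => ?_⟩
  have hz' : z ∈ Metric.ball y (ρ - dist y x) := Metric.ball_subset_ball (by linarith) hz
  have h2 := hmax' z (Metric.ball_subset_closedBall (hsub hz'))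
  rw [Metric.mem_ball] at hz
  have h3 : (ρ - dist y x) / 2 ≤ ρ - dist z x := by linarith [dist_triangle z y x]
  have h4 : G z * ((ρ - dist y x) / 2) ^ L ≤ G y * (ρ - dist y x) ^ L := by
    refine le_trans ?_ h2
    have := hG0 z (Metric.ball_subset_closedBall (hsub hz'))
    gcongr
  rw [div_pow, mul_div_assoc', div_le_iff₀ (by positivity)] at h4
  have h5 : 0 < (ρ - dist y x) ^ L := by positivity
  nlinarith

/-- A holomorphic function is at least half as large as at the center of a disc on a concentric disc
whose size depends on an upper bound. -/
theorem half_norm_le_of_forall_norm_le {F : ℂ → ℂ} {y : ℂ} {δ Λ : ℝ} (hδ : 0 < δ) (hΛ : 1 ≤ Λ)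
    (hF : DifferentiableOn ℂ F (Metric.ball y (2 * δ)))
    (hb : ∀ z ∈ Metric.ball y (2 * δ), ‖F z‖ ≤ Λ * ‖F y‖) {z : ℂ} (hz : ‖z - y‖ ≤ δ / (4 * Λ)) :
    ‖F y‖ / 2 ≤ ‖F z‖ := by
  have hzδ : ‖z - y‖ ≤ δ / 4 := hz.trans (by
    refine div_le_div_of_nonneg_left hδ.le (by norm_num) (by linarith))
  -- Cauchy bounds the derivative by `Λ ‖F y‖ / (δ / 2)`; over a distance `δ / (4 * Λ)` the value
  -- then changes by at most half of `‖F y‖`.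
  have hd : ∀ w ∈ Metric.closedBall y (δ / 4), ‖deriv F w‖ ≤ Λ * ‖F y‖ / (δ / 2) := by
    intro w hw
    have hy' : Metric.closedBall w (δ / 2) ⊆ Metric.ball y (2 * δ) := by
      intro v hv
      rw [Metric.mem_ball]
      rw [Metric.mem_closedBall] at hv hw
      linarith [dist_triangle v w y]
    refine Complex.norm_deriv_le_of_forall_mem_sphere_norm_le (by positivity) ?_
        fun w hw => hb w (hy' (Metric.sphere_subset_closedBall hw))
    refine DifferentiableOn.diffContOnCl ?_
    rw [closure_ball _ (by positivity)]
    exact hF.mono hy'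
  have h1 := (convex_closedBall y (δ / 4)).norm_image_sub_le_of_norm_deriv_le (f := F) (𝕜 := ℂ)
    (fun w hw => hF.differentiableAt (Metric.isOpen_ball.mem_nhds
      (Metric.closedBall_subset_ball (by linarith) hw))) hd
    (Metric.mem_closedBall_self (by positivity)) (by rwa [Metric.mem_closedBall, dist_eq_norm])
  have h2 : Λ * ‖F y‖ / (δ / 2) * ‖z - y‖ ≤ ‖F y‖ / 2 := by
    calc _ ≤ Λ * ‖F y‖ / (δ / 2) * (δ / (4 * Λ)) := by gcongr
      _ = _ := by field_simp; ring
  have h3 := norm_sub_norm_le (F y) (F z)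
  rw [norm_sub_rev] at h3
  linarith

/-- Inversion near `z⁻¹` stretches lengths by about `|z|²`, so a disc of radius comparable to
`|z|⁻²` comes back inside the unit disc around `z`. This scale is responsible for the polynomial
loss in the growth bound. -/
theorem norm_inv_sub_le_one {z ζ : ℂ} (hz : 1 ≤ ‖z‖)
    (hζ : ζ ∈ Metric.closedBall z⁻¹ (‖z‖⁻¹ ^ 2 / 2)) : ζ ≠ 0 ∧ ‖ζ⁻¹ - z‖ ≤ 1 := by
  rw [Metric.mem_closedBall, dist_eq_norm] at hζ
  have hzp : 0 < ‖z‖ := by linarith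
  have h1 : ‖z‖⁻¹ ≤ 1 := inv_le_one_of_one_le₀ hz
  have hip : 0 < ‖z‖⁻¹ := by positivity
  have h2 : ‖z‖⁻¹ / 2 ≤ ‖ζ‖ := by
    have h := norm_sub_norm_le z⁻¹ ζ
    rw [norm_sub_rev, norm_inv] at h
    nlinarith
  have hζ0 : ζ ≠ 0 := norm_pos_iff.1 (by linarith)
  have hz0 : z ≠ 0 := norm_pos_iff.1 hzp
  refine ⟨hζ0, ?_⟩
  have h3 : ζ⁻¹ - z = -(ζ - z⁻¹) * z * ζ⁻¹ := by field_simp; ring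
  rw [h3, norm_mul, norm_mul, norm_neg, norm_inv, ← div_eq_mul_inv,
    div_le_one (norm_pos_iff.2 hζ0)]
  calc ‖ζ - z⁻¹‖ * ‖z‖ ≤ ‖z‖⁻¹ ^ 2 / 2 * ‖z‖ := by gcongr
    _ = ‖z‖⁻¹ / 2 := by field_simp
    _ ≤ _ := h2

/-- A test section which, in the chart at infinity, is a given smooth function supported in a disc
around the inverse of a point `z`. -/
theorem exists_testSection {c : ℂ → ℂ} (hc : ∀ ζ, ζ ≠ 0 → c ζ ≠ 0 ∧ ContDiffAt ℝ (⊤ : ℕ∞) c ζ)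
    {z : ℂ} (hz : 2 < ‖z‖) {χ : ℂ → ℂ} (hχ : ContDiff ℝ (⊤ : ℕ∞) χ)
    (hs : ∀ ζ, χ ζ ≠ 0 → ζ ∈ Metric.closedBall z⁻¹ (‖z‖⁻¹ ^ 2 / 2)) :
    ∃ φ : testSections c, φ.1.2 = χ ∧ (∀ x, φ.1.1 x = (c x⁻¹)⁻¹ * χ x⁻¹) ∧
      tsupport φ.1.1 ⊆ Metric.closedBall z 1 := by
  have h0 : ∀ x, x ∉ Metric.closedBall z 1 → (c x⁻¹)⁻¹ * χ x⁻¹ = 0 := by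
    intro x hx
    by_contra h
    have := (norm_inv_sub_le_one (by linarith) (hs x⁻¹ (right_ne_zero_of_mul h))).2
    rw [inv_inv] at this
    exact hx (by rwa [Metric.mem_closedBall, dist_eq_norm])
  have hsm : ContDiff ℝ (⊤ : ℕ∞) fun x => (c x⁻¹)⁻¹ * χ x⁻¹ := by
    rw [contDiff_iff_contDiffAt]
    intro x
    by_cases hx : x ∈ Metric.closedBall z 1
    · have hx0 : x ≠ 0 := by
        rintro rfl
        rw [Metric.mem_closedBall, dist_eq_norm, zero_sub, norm_neg] at hx
        linarith
      have hinv : ContDiffAt ℝ (⊤ : ℕ∞) (fun x : ℂ => x⁻¹) x := contDiffAt_inv ℝ hx0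
      obtain ⟨h1, h2⟩ := hc x⁻¹ (inv_ne_zero hx0)
      exact ((h2.comp x hinv).inv h1).mul (hχ.contDiffAt.comp x hinv)
    · have : (fun x => (c x⁻¹)⁻¹ * χ x⁻¹) =ᶠ[𝓝 x] fun _ => 0 := by
        filter_upwards [Metric.isClosed_closedBall.isOpen_compl.mem_nhds hx] with y hy using h0 y hy
      exact contDiffAt_const.congr_of_eventuallyEq this
  refine ⟨⟨(fun x => (c x⁻¹)⁻¹ * χ x⁻¹, χ), hsm, hχ, fun ζ hζ => ?_⟩, rfl, fun _ => rfl, ?_⟩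
  · simp only [inv_inv]
    rw [mul_inv_cancel_left₀ (hc ζ hζ).1]
  · refine closure_minimal (fun x hx => ?_) Metric.isClosed_closedBall
    by_contra h
    exact hx (h0 x h)

theorem norm_sub_le_of_bumpConj_ne_zero {P : ℂ → ℂ} {δ : ℝ} (hδ : 0 < δ) {y ζ : ℂ}
    (h : bumpConj P (δ⁻¹ • (ζ - y)) ≠ 0) : ‖ζ - y‖ ≤ δ := by
  by_contra hlt
  rw [not_le] at hlt
  refine h (bumpConj_eq_zero ?_)
  rw [norm_smul, norm_inv, Real.norm_eq_abs, abs_of_pos hδ, ← div_eq_inv_mul, one_le_div hδ]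
  exact hlt.le

/-- A function which extends to a distribution on `ℂ ∪ {∞}` and which, near infinity, is the product
of a positive weight and a holomorphic function `p` (up to the transition factor): then `p` has
polynomial growth with respect to the inverse of the weight. -/
theorem ExtendsToProj.exists_norm_le {c f p : ℂ → ℂ} {g H : ℂ → ℝ} {U : Set ℂ} {R : ℝ}
    (h : ExtendsToProj c U f) (hR : 1 ≤ R) (hU : ∀ z, R < ‖z‖ → z ∈ U)
    (hc : ∀ ζ, ζ ≠ 0 → c ζ ≠ 0 ∧ ContDiffAt ℝ (⊤ : ℕ∞) c ζ)
    (hg : Continuous g) (hp : DifferentiableOn ℂ p {z | R < ‖z‖})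
    (hf : ∀ z, R < ‖z‖ → f z = Real.exp (-g z) * p z * ((‖z‖ ^ 4)⁻¹ : ℝ) * c z⁻¹)
    (hH : ∀ z z', R + 1 < ‖z‖ → ‖z' - z‖ ≤ 1 → g z' ≤ H z) :
    ∃ (C : ℝ) (L : ℕ), 0 ≤ C ∧ ∀ z, R + 2 < ‖z‖ → ‖p z‖ ≤ C * ‖z‖ ^ L * Real.exp (H z) := by
  obtain ⟨T, ⟨N, C₀, hT⟩, hTf⟩ := h
  choose A hA0 hA using exists_norm_iteratedFDeriv_bumpConj_le
  set A' := ∑ k ∈ Finset.range (N + 1), A k with hA'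
  have hAle : ∀ k ≤ N, A k ≤ A' := fun k hk =>
    Finset.single_le_sum (f := A) (fun i _ => hA0 i) (Finset.mem_range.2 (Nat.lt_succ_of_le hk))
  have hA'0 : 0 ≤ A' := Finset.sum_nonneg fun i _ => hA0 i
  -- Of the exponent, `N` pays for the derivatives of a bump of radius `δ` and `2` for the area of
  -- the disc on which the integrand is bounded below.
  set L := N + 2 with hL
  set Λ : ℝ := 2 ^ L with hΛ
  have hΛ1 : 1 ≤ Λ := one_le_pow₀ (by norm_num)
  set C₂ := |C₀| * A' * Λ * 4 * 16 * (4 * Λ) ^ 2 / Real.pi with hC₂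
  have hC₂0 : 0 ≤ C₂ := by positivity
  refine ⟨C₂ * 4 ^ L * 2 ^ L, 2 * L + 4, by positivity, fun z hz => ?_⟩
  have hzp : 0 < ‖z‖ := by linarith
  by_cases hpz : p z = 0
  · rw [hpz, norm_zero]; positivity
  set ρ := ‖z‖⁻¹ ^ 2 / 2 with hρ
  have hρ0 : 0 < ρ := by positivity
  have hρ1 : ρ ≤ 1 := by
    have : ‖z‖⁻¹ ≤ 1 := inv_le_one_of_one_le₀ (by linarith)
    have h2 : ‖z‖⁻¹ ^ 2 ≤ 1 := pow_le_one₀ (by positivity) this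
    rw [hρ]; linarith
  have hinv : ∀ ζ ∈ Metric.closedBall z⁻¹ ρ, ζ ≠ 0 ∧ ‖ζ⁻¹ - z‖ ≤ 1 :=
    fun ζ hζ => norm_inv_sub_le_one (by linarith) hζ
  have hnear : ∀ x : ℂ, ‖x - z‖ ≤ 1 → R + 1 < ‖x‖ := fun x hx => by
    have := norm_sub_norm_le z x
    rw [norm_sub_rev] at this
    linarith
  set F : ℂ → ℂ := fun ζ => p ζ⁻¹ with hF
  have hFd : ∀ ζ ∈ Metric.closedBall z⁻¹ ρ, DifferentiableAt ℂ F ζ := fun ζ hζ => by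
    obtain ⟨h1, h2⟩ := hinv ζ hζ
    have h3 : DifferentiableAt ℂ p ζ⁻¹ := hp.differentiableAt
      ((isOpen_lt continuous_const continuous_norm).mem_nhds (by
        have := hnear _ h2
        simp only [mem_ofPred_eq]; linarith))
    exact h3.comp ζ (differentiableAt_inv h1)
  -- The estimate is carried out around `y` rather than `z⁻¹`: only there is `F` bounded on a disc
  -- by a constant times its value at the center.
  obtain ⟨y, d, hd0, hdρ, hyd, hmain, hosc⟩ := exists_mem_ball_forall_le (G := fun ζ => ‖F ζ‖) hρ0
    (fun ζ hζ => (hFd ζ hζ).continuousAt.norm.continuousWithinAt) (fun _ _ => norm_nonneg _)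
    (x := z⁻¹) (by simpa [hF] using hpz) (L := L) (by omega)
  set m := ‖F y‖ with hm
  have hm0 : 0 < m := by
    by_contra h0
    have h1 : m = 0 := le_antisymm (not_lt.1 h0) (norm_nonneg _)
    simp only [h1, zero_mul] at hmain
    have : 0 < ‖F z⁻¹‖ * ρ ^ L := by
      have : F z⁻¹ ≠ 0 := by simpa [hF] using hpz
      positivity
    linarith
  set δ := d / 4 with hδ
  have hδ0 : 0 < δ := by positivity
  have hδ1 : δ ≤ 1 := by linarith
  have hball : Metric.ball y (2 * δ) ⊆ Metric.closedBall z⁻¹ ρ :=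
    (Metric.ball_subset_ball (by linarith)).trans (hyd.trans Metric.ball_subset_closedBall)
  have hosc' : ∀ ζ ∈ Metric.ball y (2 * δ), ‖F ζ‖ ≤ Λ * m := fun ζ hζ =>
    hosc ζ (Metric.ball_subset_ball (by linarith) hζ)
  set P : ℂ → ℂ := fun ξ => F (y + δ • ξ) with hP
  have hPmem : ∀ ξ ∈ Metric.ball (0 : ℂ) 2, y + δ • ξ ∈ Metric.ball y (2 * δ) := fun ξ hξ => by
    rw [mem_ball_zero_iff] at hξ
    rw [mem_ball_iff_norm, add_sub_cancel_left, norm_smul, Real.norm_eq_abs, abs_of_pos hδ0]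
    nlinarith
  have hPd : DifferentiableOn ℂ P (Metric.ball 0 2) := fun ξ hξ => by
    have h1 := hFd _ (hball (hPmem ξ hξ))
    have h2 : DifferentiableAt ℂ (fun ξ : ℂ => y + δ • ξ) ξ := by fun_prop
    exact (h1.comp ξ h2).differentiableWithinAt
  have hPb : ∀ ξ ∈ Metric.ball (0 : ℂ) 2, ‖P ξ‖ ≤ Λ * m := fun ξ hξ => hosc' _ (hPmem ξ hξ)
  have hχ : ContDiff ℝ (⊤ : ℕ∞) fun ζ => bumpConj P (δ⁻¹ • (ζ - y)) :=
    (contDiff_bumpConj hPd).comp (by fun_prop)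
  have hχs : ∀ ζ, bumpConj P (δ⁻¹ • (ζ - y)) ≠ 0 → ζ ∈ Metric.ball y (2 * δ) := fun ζ hζ => by
    have := norm_sub_le_of_bumpConj_ne_zero hδ0 hζ
    rw [mem_ball_iff_norm]; linarith
  have hχv : ∀ ζ, bumpConj P (δ⁻¹ • (ζ - y)) =
      (unitBump (δ⁻¹ • (ζ - y)) : ℂ) * (starRingEnd ℂ) (F ζ) := fun ζ => by
    rw [bumpConj, hP]
    simp only
    rw [smul_inv_smul₀ hδ0.ne', add_sub_cancel]
  obtain ⟨φ, hφ2, hφ1, hφs⟩ := exists_testSection hc (z := z) (by linarith) hχ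
    fun ζ hζ => hball (hχs ζ hζ)
  have hφc : HasCompactSupport φ.1.1 :=
    (isCompact_closedBall z 1).of_isClosed_subset (isClosed_tsupport _) hφs
  have hφU : tsupport φ.1.1 ⊆ U := fun x hx => hU x (by
    have := hφs hx
    rw [Metric.mem_closedBall, dist_eq_norm] at this
    linarith [hnear x this])
  -- Upper bound from continuity. In the chart `z` the section vanishes on the unit disc, since its
  -- support has modulus above `R + 1`. In the chart at infinity, rescaling the bump costs `δ⁻¹` per
  -- derivative.
  have hup : ‖T φ‖ ≤ C₀ * (A' * (Λ * m) * δ⁻¹ ^ N) := by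
    refine hT φ _ fun k hk x hx => ⟨?_, ?_⟩
    · rw [image_eq_zero_of_notMem_tsupport (f := iteratedFDeriv ℝ k φ.1.1)]
      · rw [norm_zero]; positivity
      · intro hmem
        have := hφs (tsupport_iteratedFDeriv_subset (𝕜 := ℝ) k hmem)
        rw [Metric.mem_closedBall, dist_eq_norm] at this
        linarith [hnear x this]
    · rw [hφ2, norm_iteratedFDeriv_comp_affine (contDiff_bumpConj hPd) k δ⁻¹ (by positivity)]
      have h1 := hA k P (Λ * m) hPd hPb (δ⁻¹ • (x - y))
      have h2 : δ⁻¹ ^ k ≤ δ⁻¹ ^ N := pow_le_pow_right₀ ((one_le_inv₀ hδ0).2 hδ1) hk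
      calc δ⁻¹ ^ k * ‖iteratedFDeriv ℝ k (bumpConj P) (δ⁻¹ • (x - y))‖
          ≤ δ⁻¹ ^ N * (A' * (Λ * m)) := by
            gcongr
            exact h1.trans (by gcongr; exact hAle k hk)
        _ = _ := by ring
  -- The transition factors cancel in `f φ` and the conjugate turns `p` into `|p|²`, so the pairing
  -- is the integral of a nonnegative function.
  set J : ℂ → ℝ := fun x => Real.exp (-g x) * (‖x‖ ^ 4)⁻¹ * unitBump (δ⁻¹ • (x⁻¹ - y)) * ‖p x‖ ^ 2
    with hJ
  have hJ0 : ∀ x, 0 ≤ J x := fun x => by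
    have := unitBump.nonneg (x := δ⁻¹ • (x⁻¹ - y))
    positivity
  have hfJ : ∀ x, f x * φ.1.1 x = (((Metric.closedBall z 1).indicator J x : ℝ) : ℂ) := by
    intro x
    by_cases hx : x ∈ Metric.closedBall z 1
    · rw [Set.indicator_of_mem hx]
      rw [Metric.mem_closedBall, dist_eq_norm] at hx
      have hxR : R < ‖x‖ := by linarith [hnear x hx]
      have hx0 : x ≠ 0 := norm_pos_iff.1 (by linarith)
      rw [hf x hxR, hφ1, hχv, hJ, hF]
      simp only [inv_inv]
      have hcx := (hc x⁻¹ (inv_ne_zero hx0)).1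
      have hpp : p x * (starRingEnd ℂ) (p x) = ((‖p x‖ ^ 2 : ℝ) : ℂ) := by
        rw [Complex.mul_conj, Complex.normSq_eq_norm_sq]
      simp only [Complex.ofReal_mul]
      rw [← hpp]
      generalize c x⁻¹ = cx at hcx
      generalize ((unitBump (δ⁻¹ • (x⁻¹ - y)) : ℝ) : ℂ) = ub
      field_simp
    · rw [Set.indicator_of_notMem hx, image_eq_zero_of_notMem_tsupport fun h => hx (hφs h)]
      simp
  have hJi : Integrable ((Metric.closedBall z 1).indicator J) := by
    have h1 : Integrable fun x => f x * φ.1.1 x := by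
      refine integrable_mul (U := {x | R < ‖x‖}) (fun x hx => ?_) φ.2.1.continuous hφc ?_
      · have hxo : {x : ℂ | R < ‖x‖} ∈ 𝓝 x := (isOpen_lt continuous_const continuous_norm).mem_nhds hx
        have hx' : R < ‖x‖ := hx
        have hx0 : x ≠ 0 := norm_pos_iff.1 (by linarith)
        have h2 : ContinuousAt (fun z => (Real.exp (-g z) : ℂ) * p z * ((‖z‖ ^ 4)⁻¹ : ℝ) * c z⁻¹) x := by
          have hcc : ContinuousAt (fun z : ℂ => c z⁻¹) x :=
            ContinuousAt.comp (f := fun z : ℂ => z⁻¹) (hc x⁻¹ (inv_ne_zero hx0)).2.continuousAt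
              (continuousAt_inv₀ hx0)
          have hpc : ContinuousAt p x := (hp.differentiableAt hxo).continuousAt
          have hn : ContinuousAt (fun z : ℂ => (‖z‖ ^ 4)⁻¹) x :=
            (continuous_norm.continuousAt.pow 4).inv₀ (by simpa using hx0)
          have he : Continuous fun z => (Real.exp (-g z) : ℂ) := by fun_prop
          exact ((he.continuousAt.mul hpc).mul
            (Complex.continuous_ofReal.continuousAt.comp hn)).mul hcc
        refine h2.congr ?_
        filter_upwards [hxo] with w hw using (hf w hw).symm
      · intro x hx
        have := hφs hx
        rw [Metric.mem_closedBall, dist_eq_norm] at this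
        have := hnear x this
        simp only [mem_ofPred_eq]; linarith
    have h2 := h1.re
    refine h2.congr (Eventually.of_forall fun x => ?_)
    simp only [hfJ]
    simp
  have hTJ : ‖T φ‖ = ∫ x, (Metric.closedBall z 1).indicator J x := by
    rw [hTf φ hφc hφU]
    simp_rw [hfJ]
    rw [integral_complex_ofReal, Complex.norm_real, Real.norm_eq_abs, abs_of_nonneg]
    exact integral_nonneg fun x => Set.indicator_nonneg (fun x _ => hJ0 x) x
  -- On a disc of this radius around `y⁻¹` the bump equals 1 and `‖p‖ ≥ m / 2`; inversion does not
  -- increase distances there, as both points have modulus at least 1.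
  set η := δ / (4 * Λ) with hη
  have hη0 : 0 < η := by positivity
  have hηδ : η ≤ δ / 4 := div_le_div_of_nonneg_left hδ0.le (by norm_num) (by linarith)
  have hylt := hball (Metric.mem_ball_self (by positivity : (0 : ℝ) < 2 * δ))
  obtain ⟨hy0, hyz⟩ := hinv y hylt
  have hlow : ∀ x ∈ Metric.closedBall y⁻¹ η,
      Real.exp (-H z) * ((2 * ‖z‖) ^ 4)⁻¹ * (m / 2) ^ 2 ≤ (Metric.closedBall z 1).indicator J x := by
    intro x hx
    rw [Metric.mem_closedBall, dist_eq_norm] at hx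
    have hyn : 1 ≤ ‖y⁻¹‖ := by linarith [hnear _ hyz]
    have hxn : 1 ≤ ‖x‖ := by
      have := norm_sub_norm_le y⁻¹ x
      rw [norm_sub_rev] at this
      linarith [hnear _ hyz]
    have hx0 : x ≠ 0 := norm_pos_iff.1 (by linarith)
    have hxy : ‖x⁻¹ - y‖ ≤ η := by
      have h1 : x⁻¹ - y = -(x - y⁻¹) * (x⁻¹ * y) := by field_simp; ring
      rw [h1, norm_mul, norm_neg, norm_mul, norm_inv]
      have h2 : ‖x‖⁻¹ ≤ 1 := inv_le_one_of_one_le₀ hxn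
      have h3 : ‖y‖ ≤ 1 := by
        rw [norm_inv] at hyn
        exact (one_le_inv₀ (norm_pos_iff.2 hy0)).1 hyn
      have h4 : ‖x‖⁻¹ * ‖y‖ ≤ 1 := mul_le_one₀ h2 (norm_nonneg _) h3
      calc _ ≤ ‖x - y⁻¹‖ * 1 := by gcongr
        _ ≤ _ := by linarith
    have hxb : x⁻¹ ∈ Metric.ball y (2 * δ) := by rw [mem_ball_iff_norm]; linarith
    have hxz : ‖x - z‖ ≤ 1 := by simpa using (hinv _ (hball hxb)).2
    rw [Set.indicator_of_mem (by rwa [Metric.mem_closedBall, dist_eq_norm])]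
    have h1 : unitBump (δ⁻¹ • (x⁻¹ - y)) = 1 := by
      refine unitBump.one_of_mem_closedBall ?_
      rw [mem_closedBall_zero_iff, norm_smul, norm_inv, Real.norm_eq_abs, abs_of_pos hδ0,
        ← div_eq_inv_mul, div_le_iff₀ hδ0]
      change _ ≤ 1 / 2 * δ
      linarith
    have h2 : m / 2 ≤ ‖p x‖ := by
      have := half_norm_le_of_forall_norm_le hδ0 hΛ1
        (fun ζ hζ => (hFd ζ (hball hζ)).differentiableWithinAt) hosc' hxy
      simpa [hF] using this
    have h3 : ‖x‖ ≤ 2 * ‖z‖ := by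
      have := norm_sub_norm_le x z
      linarith
    simp only [hJ]
    rw [h1, mul_one]
    have h4 := hH z x (by linarith) hxz
    gcongr
  have hint : Real.exp (-H z) * ((2 * ‖z‖) ^ 4)⁻¹ * (m / 2) ^ 2 * (Real.pi * η ^ 2) ≤ ‖T φ‖ := by
    rw [hTJ]
    have h1 := setIntegral_mono_on (μ := volume) (s := Metric.closedBall y⁻¹ η)
      (f := fun _ => Real.exp (-H z) * ((2 * ‖z‖) ^ 4)⁻¹ * (m / 2) ^ 2)
      (integrableOn_const (by exact measure_closedBall_lt_top.ne)) hJi.integrableOn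
      Metric.isClosed_closedBall.measurableSet hlow
    have h2 : ∫ x in Metric.closedBall y⁻¹ η, (Metric.closedBall z 1).indicator J x ≤
        ∫ x, (Metric.closedBall z 1).indicator J x :=
      setIntegral_le_integral hJi (Eventually.of_forall fun x =>
        Set.indicator_nonneg (fun x _ => hJ0 x) x)
    refine le_trans (le_of_eq ?_) (h1.trans h2)
    rw [setIntegral_const, smul_eq_mul, Measure.real, Complex.volume_closedBall]
    simp only [ENNReal.toReal_mul, ENNReal.toReal_pow, ENNReal.toReal_ofReal hη0.le,
      ENNReal.coe_toReal, NNReal.coe_real_pi]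
    ring
  -- The lower bound is quadratic in `m` and the upper bound linear: dividing by `m > 0` leaves a
  -- bound for `m` itself.
  have hcomb : m * δ ^ L ≤ C₂ * ‖z‖ ^ 4 * Real.exp (H z) := by
    have h1 : Real.exp (-H z) * ((2 * ‖z‖) ^ 4)⁻¹ * (m / 2) ^ 2 * (Real.pi * η ^ 2) ≤
        |C₀| * (A' * (Λ * m) * δ⁻¹ ^ N) :=
      hint.trans (hup.trans (by gcongr; exact le_abs_self _))
    have hpi := Real.pi_pos
    have h2 : Real.exp (-H z) * ((2 * ‖z‖) ^ 4)⁻¹ * (m / 2) ^ 2 * (Real.pi * η ^ 2) *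
        (Real.exp (H z) * ‖z‖ ^ 4 * 4 * 16 * (4 * Λ) ^ 2 * δ ^ N / (Real.pi * m)) = m * δ ^ L := by
      rw [Real.exp_neg, hη, hL]
      field_simp
      ring
    have h3 : |C₀| * (A' * (Λ * m) * δ⁻¹ ^ N) *
        (Real.exp (H z) * ‖z‖ ^ 4 * 4 * 16 * (4 * Λ) ^ 2 * δ ^ N / (Real.pi * m)) =
        C₂ * ‖z‖ ^ 4 * Real.exp (H z) := by
      rw [hC₂, inv_pow]
      field_simp
    rw [← h2, ← h3]
    exact mul_le_mul_of_nonneg_right h1 (by positivity)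
  have hfin : ‖p z‖ * ρ ^ L ≤ 4 ^ L * (C₂ * ‖z‖ ^ 4 * Real.exp (H z)) := by
    have h1 : m * d ^ L = 4 ^ L * (m * δ ^ L) := by
      rw [hδ, div_pow]; field_simp
    have h2 : ‖p z‖ * ρ ^ L ≤ m * d ^ L := by simpa [hF] using hmain
    rw [h1] at h2
    exact h2.trans (by gcongr)
  have hρL : ρ ^ L * (2 ^ L * ‖z‖ ^ (2 * L)) = 1 := by
    rw [hρ, pow_mul, ← mul_pow, ← mul_pow]
    have : ‖z‖⁻¹ ^ 2 / 2 * (2 * ‖z‖ ^ 2) = 1 := by field_simp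
    rw [this, one_pow]
  calc ‖p z‖ = ‖p z‖ * ρ ^ L * (2 ^ L * ‖z‖ ^ (2 * L)) := by rw [mul_assoc, hρL, mul_one]
    _ ≤ 4 ^ L * (C₂ * ‖z‖ ^ 4 * Real.exp (H z)) * (2 ^ L * ‖z‖ ^ (2 * L)) := by gcongr
    _ = _ := by rw [pow_add]; ring

theorem isOpen_lt_norm (R : ℝ) : IsOpen {z : ℂ | R < ‖z‖} := isOpen_lt continuous_const continuous_norm

theorem setOf_lt_norm_mem_cobounded (R : ℝ) : {z : ℂ | R < ‖z‖} ∈ Bornology.cobounded ℂ :=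
  tendsto_norm_cobounded_atTop.eventually (eventually_gt_atTop R)

/-! ### Holomorphic functions near infinity -/

/-- Riemann's removable singularity theorem for `ζ ↦ f ζ⁻¹` at `0`; differentiability of the
extension there gives the rate `O(z⁻¹)`. -/
theorem exists_sub_const_isBigO_inv {f : ℂ → ℂ} {R : ℝ} (hf : DifferentiableOn ℂ f {z | R < ‖z‖})
    (hb : f =O[Bornology.cobounded ℂ] fun _ => (1 : ℂ)) :
    ∃ a : ℂ, (fun z => f z - a) =O[Bornology.cobounded ℂ] fun z => z⁻¹ := by
  have hmem : {z : ℂ | R < ‖z‖} ∈ Bornology.cobounded ℂ := setOf_lt_norm_mem_cobounded R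
  obtain ⟨C, hC⟩ := hb.bound
  have hev : ∀ᶠ ζ in 𝓝[≠] (0 : ℂ), R < ‖ζ⁻¹‖ ∧ ‖f ζ⁻¹‖ ≤ C * ‖(1 : ℂ)‖ :=
    tendsto_inv₀_nhdsNE_zero.eventually ((eventually_of_mem hmem fun _ h => h).and hC)
  obtain ⟨s, hs, hsub⟩ := mem_nhdsWithin_iff_exists_mem_nhds_inter.1 hev
  have hd : DifferentiableOn ℂ (fun ζ => f ζ⁻¹) (s \ {0}) := by
    intro ζ hζ
    have h1 : DifferentiableAt ℂ f ζ⁻¹ :=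
      hf.differentiableAt ((isOpen_lt_norm R).mem_nhds (hsub ⟨hζ.1, hζ.2⟩).1)
    exact (h1.comp ζ (differentiableAt_inv hζ.2)).differentiableWithinAt
  have hV := Complex.differentiableOn_update_limUnder_of_bddAbove hs hd ⟨C * ‖(1 : ℂ)‖, by
    rintro _ ⟨ζ, hζ, rfl⟩
    exact (hsub ⟨hζ.1, hζ.2⟩).2⟩
  set a := limUnder (𝓝[≠] 0) fun ζ => f ζ⁻¹
  have h0 := (hV.differentiableAt hs).isBigO_sub
  refine ⟨a, ?_⟩
  have h1 := h0.comp_tendsto (tendsto_inv₀_cobounded (α := ℂ))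
  refine (h1.congr' ?_ ?_)
  · filter_upwards [setOf_lt_norm_mem_cobounded 0] with z hz
    have hz0 : z ≠ 0 := norm_pos_iff.1 hz
    simp [Function.update_of_ne (inv_ne_zero hz0)]
  · exact Eventually.of_forall fun z => by simp

/-- A holomorphic function of polynomial growth at infinity differs from a polynomial by a function
which vanishes at infinity. -/
theorem exists_polynomial_sub_isBigO_inv {n : ℕ} : ∀ {f : ℂ → ℂ} {R : ℝ},
    DifferentiableOn ℂ f {z | R < ‖z‖} →
    f =O[Bornology.cobounded ℂ] (fun z => z ^ n) →
    ∃ p : Polynomial ℂ, (fun z => f z - p.eval z) =O[Bornology.cobounded ℂ] fun z => z⁻¹ := by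
  induction n with
  | zero =>
    intro f R hf hb
    obtain ⟨a, ha⟩ := exists_sub_const_isBigO_inv hf (by simpa using hb)
    exact ⟨Polynomial.C a, by simpa using ha⟩
  | succ n ih =>
    intro f R hf hb
    have hne : ∀ᶠ z in Bornology.cobounded ℂ, z ≠ 0 := by
      filter_upwards [setOf_lt_norm_mem_cobounded 0] with z hz using norm_pos_iff.1 hz
    have hd : DifferentiableOn ℂ (fun z => f z * (z ^ (n + 1))⁻¹) {z | max R 0 < ‖z‖} := by
      intro z hz
      have h1 : R < ‖z‖ := (le_max_left R 0).trans_lt hz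
      have h2 : z ≠ 0 := norm_pos_iff.1 ((le_max_right R 0).trans_lt hz)
      have h3 : DifferentiableAt ℂ f z := hf.differentiableAt ((isOpen_lt_norm R).mem_nhds h1)
      have h4 : DifferentiableAt ℂ (fun z : ℂ => (z ^ (n + 1))⁻¹) z :=
        (differentiableAt_pow (n + 1)).inv (pow_ne_zero _ h2)
      exact (h3.mul h4).differentiableWithinAt
    obtain ⟨a, ha⟩ := exists_sub_const_isBigO_inv hd (by
      refine (hb.mul (Asymptotics.isBigO_refl (fun z : ℂ => (z ^ (n + 1))⁻¹) _)).congr' .rfl ?_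
      filter_upwards [hne] with z hz
      exact mul_inv_cancel₀ (pow_ne_zero _ hz))
    have h1 := ha.mul (Asymptotics.isBigO_refl (fun z : ℂ => z ^ (n + 1)) _)
    have h2 : (fun z => f z - a * z ^ (n + 1)) =O[Bornology.cobounded ℂ] fun z => z ^ n := by
      refine h1.congr' ?_ ?_
      · filter_upwards [hne] with z hz
        rw [sub_mul, inv_mul_cancel_right₀ (pow_ne_zero _ hz)]
      · filter_upwards [hne] with z hz
        rw [pow_succ, mul_comm, mul_assoc, mul_inv_cancel₀ hz, mul_one]
    obtain ⟨p, hp⟩ := ih (R := R) (hf.sub (by fun_prop)) h2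
    refine ⟨p + Polynomial.C a * Polynomial.X ^ (n + 1), hp.congr_left fun z => ?_⟩
    simp only [Pi.sub_apply, Polynomial.eval_add, Polynomial.eval_mul, Polynomial.eval_C, Polynomial.eval_pow,
      Polynomial.eval_X]
    ring

/-! ### Circle integrals -/

theorem hasDerivAt_intervalIntegral_of_continuousOn {G G' : ℂ → ℝ → ℂ} {a b : ℝ} {s : Set ℂ}
    (hs : IsOpen s) (hG : ∀ x ∈ s, ContinuousOn (G x) (uIcc a b))
    (hG' : ContinuousOn (fun q : ℂ × ℝ => G' q.1 q.2) (s ×ˢ uIcc a b))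
    (hd : ∀ x ∈ s, ∀ t ∈ uIcc a b, HasDerivAt (fun y => G y t) (G' x t) x) {x : ℂ} (hx : x ∈ s) :
    HasDerivAt (fun y => ∫ t in a..b, G y t) (∫ t in a..b, G' x t) x := by
  obtain ⟨r, hr, hrs⟩ := Metric.nhds_basis_closedBall.mem_iff.1 (hs.mem_nhds hx)
  obtain ⟨C, hC⟩ := ((isCompact_closedBall x r).prod isCompact_uIcc).exists_bound_of_continuousOn
    (hG'.mono (Set.prod_mono hrs subset_rfl))
  have hG'x : ContinuousOn (G' x) (uIcc a b) :=
    hG'.comp (f := fun t => (x, t)) (by fun_prop) fun t ht => ⟨hx, ht⟩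
  refine (intervalIntegral.hasDerivAt_integral_of_dominated_loc_of_deriv_le
    (F := G) (F' := G') (s := Metric.closedBall x r) (bound := fun _ => C)
    (Metric.closedBall_mem_nhds x hr) ?_ (hG x hx).intervalIntegrable ?_ ?_
    intervalIntegrable_const ?_).2
  · filter_upwards [hs.mem_nhds hx] with y hy
    exact ((hG y hy).mono uIoc_subset_uIcc).aestronglyMeasurable measurableSet_uIoc
  · exact (hG'x.mono uIoc_subset_uIcc).aestronglyMeasurable measurableSet_uIoc
  · exact Eventually.of_forall fun t ht y hy => hC (y, t) ⟨hy, uIoc_subset_uIcc ht⟩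
  · exact Eventually.of_forall fun t ht y hy => hd y (hrs hy) t (uIoc_subset_uIcc ht)

theorem differentiable_circleIntegral_exp_mul {u : ℂ → ℂ} {r : ℝ} (hr : 0 ≤ r)
    (hu : ContinuousOn u (Metric.sphere 0 r)) :
    Differentiable ℂ fun w : ℂ => ∮ z in C(0, r), Complex.exp (w * z) * u z := by
  intro w
  have hcm : ∀ θ, circleMap 0 r θ ∈ Metric.sphere (0 : ℂ) r := circleMap_mem_sphere 0 hr
  have huc : Continuous fun θ => u (circleMap 0 r θ) :=
    hu.comp_continuous (continuous_circleMap 0 r) hcm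
  have hdc : Continuous fun θ => deriv (circleMap 0 r) θ := by
    simp_rw [deriv_circleMap]
    exact (continuous_circleMap 0 r).mul continuous_const
  have hcc : Continuous (circleMap 0 r) := continuous_circleMap 0 r
  refine (hasDerivAt_intervalIntegral_of_continuousOn (s := univ) isOpen_univ
    (G := fun w θ => deriv (circleMap 0 r) θ •
      (Complex.exp (w * circleMap 0 r θ) * u (circleMap 0 r θ)))
    (G' := fun w θ => deriv (circleMap 0 r) θ •
      (Complex.exp (w * circleMap 0 r θ) * circleMap 0 r θ * u (circleMap 0 r θ)))
    (fun x _ => ?_) ?_ (fun x _ θ _ => ?_) (mem_univ w)).differentiableAt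
  · refine Continuous.continuousOn (hdc.smul (M := ℂ) ?_)
    exact (Complex.continuous_exp.comp (continuous_const.mul hcc)).mul huc
  · refine Continuous.continuousOn ((hdc.comp continuous_snd).smul (M := ℂ) ?_)
    exact ((Complex.continuous_exp.comp (continuous_fst.mul (hcc.comp continuous_snd))).mul
      (hcc.comp continuous_snd)).mul (huc.comp continuous_snd)
  · have h1 := ((hasDerivAt_id x).mul_const (circleMap 0 r θ)).cexp
    simp only [id_eq, one_mul] at h1
    exact (h1.mul_const _).const_mul _

/-- The integral of a holomorphic function on the complement of a set `K` over a circle around `K`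
does not depend on the circle. -/
theorem circleIntegral_eq_of_differentiableOn_compl {F : ℂ → ℂ} {K : Set ℂ} (hK : IsClosed K)
    (hne : K.Nonempty) (hF : DifferentiableOn ℂ F Kᶜ) {c₁ c₂ : ℂ} {r₁ r₂ : ℝ}
    (h₁ : K ⊆ Metric.ball c₁ r₁) (h₂ : K ⊆ Metric.ball c₂ r₂) :
    (∮ z in C(c₁, r₁), F z) = ∮ z in C(c₂, r₂), F z := by
  have hFd : ∀ z ∉ K, DifferentiableAt ℂ F z := fun z hz =>
    hF.differentiableAt (hK.isOpen_compl.mem_nhds hz)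
  obtain ⟨k, hk⟩ := hne
  have hr₁ : 0 < r₁ := Metric.pos_of_mem_ball (h₁ hk)
  have hr₂ : 0 < r₂ := Metric.pos_of_mem_ball (h₂ hk)
  have hmono : ∀ (c : ℂ) (r R : ℝ), 0 < r → r ≤ R → K ⊆ Metric.ball c r →
      (∮ z in C(c, R), F z) = ∮ z in C(c, r), F z := by
    intro c r R hr hrR hc
    refine Complex.circleIntegral_eq_of_differentiable_on_annulus_off_countable hr hrR
      Set.countable_empty (fun z hz => ?_) fun z hz => ?_
    · exact (hFd z fun h => hz.2 (hc h)).continuousAt.continuousWithinAt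
    · exact hFd z fun h => hz.1.2 (Metric.ball_subset_closedBall (hc h))
  -- Both circles are first enlarged to this common radius. It is so large that every circle of
  -- radius `P` centered in the disc `S` around `c₁`, which contains `c₂`, avoids `K`; the center
  -- can then be moved from `c₁` to `c₂`.
  set P := r₁ + r₂ + dist c₂ c₁ with hP
  have hP0 : 0 < P := by positivity
  have hd0 : 0 ≤ dist c₂ c₁ := dist_nonneg
  rw [← hmono c₁ r₁ P hr₁ (by linarith) h₁, ← hmono c₂ r₂ P hr₂ (by linarith) h₂]
  set S := Metric.ball c₁ (r₂ + dist c₂ c₁) with hS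
  have hSK : ∀ c ∈ S, ∀ θ, circleMap c P θ ∉ K := by
    intro c hc θ h
    have h3 := h₁ h
    have h4 := circleMap_mem_sphere c hP0.le θ
    rw [Metric.mem_sphere] at h4
    rw [Metric.mem_ball] at h3 hc
    have := dist_triangle (circleMap c P θ) c₁ c
    rw [dist_comm c₁ c] at this
    linarith
  have hcc : Continuous fun q : ℂ × ℝ => circleMap q.1 P q.2 := by
    simp only [circleMap]; fun_prop
  have hdc : ∀ c, Continuous fun θ => deriv (circleMap c P) θ := fun c => by
    simp_rw [deriv_circleMap]
    exact (continuous_circleMap 0 P).mul continuous_const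
  -- Differentiating in the center gives the integral of `deriv F` over a closed curve, which is
  -- zero since `F` is a primitive.
  have hderiv : ∀ c ∈ S, HasDerivAt (fun c => ∮ z in C(c, P), F z) 0 c := by
    intro c hc
    have h0 : (∮ z in C(c, P), deriv F z) = 0 := by
      refine circleIntegral.integral_eq_zero_of_hasDerivWithinAt hP0.le (f := F) fun z hz => ?_
      rw [← abs_of_pos hP0, ← range_circleMap] at hz
      obtain ⟨θ, rfl⟩ := hz
      exact (hFd _ (hSK c hc θ)).hasDerivAt.hasDerivWithinAt
    rw [← h0]
    refine hasDerivAt_intervalIntegral_of_continuousOn (s := S) Metric.isOpen_ball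
      (G := fun c θ => deriv (circleMap c P) θ • F (circleMap c P θ))
      (G' := fun c θ => deriv (circleMap c P) θ • deriv F (circleMap c P θ))
      (fun x hx => ?_) ?_ (fun x hx θ _ => ?_) hc
    · refine Continuous.continuousOn ((hdc x).smul ?_)
      exact hF.continuousOn.comp_continuous (continuous_circleMap x P) (hSK x hx)
    · simp only [smul_eq_mul]
      refine ContinuousOn.mul ?_ ?_
      · simp_rw [deriv_circleMap]
        refine Continuous.continuousOn ?_
        simp only [circleMap]; fun_prop
      · exact ((hF.deriv hK.isOpen_compl).continuousOn).comp hcc.continuousOn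
          fun q hq => hSK q.1 hq.1 q.2
    · simp_rw [deriv_circleMap]
      refine HasDerivAt.const_mul _ ?_
      have h5 : HasDerivAt (fun y => circleMap y P θ) 1 x := by
        simp only [circleMap]
        exact (hasDerivAt_id x).add_const _
      have h6 := (hFd _ (hSK x hx θ)).hasDerivAt.comp x h5
      rw [mul_one] at h6
      exact h6
  refine Metric.isOpen_ball.is_const_of_deriv_eq_zero (convex_ball c₁ _).isPreconnected
    (fun c hc => (hderiv c hc).differentiableAt.differentiableWithinAt)
    (fun c hc => (hderiv c hc).deriv) (Metric.mem_ball_self (by linarith)) ?_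
  rw [Metric.mem_ball]; linarith

theorem hasSum_circleIntegral {f : ℂ → ℂ} {F : ℕ → ℂ → ℂ} {b : ℕ → ℝ} {c : ℂ} {r : ℝ} (hr : 0 ≤ r)
    (hF : ∀ n, ContinuousOn (F n) (Metric.sphere c r)) (hb : Summable b)
    (hFb : ∀ n, ∀ z ∈ Metric.sphere c r, ‖F n z‖ ≤ b n)
    (hs : ∀ z ∈ Metric.sphere c r, HasSum (fun n => F n z) (f z)) :
    HasSum (fun n => ∮ z in C(c, r), F n z) (∮ z in C(c, r), f z) := by
  have hcm := circleMap_mem_sphere c hr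
  refine intervalIntegral.hasSum_integral_of_dominated_convergence (fun n _ => r * b n)
    (fun n => ?_) (fun n => Eventually.of_forall fun θ _ => ?_)
    (Eventually.of_forall fun θ _ => hb.mul_left r) intervalIntegrable_const
    (Eventually.of_forall fun θ _ => (hs _ (hcm θ)).const_smul _)
  · refine Continuous.aestronglyMeasurable ?_
    change Continuous fun θ => deriv (circleMap c r) θ * F n (circleMap c r θ)
    refine Continuous.mul ?_ ?_
    · rw [show deriv (circleMap c r) = fun θ => circleMap 0 r θ * Complex.I from
        funext (deriv_circleMap c r)]
      exact (continuous_circleMap 0 r).mul continuous_const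
    · exact (hF n).comp_continuous (continuous_circleMap c r) hcm
  · rw [norm_smul, deriv_circleMap, norm_mul, Complex.norm_I, mul_one, norm_circleMap_zero,
      abs_of_nonneg hr]
    exact mul_le_mul_of_nonneg_left (hFb n _ (hcm θ)) hr

/-- Termwise integration of the exponential series: up to factorials, the Taylor coefficients of the
contour integral are the moments of `u`. Both injectivity and the inversion of the Borel transform
read off these moments. -/
theorem hasSum_circleIntegral_exp_mul {u : ℂ → ℂ} {r : ℝ} (hr : 0 ≤ r)
    (hu : ContinuousOn u (Metric.sphere 0 r)) (w : ℂ) :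
    HasSum (fun n : ℕ => w ^ n * ((n.factorial : ℂ)⁻¹ * ∮ z in C(0, r), z ^ n * u z))
      (∮ z in C(0, r), Complex.exp (w * z) * u z) := by
  obtain ⟨M, hM⟩ := (isCompact_sphere (0 : ℂ) r).exists_bound_of_continuousOn hu
  have h := hasSum_circleIntegral (F := fun n z => (n.factorial : ℂ)⁻¹ * (w * z) ^ n * u z)
    (f := fun z => Complex.exp (w * z) * u z) (b := fun n => (‖w‖ * r) ^ n / n.factorial * M) hr
    (fun n => ContinuousOn.mul (by fun_prop) hu) ((Real.summable_pow_div_factorial _).mul_right M)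
    (fun n z hz => ?_) fun z _ => ?_
  · convert h using 2 with n
    rw [← mul_assoc, ← circleIntegral.integral_const_mul]
    congr 1
    ext z
    rw [mul_pow]; ring
  · rw [norm_mul, norm_mul, norm_inv, norm_pow, norm_mul, mem_sphere_zero_iff_norm.1 hz,
      Complex.norm_natCast, div_eq_inv_mul]
    gcongr
    exact hM z hz
  · refine HasSum.mul_right _ ?_
    rw [Complex.exp_eq_exp_ℂ]
    simpa [div_eq_inv_mul] using NormedSpace.expSeries_div_hasSum_exp (w * z)

theorem eq_zero_of_forall_hasSum_pow_mul {c : ℕ → ℂ} (h : ∀ w : ℂ, HasSum (fun n => w ^ n * c n) 0)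
    (n : ℕ) : c n = 0 := by
  let p : FormalMultilinearSeries ℂ ℂ ℂ := fun n => ContinuousMultilinearMap.mkPiRing ℂ (Fin n) (c n)
  have hp : ∀ k, p.coeff k = c k := fun k => by simp [p, FormalMultilinearSeries.coeff]
  have h1 : HasFPowerSeriesAt (0 : ℂ → ℂ) p 0 := by
    rw [hasFPowerSeriesAt_iff]
    refine Eventually.of_forall fun z => ?_
    simpa [hp] using h z
  rw [← hp, h1.eq_zero]
  simp [FormalMultilinearSeries.coeff]

/-! ### Support functions in a coordinate -/

/-- The support function of `K ⊆ ℂ`, for the pairing `(z, w) ↦ w z`. -/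
def coordSupport (K : Set ℂ) (w : ℂ) : ℝ := sSup ((fun z => (w * z).re) '' K)

/-- The open half-plane defined by the support line of `K` in the direction `θ`, on the side which
does not contain `K`. -/
def outerHalfPlane (K : Set ℂ) (θ : ℂ) : Set ℂ := {z | coordSupport K θ < (θ * z).re}

theorem bddAbove_image_re_mul {K : Set ℂ} (hK : Bornology.IsBounded K) (w : ℂ) :
    BddAbove ((fun z => (w * z).re) '' K) := by
  obtain ⟨r, hr⟩ := hK.exists_norm_le
  refine ⟨‖w‖ * r, ?_⟩
  rintro _ ⟨z, hz, rfl⟩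
  calc (w * z).re ≤ ‖w * z‖ := Complex.re_le_norm _
    _ ≤ _ := by rw [norm_mul]; gcongr; exact hr z hz

theorem re_mul_le_coordSupport {K : Set ℂ} (hK : Bornology.IsBounded K) {z : ℂ} (hz : z ∈ K) (w : ℂ) :
    (w * z).re ≤ coordSupport K w :=
  le_csSup (bddAbove_image_re_mul hK w) ⟨z, hz, rfl⟩

theorem coordSupport_le {K : Set ℂ} (hne : K.Nonempty) {w : ℂ} {a : ℝ}
    (h : ∀ z ∈ K, (w * z).re ≤ a) : coordSupport K w ≤ a := by
  refine csSup_le (hne.image _) ?_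
  rintro _ ⟨z, hz, rfl⟩
  exact h z hz

theorem coordSupport_le_norm_mul {K : Set ℂ} (hne : K.Nonempty) {r : ℝ}
    (hr : ∀ z ∈ K, ‖z‖ ≤ r) (w : ℂ) : coordSupport K w ≤ ‖w‖ * r :=
  coordSupport_le hne fun z hz => by
    calc (w * z).re ≤ ‖w * z‖ := Complex.re_le_norm _
      _ ≤ _ := by rw [norm_mul]; gcongr; exact hr z hz

theorem coordSupport_real_mul {K : Set ℂ} {t : ℝ} (ht : 0 ≤ t) (w : ℂ) :
    coordSupport K (t * w) = t * coordSupport K w := by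
  unfold coordSupport
  rw [← smul_eq_mul t (sSup _), ← Real.sSup_smul_of_nonneg ht]
  congr 1
  ext x
  simp only [mem_image, mem_smul_set, exists_exists_and_eq_and, smul_eq_mul]
  refine exists_congr fun z => and_congr_right fun _ => ?_
  rw [mul_assoc, Complex.re_ofReal_mul]

/-- Hahn–Banach separation: a linear functional on `ℂ` is multiplication by `f 1`, which is
normalized to unit modulus. This is where convexity of `K` enters. -/
theorem exists_mem_outerHalfPlane {K : Set ℂ} (hne : K.Nonempty) (hconv : Convex ℝ K)
    (hK : IsCompact K) {z : ℂ} (hz : z ∉ K) : ∃ θ : ℂ, ‖θ‖ = 1 ∧ z ∈ outerHalfPlane K θ := by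
  obtain ⟨f, s, hs, hsz⟩ := RCLike.geometric_hahn_banach_closed_point (𝕜 := ℂ) hconv hK.isClosed hz
  have hf : ∀ x, f x = f 1 * x := fun x => by
    have := f.map_smul x 1
    rw [smul_eq_mul, mul_one, smul_eq_mul] at this
    rw [this, mul_comm]
  have hf0 : f 1 ≠ 0 := by
    intro h0
    obtain ⟨k, hk⟩ := hne
    have := (hs k hk).trans hsz
    rw [hf k, hf z, h0] at this
    simp at this
  have hn : 0 < ‖f 1‖ := norm_pos_iff.2 hf0
  refine ⟨((‖f 1‖⁻¹ : ℝ) : ℂ) * f 1, ?_, ?_⟩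
  · rw [norm_mul, Complex.norm_real, Real.norm_eq_abs, abs_of_pos (by positivity)]
    exact inv_mul_cancel₀ hn.ne'
  · rw [outerHalfPlane, mem_ofPred_eq, coordSupport_real_mul (by positivity), mul_assoc,
      Complex.re_ofReal_mul]
    refine mul_lt_mul_of_pos_left ?_ (by positivity)
    refine (coordSupport_le hne (a := s) fun k hk => ?_).trans_lt (by rw [← hf]; exact hsz)
    rw [← hf]; exact (hs k hk).le

theorem isOpen_outerHalfPlane (K : Set ℂ) (θ : ℂ) : IsOpen (outerHalfPlane K θ) :=
  isOpen_lt continuous_const (by fun_prop)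

theorem convex_setOf_lt_re_mul (θ : ℂ) (a : ℝ) : Convex ℝ {z : ℂ | a < (θ * z).re} :=
  convex_halfSpace_gt (IsLinearMap.mk (by simp [mul_add]) (by intro c x; simp; ring)) a

theorem outerHalfPlane_subset_compl {K : Set ℂ} (hK : Bornology.IsBounded K) (θ : ℂ) :
    outerHalfPlane K θ ⊆ Kᶜ := fun _ hz hzK =>
  absurd (re_mul_le_coordSupport hK hzK θ) (not_le.2 hz)

theorem mul_conj_of_norm_eq_one {θ : ℂ} (h : ‖θ‖ = 1) : θ * (starRingEnd ℂ) θ = 1 := by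
  rw [Complex.mul_conj, Complex.normSq_eq_norm_sq, h]; simp

theorem exists_norm_eq_one_mul_eq_norm (w : ℂ) : ∃ θ : ℂ, ‖θ‖ = 1 ∧ w = ‖w‖ * θ := by
  by_cases hw : w = 0
  · exact ⟨1, by simp, by simp [hw]⟩
  · refine ⟨w / ‖w‖, ?_, ?_⟩
    · rw [norm_div, Complex.norm_real, norm_norm, div_self (norm_ne_zero_iff.2 hw)]
    · rw [mul_div_cancel₀]
      exact_mod_cast norm_ne_zero_iff.2 hw

/-! ### The direct estimate -/

/-- A compact set is enclosed in large discs which are almost tangent to its support lines. -/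
theorem exists_ball_of_support {K : Set ℂ} (hne : K.Nonempty) (hK : Bornology.IsBounded K) {ε : ℝ}
    (hε : 0 < ε) : ∃ ρ δ D : ℝ, 0 < δ ∧ δ < ρ ∧ ∀ θ : ℂ, ‖θ‖ = 1 → ∃ c : ℂ, ‖c‖ ≤ D ∧
      (θ * c).re + ρ = coordSupport K θ + ε ∧ K ⊆ Metric.ball c (ρ - δ) := by
  obtain ⟨r, hr0, hr⟩ := hK.exists_pos_norm_le
  -- With `x = a + ε - Re(θ k)`, which lies in `[ε, 2r + ε]`, the squared distance from `k` to the
  -- center is at most `ρ² - 2ρx + x² + r²`. The choice makes `ρ ε` exceed `x² + r²`, so that this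
  -- is below `(ρ - ε / 4)²`.
  set ρ := ((2 * r + ε) ^ 2 + r ^ 2 + ε) / ε with hρ
  have hρε : ρ * ε = (2 * r + ε) ^ 2 + r ^ 2 + ε := by rw [hρ]; field_simp
  have hερ : ε < ρ := by
    rw [hρ, lt_div_iff₀ hε]
    nlinarith
  refine ⟨ρ, ε / 4, r + ε + ρ, by positivity, by linarith, fun θ hθ => ?_⟩
  set a := coordSupport K θ with ha
  have har : a ≤ r := by
    have := coordSupport_le_norm_mul hne hr θ
    rwa [hθ, one_mul] at this
  have har' : -r ≤ a := by
    obtain ⟨k, hk⟩ := hne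
    refine le_trans ?_ (re_mul_le_coordSupport hK hk θ)
    have h1 := Complex.abs_re_le_norm (θ * k)
    rw [norm_mul, hθ, one_mul] at h1
    linarith [(abs_le.1 h1).1, hr k hk]
  refine ⟨(starRingEnd ℂ) θ * ((a + ε - ρ : ℝ) : ℂ), ?_, ?_, ?_⟩
  · rw [norm_mul, Complex.norm_conj, hθ, one_mul, Complex.norm_real, Real.norm_eq_abs, abs_le]
    constructor <;> linarith
  · rw [← mul_assoc, mul_conj_of_norm_eq_one hθ, one_mul, Complex.ofReal_re]
    ring
  · intro k hk
    have h1 : ‖k - (starRingEnd ℂ) θ * ((a + ε - ρ : ℝ) : ℂ)‖ = ‖θ * k - ((a + ε - ρ : ℝ) : ℂ)‖ := by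
      rw [← one_mul ‖_ - _‖, ← hθ, ← norm_mul, mul_sub, ← mul_assoc, mul_conj_of_norm_eq_one hθ,
        one_mul]
    rw [mem_ball_iff_norm, h1]
    have h2 : (θ * k).re ≤ a := re_mul_le_coordSupport hK hk θ
    have h3 : ‖θ * k‖ ≤ r := by rw [norm_mul, hθ, one_mul]; exact hr k hk
    have h4 := (Complex.abs_re_le_norm (θ * k)).trans h3
    have h5 := (Complex.abs_im_le_norm (θ * k)).trans h3
    rw [abs_le] at h4
    have h6 : (θ * k).im ^ 2 ≤ r ^ 2 := sq_le_sq' (abs_le.1 h5).1 (abs_le.1 h5).2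
    refine lt_of_pow_lt_pow_left₀ 2 (by linarith) ?_
    rw [Complex.sq_norm, Complex.normSq_apply]
    simp only [Complex.sub_re, Complex.ofReal_re, Complex.sub_im, Complex.ofReal_im, sub_zero]
    set x := a + ε - (θ * k).re with hx
    have hx1 : ε ≤ x := by linarith
    have hx2 : x ≤ 2 * r + ε := by linarith
    have hre : (θ * k).re - (a + ε - ρ) = ρ - x := by rw [hx]; ring
    rw [hre]
    have hx0 : 0 ≤ x := hε.le.trans hx1
    have hx3 : x ^ 2 ≤ (2 * r + ε) ^ 2 := by gcongr
    nlinarith [mul_le_mul_of_nonneg_left hx1 (by linarith : (0 : ℝ) ≤ ρ)]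

/-- The contour is replaced, for each direction of `w`, by a circle that reaches only `ε` beyond the
support line of `K`. On it `Re(w z) ≤ h_K(w) + ε ‖w‖`, and its length does not depend on `w`. -/
theorem exists_norm_circleIntegral_exp_mul_le {K : Set ℂ} (hne : K.Nonempty) (hK : IsCompact K)
    {u : ℂ → ℂ} (hu : DifferentiableOn ℂ u Kᶜ) {r : ℝ} (hr : K ⊆ Metric.ball 0 r) {ε : ℝ}
    (hε : 0 < ε) : ∃ C : ℝ, ∀ w : ℂ, ‖∮ z in C(0, r), Complex.exp (w * z) * u z‖ ≤
      C * Real.exp (coordSupport K w + ε * ‖w‖) := by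
  obtain ⟨ρ, δ, D, hδ, hδρ, h⟩ := exists_ball_of_support hne hK.isBounded hε
  -- All these circles lie in one compact subset of the complement of `K`, so `u` is bounded on them
  -- uniformly in `w`.
  set Q : Set ℂ := Metric.closedBall 0 (D + ρ) ∩ {z | δ ≤ Metric.infDist z K} with hQ
  have hQc : IsCompact Q := (isCompact_closedBall _ _).inter_right
    (isClosed_le continuous_const (Metric.continuous_infDist_pt K))
  have hQK : Q ⊆ Kᶜ := fun z hz hzK => by
    have : δ ≤ Metric.infDist z K := hz.2
    rw [Metric.infDist_zero_of_mem hzK] at this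
    linarith
  obtain ⟨M, hM⟩ := hQc.exists_bound_of_continuousOn (hu.continuousOn.mono hQK)
  refine ⟨2 * Real.pi * ρ * M, fun w => ?_⟩
  obtain ⟨θ, hθ, hw⟩ := exists_norm_eq_one_mul_eq_norm w
  obtain ⟨c, hcD, hc, hKc⟩ := h θ hθ
  have hF : DifferentiableOn ℂ (fun z => Complex.exp (w * z) * u z) Kᶜ :=
    DifferentiableOn.mul (by fun_prop) hu
  rw [circleIntegral_eq_of_differentiableOn_compl hK.isClosed hne hF hr
    (hKc.trans (Metric.ball_subset_ball (by linarith : ρ - δ ≤ ρ)))]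
  refine (circleIntegral.norm_integral_le_of_norm_le_const (by linarith)
    (C := M * Real.exp (coordSupport K w + ε * ‖w‖)) fun z hz => ?_).trans (le_of_eq (by ring))
  rw [Metric.mem_sphere, dist_eq_norm] at hz
  have hzQ : z ∈ Q := by
    refine ⟨?_, (Metric.le_infDist hne).2 fun k hk => ?_⟩
    · rw [mem_closedBall_zero_iff]
      have := norm_sub_norm_le z c
      linarith
    · have h1 := hKc hk
      rw [mem_ball_iff_norm] at h1
      have h2 := norm_sub_norm_le (z - c) (k - c)
      rw [sub_sub_sub_cancel_right] at h2
      rw [dist_eq_norm]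
      linarith
  rw [norm_mul, mul_comm, Complex.norm_exp]
  have hM0 : 0 ≤ M := (norm_nonneg _).trans (hM z hzQ)
  gcongr
  · exact hM z hzQ
  · have h3 : coordSupport K w = ‖w‖ * coordSupport K θ := by
      conv_lhs => rw [hw]
      exact coordSupport_real_mul (norm_nonneg w) θ
    have h4 : (w * z).re = ‖w‖ * (θ * z).re := by
      conv_lhs => rw [hw, mul_assoc, Complex.re_ofReal_mul]
    have h5 : (θ * z).re ≤ coordSupport K θ + ε := by
      have h6 : (θ * (z - c)).re ≤ ρ := by
        refine (Complex.re_le_norm _).trans ?_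
        rw [norm_mul, hθ, one_mul, hz]
      rw [mul_sub, Complex.sub_re] at h6
      linarith
    rw [h3, h4]
    nlinarith [norm_nonneg w]

/-! ### Injectivity -/

/-- The difference quotient `dslope u z` is holomorphic across `z`, so its integrals over `|ζ| = r`
and over a large circle agree. The kernel contributes `0` on the first and `2πi` on the second, and
the large-circle integral of the kernel times `u` tends to `0` because `u` does. -/
theorem circleIntegral_exterior_cauchy {u : ℂ → ℂ} {r : ℝ} (hr : 0 < r)
    (hu : ∀ z, r ≤ ‖z‖ → DifferentiableAt ℂ u z) (h0 : Tendsto u (Bornology.cobounded ℂ) (𝓝 0))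
    {z : ℂ} (hz : r < ‖z‖) : (∮ ζ in C(0, r), (ζ - z)⁻¹ * u ζ) = -(2 * Real.pi * Complex.I * u z) := by
  have hsph : ∀ {R : ℝ}, r ≤ R → R ≠ ‖z‖ → ∀ ζ ∈ Metric.sphere (0 : ℂ) R, ζ ≠ z ∧ r ≤ ‖ζ‖ := by
    intro R hR hne ζ hζ
    rw [mem_sphere_zero_iff_norm] at hζ
    exact ⟨fun h => hne (by rw [← hζ, h]), by rw [hζ]; exact hR⟩
  have hcont : ∀ {R : ℝ}, r ≤ R → R ≠ ‖z‖ →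
      ContinuousOn (fun ζ => (ζ - z)⁻¹) (Metric.sphere (0 : ℂ) R) := fun hR hne ζ hζ =>
    (((continuousAt_id.sub continuousAt_const).inv₀
      (sub_ne_zero.2 (hsph hR hne ζ hζ).1))).continuousWithinAt
  have hucont : ∀ {R : ℝ}, r ≤ R → R ≠ ‖z‖ → ContinuousOn u (Metric.sphere (0 : ℂ) R) :=
    fun hR hne ζ hζ => (hu ζ (hsph hR hne ζ hζ).2).continuousAt.continuousWithinAt
  have hsplit : ∀ {R : ℝ}, r ≤ R → R ≠ ‖z‖ → (∮ ζ in C(0, R), dslope u z ζ) =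
      (∮ ζ in C(0, R), (ζ - z)⁻¹ * u ζ) - u z * ∮ ζ in C(0, R), (ζ - z)⁻¹ := by
    intro R hR hne
    have hR0 : 0 ≤ R := hr.le.trans hR
    rw [← circleIntegral.integral_const_mul,
      ← circleIntegral.integral_sub (f := fun ζ => (ζ - z)⁻¹ * u ζ) (g := fun ζ => u z * (ζ - z)⁻¹)
      (((hcont hR hne).mul (hucont hR hne)).circleIntegrable hR0)
      ((continuousOn_const.mul (hcont hR hne)).circleIntegrable hR0)]
    refine circleIntegral.integral_congr hR0 fun ζ hζ => ?_
    rw [dslope_of_ne _ (hsph hR hne ζ hζ).1, slope_def_field, div_eq_inv_mul]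
    ring
  have hr0 : (∮ ζ in C(0, r), (ζ - z)⁻¹) = 0 := by
    have hne : ∀ ζ ∈ Metric.closedBall (0 : ℂ) r, ζ - z ≠ 0 := fun ζ hζ h => by
      rw [mem_closedBall_zero_iff, sub_eq_zero.1 h] at hζ
      linarith
    exact Complex.circleIntegral_eq_zero_of_differentiable_on_off_countable hr.le Set.countable_empty
      (fun ζ hζ => ((continuousAt_id.sub continuousAt_const).inv₀ (hne ζ hζ)).continuousWithinAt)
      fun ζ hζ => (differentiableAt_id.sub_const z).inv (hne ζ (Metric.ball_subset_closedBall hζ.1))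
  have hconst : ∀ R, ‖z‖ < R → (∮ ζ in C(0, R), (ζ - z)⁻¹ * u ζ) =
      (∮ ζ in C(0, r), (ζ - z)⁻¹ * u ζ) + 2 * Real.pi * Complex.I * u z := by
    intro R hR
    have h1 : (∮ ζ in C(0, R), dslope u z ζ) = ∮ ζ in C(0, r), dslope u z ζ := by
      refine Complex.circleIntegral_eq_of_differentiable_on_annulus_off_countable hr (hz.trans hR).le
        (Set.countable_singleton z) (fun ζ hζ => ?_) fun ζ hζ => ?_
      · have hζr : r ≤ ‖ζ‖ := by simpa using hζ.2
        by_cases hζz : ζ = z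
        · rw [hζz]
          exact (continuousAt_dslope_same.2 (hu z hz.le)).continuousWithinAt
        · exact ((continuousAt_dslope_of_ne hζz).2 (hu ζ hζr).continuousAt).continuousWithinAt
      · have hζr : r < ‖ζ‖ := by simpa using hζ.1.2
        exact (differentiableAt_dslope_of_ne hζ.2).2 (hu ζ hζr.le)
    rw [hsplit (hz.trans hR).le hR.ne', hsplit le_rfl hz.ne, hr0,
      circleIntegral.integral_sub_inv_of_mem_ball (by simpa using hR)] at h1
    linear_combination h1
  have hlim : Tendsto (fun R : ℝ => ∮ ζ in C(0, R), (ζ - z)⁻¹ * u ζ) atTop (𝓝 0) := by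
    rw [Metric.tendsto_nhds]
    intro ε hε
    have hη : 0 < ε / (8 * Real.pi) := by positivity
    obtain ⟨R₀, -, hR₀⟩ := ((Metric.hasBasis_cobounded_compl_closedBall (0 : ℂ)).eventually_iff).1
      (Metric.tendsto_nhds.1 h0 _ hη)
    filter_upwards [eventually_gt_atTop R₀, eventually_gt_atTop (2 * ‖z‖)] with R hR1 hR2
    have hR0 : 0 < R := (by positivity : 0 ≤ 2 * ‖z‖).trans_lt hR2
    rw [dist_zero_right]
    refine (circleIntegral.norm_integral_le_of_norm_le_const hR0.le
      (C := 2 / R * (ε / (8 * Real.pi))) fun ζ hζ => ?_).trans_lt ?_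
    · rw [mem_sphere_zero_iff_norm] at hζ
      have h1 : ‖u ζ‖ ≤ ε / (8 * Real.pi) := by
        have := hR₀ (x := ζ) (by simp [hζ, hR1])
        rw [dist_zero_right] at this
        exact this.le
      have h2 : R / 2 ≤ ‖ζ - z‖ := by
        have := norm_sub_norm_le ζ z
        linarith
      rw [norm_mul, norm_inv]
      gcongr
      rw [inv_le_comm₀ (by linarith) (by positivity), inv_div]
      exact h2
    · have hpi := Real.pi_pos
      have : 2 * Real.pi * R * (2 / R * (ε / (8 * Real.pi))) = ε / 2 := by field_simp; ring
      rw [this]; linarith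
  have h2 := tendsto_nhds_unique hlim (tendsto_const_nhds.congr' (by
    filter_upwards [eventually_gt_atTop ‖z‖] with R hR using (hconst R hR).symm))
  linear_combination -h2

/-- If the transform vanishes, so do its Taylor coefficients, that is, all moments of `u`. Expanding
the Cauchy kernel geometrically for `|z| > r` gives `u z = 0` there. A half-plane separating `z`
from `K` is connected and meets this region, so `u` vanishes at every `z ∉ K`. -/
theorem eqOn_zero_of_circleIntegral_exp_mul_eq_zero {K : Set ℂ} (hne : K.Nonempty)
    (hconv : Convex ℝ K) (hK : IsCompact K) {u : ℂ → ℂ} (hu : DifferentiableOn ℂ u Kᶜ)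
    (h0 : Tendsto u (Bornology.cobounded ℂ) (𝓝 0)) {r : ℝ} (hr : K ⊆ Metric.ball 0 r)
    (h : ∀ w : ℂ, (∮ z in C(0, r), Complex.exp (w * z) * u z) = 0) {z : ℂ} (hz : z ∉ K) :
    u z = 0 := by
  have hr0 : 0 < r := by
    obtain ⟨k, hk⟩ := hne
    exact Metric.pos_of_mem_ball (hr hk)
  have hud : ∀ z, r ≤ ‖z‖ → DifferentiableAt ℂ u z := fun z hz =>
    hu.differentiableAt (hK.isClosed.isOpen_compl.mem_nhds fun hzK => by
      have := hr hzK
      rw [mem_ball_zero_iff] at this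
      linarith)
  have huc : ContinuousOn u (Metric.sphere 0 r) := fun ζ hζ =>
    (hud ζ (mem_sphere_zero_iff_norm.1 hζ).ge).continuousAt.continuousWithinAt
  have hmom : ∀ n : ℕ, (∮ z in C(0, r), z ^ n * u z) = 0 := fun n => by
    have := eq_zero_of_forall_hasSum_pow_mul (fun w => by
      rw [← h w]; exact hasSum_circleIntegral_exp_mul hr0.le huc w) n
    rcases mul_eq_zero.1 this with h1 | h1
    · exact absurd h1 (inv_ne_zero (by exact_mod_cast n.factorial_ne_zero))
    · exact h1
  have hfar : ∀ z, r < ‖z‖ → u z = 0 := by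
    intro z hz
    obtain ⟨M, hM⟩ := (isCompact_sphere (0 : ℂ) r).exists_bound_of_continuousOn huc
    have hz0 : z ≠ 0 := norm_pos_iff.1 (hr0.trans hz)
    have hq : r / ‖z‖ < 1 := (div_lt_one (hr0.trans hz)).2 hz
    have hs := hasSum_circleIntegral (F := fun n ζ => -z⁻¹ ^ (n + 1) * (ζ ^ n * u ζ))
      (f := fun ζ => (ζ - z)⁻¹ * u ζ) (b := fun n => (r / ‖z‖) ^ n * (‖z‖⁻¹ * M)) hr0.le
      (fun n => by fun_prop) ((summable_geometric_of_lt_one (by positivity) hq).mul_right _)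
      (fun n ζ hζ => ?_) fun ζ hζ => ?_
    · simp_rw [circleIntegral.integral_const_mul, hmom, mul_zero] at hs
      have := hs.unique hasSum_zero
      rw [circleIntegral_exterior_cauchy hr0 hud h0 hz, neg_eq_zero] at this
      exact (mul_eq_zero.1 this).resolve_left Complex.two_pi_I_ne_zero
    · rw [norm_mul, norm_neg, norm_mul, norm_pow, norm_pow, norm_inv,
        mem_sphere_zero_iff_norm.1 hζ, div_eq_mul_inv, mul_pow, pow_succ]
      have := hM ζ hζ
      calc _ = r ^ n * ‖z‖⁻¹ ^ n * (‖z‖⁻¹ * ‖u ζ‖) := by ring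
        _ ≤ _ := by gcongr
    · have hlt : ‖z⁻¹ * ζ‖ < 1 := by
        rw [norm_mul, norm_inv, mem_sphere_zero_iff_norm.1 hζ, ← div_eq_inv_mul]
        exact hq
      have hζz : ζ - z ≠ 0 := fun h => by
        rw [mem_sphere_zero_iff_norm, sub_eq_zero.1 h] at hζ
        linarith
      have h1 := ((hasSum_geometric_of_norm_lt_one hlt).mul_left (-z⁻¹ * u ζ))
      have h2 : 1 - z⁻¹ * ζ = -z⁻¹ * (ζ - z) := by field_simp; ring
      have h3 : (ζ - z)⁻¹ * u ζ = -z⁻¹ * u ζ * (1 - z⁻¹ * ζ)⁻¹ := by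
        rw [h2, mul_inv, inv_neg, inv_inv]
        field_simp
      rw [h3]
      refine h1.congr_fun fun n => ?_
      rw [mul_pow, pow_succ]; ring
  obtain ⟨θ, hθ, hzθ⟩ := exists_mem_outerHalfPlane hne hconv hK hz
  have han : AnalyticOnNhd ℂ u (outerHalfPlane K θ) :=
    (hu.mono (outerHalfPlane_subset_compl hK.isBounded θ)).analyticOnNhd (isOpen_outerHalfPlane K θ)
  -- A real number large enough that the point `s` times the conjugate of `θ` lies both in the
  -- half-plane and outside the disc of radius `r`.
  set s := max (|coordSupport K θ|) r + 1 with hs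
  have hsr : r < s := by linarith [le_max_right |coordSupport K θ| r]
  have hsm : (starRingEnd ℂ) θ * (s : ℂ) ∈ outerHalfPlane K θ := by
    rw [outerHalfPlane, mem_ofPred_eq, ← mul_assoc, mul_conj_of_norm_eq_one hθ, one_mul,
      Complex.ofReal_re]
    linarith [le_max_left |coordSupport K θ| r, le_abs_self (coordSupport K θ)]
  refine han.eqOn_zero_of_preconnected_of_eventuallyEq_zero
    (convex_setOf_lt_re_mul θ _).isPreconnected hsm ?_ hzθ
  filter_upwards [(isOpen_lt_norm r).mem_nhds (x := (starRingEnd ℂ) θ * (s : ℂ)) (by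
    rw [mem_ofPred_eq, norm_mul, Complex.norm_conj, hθ, one_mul, Complex.norm_real,
      Real.norm_eq_abs]
    exact hsr.trans_le (le_abs_self s))] with y hy using hfar y hy

/-! ### The Borel transform -/

/-- The Laplace transform of `v` along the ray `ℝ₊ θ`. -/
def rayLaplace (v : ℂ → ℂ) (θ z : ℂ) : ℂ :=
  ∫ t in Ioi (0 : ℝ), v (t * θ) * (θ * Complex.exp (-(t * (θ * z))))

/-- The rate `b` of `v` along the ray is beaten by `e^{-t Re(θ z)}` as soon as `Re(θ z) > b`; the
derivative in `z` is taken under the integral. -/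
theorem differentiableOn_rayLaplace {v : ℂ → ℂ} (hv : Continuous v) {θ : ℂ} (hθ : ‖θ‖ = 1) {b : ℝ}
    (hb : ∀ η, b < η → ∃ C, ∀ t : ℝ, 0 < t → ‖v (t * θ)‖ ≤ C * Real.exp (η * t)) :
    DifferentiableOn ℂ (rayLaplace v θ) {z | b < (θ * z).re} := by
  intro z hz
  rw [mem_ofPred_eq] at hz
  set s := (θ * z).re with hs
  -- A quarter of the gap: one share for the growth of `v`, one for moving `z` in a disc, and enough
  -- is left for decay `e^{-κ t}`.
  set κ := (s - b) / 4 with hκ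
  have hκ0 : 0 < κ := by rw [hκ]; linarith
  obtain ⟨C, hC⟩ := hb (b + κ) (by linarith)
  have hC0 : 0 ≤ C := by
    have := (norm_nonneg _).trans (hC 1 one_pos)
    exact nonneg_of_mul_nonneg_left this (Real.exp_pos _)
  have hmeas : ∀ z : ℂ, Continuous fun t : ℝ => v (t * θ) * (θ * Complex.exp (-(t * (θ * z)))) :=
    fun z => by fun_prop
  have hnorm : ∀ (y : ℂ) (t : ℝ), 0 < t → b + 2 * κ ≤ (θ * y).re →
      ‖v (t * θ) * (θ * Complex.exp (-(t * (θ * y))))‖ ≤ C * Real.exp (-κ * t) := by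
    intro y t ht hy
    rw [norm_mul, norm_mul, hθ, one_mul, Complex.norm_exp, Complex.neg_re, Complex.re_ofReal_mul]
    calc _ ≤ C * Real.exp ((b + κ) * t) * Real.exp (-(t * (θ * y).re)) := by gcongr; exact hC t ht
      _ ≤ C * Real.exp (-κ * t) := by
        rw [mul_assoc, ← Real.exp_add]
        gcongr
        nlinarith
  have hint : IntegrableOn (fun t : ℝ => C * (2 / κ) * Real.exp (-(κ / 2) * t)) (Ioi 0) :=
    (exp_neg_integrableOn_Ioi 0 (by positivity)).const_mul _
  have hint0 : IntegrableOn (fun t : ℝ => C * Real.exp (-κ * t)) (Ioi 0) :=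
    (exp_neg_integrableOn_Ioi 0 hκ0).const_mul _
  have hball : ∀ y ∈ Metric.ball z κ, b + 2 * κ ≤ (θ * y).re := by
    intro y hy
    rw [mem_ball_iff_norm'] at hy
    have h1 := (Complex.re_le_norm (θ * (z - y)))
    rw [norm_mul, hθ, one_mul, mul_sub, Complex.sub_re] at h1
    rw [← hs] at h1
    linarith
  refine (hasDerivAt_integral_of_dominated_loc_of_deriv_le (μ := volume.restrict (Ioi (0 : ℝ)))
    (F := fun (y : ℂ) (t : ℝ) => v (t * θ) * (θ * Complex.exp (-(t * (θ * y)))))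
    (F' := fun (y : ℂ) (t : ℝ) => -(t * θ) * (v (t * θ) * (θ * Complex.exp (-(t * (θ * y))))))
    (bound := fun t => C * (2 / κ) * Real.exp (-(κ / 2) * t))
    (Metric.ball_mem_nhds z hκ0) ?_ ?_ ?_ ?_ hint ?_).2.differentiableAt.differentiableWithinAt
  · exact Eventually.of_forall fun y => (hmeas y).aestronglyMeasurable
  · refine hint0.mono' (hmeas z).aestronglyMeasurable ?_
    filter_upwards [ae_restrict_mem measurableSet_Ioi] with t ht
    exact hnorm z t ht (hball z (Metric.mem_ball_self hκ0))
  · exact (Continuous.mul (by fun_prop) (hmeas z)).aestronglyMeasurable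
  · filter_upwards [ae_restrict_mem measurableSet_Ioi] with t ht y hy
    have ht0 : 0 < t := ht
    rw [norm_mul, norm_neg, norm_mul, hθ, mul_one, Complex.norm_real, Real.norm_eq_abs, abs_of_pos ht0]
    -- The factor `t` created by differentiation is absorbed by half of the decay.
    have h1 : t ≤ 2 / κ * Real.exp (κ / 2 * t) := by
      have := Real.add_one_le_exp (κ / 2 * t)
      rw [div_mul_eq_mul_div, le_div_iff₀ hκ0]
      nlinarith
    calc _ ≤ 2 / κ * Real.exp (κ / 2 * t) * (C * Real.exp (-κ * t)) := by
          gcongr; exact hnorm y t ht (hball y hy)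
      _ = C * (2 / κ) * (Real.exp (κ / 2 * t) * Real.exp (-κ * t)) := by ring
      _ = _ := by
        rw [← Real.exp_add]
        congr 2
        ring
  · filter_upwards with t y _
    have h1 : HasDerivAt (fun y : ℂ => -(t * (θ * y))) (-(t * θ)) y := by
      exact (((hasDerivAt_id y).const_mul θ).const_mul (t : ℂ)).neg.congr_deriv (by simp)
    have h2 := (h1.cexp.const_mul θ).const_mul (v (t * θ))
    exact h2.congr_deriv (by ring)

theorem integrableOn_pow_mul_exp_neg (n : ℕ) {σ : ℝ} (hσ : 0 < σ) :
    IntegrableOn (fun t : ℝ => t ^ n * Real.exp (-(σ * t))) (Ioi 0) := by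
  have := integrableOn_rpow_mul_exp_neg_mul_rpow (p := 1) (s := n) (b := σ)
    (by have : (0 : ℝ) ≤ n := n.cast_nonneg
        linarith) one_pos hσ
  refine this.congr_fun (fun t _ => ?_) measurableSet_Ioi
  simp

theorem integral_pow_mul_exp_neg_real (n : ℕ) {σ : ℝ} (hσ : 0 < σ) :
    ∫ t in Ioi (0 : ℝ), t ^ n * Real.exp (-(σ * t)) = n.factorial * (σ ^ (n + 1))⁻¹ := by
  have h := Real.integral_rpow_mul_exp_neg_mul_Ioi (a := n + 1) (by positivity) hσ
  rw [Real.Gamma_nat_eq_factorial, add_sub_cancel_right] at h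
  simp only [Real.rpow_natCast] at h
  rw [h, one_div, Real.inv_rpow hσ.le]
  rw [show ((n : ℝ) + 1) = ((n + 1 : ℕ) : ℝ) by push_cast; ring, Real.rpow_natCast, mul_comm]

theorem norm_pow_mul_cexp_neg (n : ℕ) (s : ℂ) {t : ℝ} (ht : 0 ≤ t) :
    ‖(t : ℂ) ^ n * Complex.exp (-(t * s))‖ = t ^ n * Real.exp (-(s.re * t)) := by
  rw [norm_mul, norm_pow, Complex.norm_real, Real.norm_eq_abs, abs_of_nonneg ht, Complex.norm_exp,
    Complex.neg_re, Complex.re_ofReal_mul, mul_comm t]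

theorem integrableOn_pow_mul_cexp_neg (n : ℕ) {s : ℂ} (hs : 0 < s.re) :
    IntegrableOn (fun t : ℝ => (t : ℂ) ^ n * Complex.exp (-(t * s))) (Ioi 0) := by
  refine (integrableOn_pow_mul_exp_neg n hs).mono'
    (Continuous.aestronglyMeasurable (by fun_prop)) ?_
  filter_upwards [ae_restrict_mem measurableSet_Ioi] with t ht
  exact (norm_pow_mul_cexp_neg n s (le_of_lt ht)).le

/-- The Gamma integral with complex rate: integrating the derivative of `t ^ (n + 1) * exp (-(t *
s))` over the half-line gives the recursion in `n`. -/
theorem integral_pow_mul_cexp_neg (n : ℕ) {s : ℂ} (hs : 0 < s.re) :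
    ∫ t in Ioi (0 : ℝ), (t : ℂ) ^ n * Complex.exp (-(t * s)) = n.factorial * (s ^ (n + 1))⁻¹ := by
  have hs0 : s ≠ 0 := fun h => by simp [h] at hs
  have hexp : ∀ t : ℝ, HasDerivAt (fun t : ℝ => Complex.exp (-(t * s)))
      (Complex.exp (-(t * s)) * -s) t := fun t => by
    have h1 : HasDerivAt (fun t : ℝ => -((t : ℂ) * s)) (-s) t := by
      exact ((Complex.ofRealCLM.hasDerivAt (x := t)).mul_const s).neg.congr_deriv (by simp)
    exact h1.cexp
  have key : ∀ (n : ℕ) (f' : ℝ → ℂ), (∀ t, HasDerivAt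
      (fun t : ℝ => (t : ℂ) ^ n * Complex.exp (-(t * s))) (f' t) t) → IntegrableOn f' (Ioi 0) →
      ∫ t in Ioi (0 : ℝ), f' t = 0 - ((0 : ℝ) : ℂ) ^ n * Complex.exp (-((0 : ℝ) * s)) := by
    intro n f' hd hi
    exact integral_Ioi_of_hasDerivAt_of_tendsto' (fun t _ => hd t) hi
      (tendsto_zero_of_hasDerivAt_of_integrableOn_Ioi (fun t _ => hd t) hi
        (integrableOn_pow_mul_cexp_neg n hs))
  induction n with
  | zero =>
    have h0 := key 0 (fun t => Complex.exp (-(t * s)) * -s) (fun t => by simpa using hexp t)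
      (by
        refine Integrable.mul_const ?_ (-s)
        simpa using (integrableOn_pow_mul_cexp_neg 0 hs).integrable)
    rw [integral_mul_const] at h0
    simp only [pow_zero, one_mul, Complex.ofReal_zero, zero_mul, neg_zero, Complex.exp_zero] at h0 ⊢
    simp only [Nat.factorial_zero, Nat.cast_one, one_mul, zero_add, pow_one]
    refine eq_inv_of_mul_eq_one_left ?_
    linear_combination -h0
  | succ n ih =>
    have h1 : ∀ t : ℝ, HasDerivAt (fun t : ℝ => (t : ℂ) ^ (n + 1) * Complex.exp (-(t * s)))
        ((n + 1) * ((t : ℂ) ^ n * Complex.exp (-(t * s))) -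
          s * ((t : ℂ) ^ (n + 1) * Complex.exp (-(t * s)))) t := fun t => by
      have h2 : HasDerivAt (fun t : ℝ => (t : ℂ) ^ (n + 1)) ((n + 1) * (t : ℂ) ^ n) t := by
        exact ((Complex.ofRealCLM.hasDerivAt (x := t)).pow (n + 1)).congr_deriv (by simp)
      exact (h2.mul (hexp t)).congr_deriv (by ring)
    have i1 := (integrableOn_pow_mul_cexp_neg n hs).const_mul ((n : ℂ) + 1)
    have i2 := (integrableOn_pow_mul_cexp_neg (n + 1) hs).const_mul s
    have h0 := key (n + 1) _ h1 (i1.sub i2)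
    rw [integral_sub i1 i2, integral_const_mul, integral_const_mul, ih] at h0
    simp only [Complex.ofReal_zero, ne_eq, Nat.add_eq_zero_iff, one_ne_zero, and_false,
      not_false_eq_true, zero_pow, zero_mul, sub_zero] at h0
    rw [sub_eq_zero] at h0
    rw [pow_succ s (n + 1), mul_inv, ← mul_assoc, eq_mul_inv_iff_mul_eq₀ hs0, Nat.factorial_succ]
    push_cast
    linear_combination -h0

/-- The Taylor coefficients of an entire function of exponential type grow geometrically
(after multiplication by `n!`). -/
theorem exists_norm_iteratedDeriv_le_geometric {v : ℂ → ℂ} (hv : Differentiable ℂ v) {C A : ℝ}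
    (h : ∀ w, ‖v w‖ ≤ C * Real.exp (A * ‖w‖)) (n : ℕ) :
    ‖iteratedDeriv n v 0‖ ≤ C * Real.exp A ^ n := by
  have hC : 0 ≤ C := by simpa using (norm_nonneg _).trans (h 0)
  rcases n.eq_zero_or_pos with rfl | hn
  · simpa using h 0
  have hn' : (0 : ℝ) < n := by exact_mod_cast hn
  -- Cauchy's estimate on the circle of radius `n`, with `n! ≤ n ^ n` cancelling the power of the
  -- radius.
  have h1 := Complex.norm_iteratedDeriv_le_of_forall_mem_sphere_norm_le (c := 0) (R := n)
    (C := C * Real.exp (A * n)) (f := v) n hn' hv.diffContOnCl (fun z hz => by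
      have := h z
      rwa [mem_sphere_zero_iff_norm.1 hz] at this)
  refine h1.trans ?_
  rw [div_le_iff₀ (by positivity), ← Real.exp_nat_mul, mul_comm (n : ℝ) A]
  have h2 : (n.factorial : ℝ) ≤ (n : ℝ) ^ n := by exact_mod_cast Nat.factorial_le_pow n
  calc _ ≤ (n : ℝ) ^ n * (C * Real.exp (A * n)) := by gcongr
    _ = _ := by ring

/-- The Taylor series of `v` is integrated termwise. In each term `θ ^ (n + 1)` cancels against `(θ
* z) ^ (n + 1)`, so the series does not depend on the ray; this is why the transforms along
different rays agree. -/
theorem hasSum_rayLaplace {v : ℂ → ℂ} (hv : Differentiable ℂ v) {C B : ℝ} (hB : 0 ≤ B)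
    (h : ∀ n, ‖iteratedDeriv n v 0‖ ≤ C * B ^ n) {θ : ℂ} (hθ : ‖θ‖ = 1) {z : ℂ}
    (hz : B < (θ * z).re) :
    HasSum (fun n => iteratedDeriv n v 0 * (z ^ (n + 1))⁻¹) (rayLaplace v θ z) := by
  have hs : 0 < (θ * z).re := hB.trans_lt hz
  have hθ0 : θ ≠ 0 := norm_ne_zero_iff.1 (by rw [hθ]; exact one_ne_zero)
  have hz0 : z ≠ 0 := by rintro rfl; simp at hs
  set c : ℕ → ℂ := fun n => (n.factorial : ℂ)⁻¹ * iteratedDeriv n v 0 * θ ^ (n + 1) with hc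
  have hcn : ∀ n, ‖c n‖ = (n.factorial : ℝ)⁻¹ * ‖iteratedDeriv n v 0‖ := fun n => by
    simp [hc, hθ]
  have hsum := hasSum_integral_of_summable_integral_norm (μ := volume.restrict (Ioi (0 : ℝ)))
    (F := fun (n : ℕ) (t : ℝ) => c n * ((t : ℂ) ^ n * Complex.exp (-(t * (θ * z)))))
    (fun n => (integrableOn_pow_mul_cexp_neg n hs).const_mul (c n)) (by
      have hI : ∀ n : ℕ, ∫ t in Ioi (0 : ℝ), ‖c n * ((t : ℂ) ^ n * Complex.exp (-(t * (θ * z))))‖ =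
          ‖iteratedDeriv n v 0‖ * ((θ * z).re ^ (n + 1))⁻¹ := fun n => by
        have h1 : ∫ t in Ioi (0 : ℝ), ‖c n * ((t : ℂ) ^ n * Complex.exp (-(t * (θ * z))))‖ =
            ∫ t in Ioi (0 : ℝ), ‖c n‖ * (t ^ n * Real.exp (-((θ * z).re * t))) := by
          refine setIntegral_congr_fun measurableSet_Ioi fun t ht => ?_
          rw [norm_mul, norm_pow_mul_cexp_neg n _ (le_of_lt ht)]
        rw [h1, integral_const_mul, integral_pow_mul_exp_neg_real n hs, hcn]
        field_simp
      simp_rw [hI]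
      refine Summable.of_nonneg_of_le (fun n => by positivity) (fun n => ?_)
        ((summable_geometric_of_lt_one (by positivity) ((div_lt_one hs).2 hz)).mul_left
          (C * (θ * z).re⁻¹))
      calc _ ≤ C * B ^ n * ((θ * z).re ^ (n + 1))⁻¹ := by gcongr; exact h n
        _ = _ := by rw [div_pow, pow_succ, mul_inv]; ring)
  have h1 : ∀ n, ∫ t in Ioi (0 : ℝ), c n * ((t : ℂ) ^ n * Complex.exp (-(t * (θ * z)))) =
      iteratedDeriv n v 0 * (z ^ (n + 1))⁻¹ := fun n => by
    rw [integral_const_mul, integral_pow_mul_cexp_neg n hs, hc, mul_pow]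
    have := n.factorial_ne_zero
    field_simp
  simp_rw [h1] at hsum
  have hval : rayLaplace v θ z =
      ∫ t in Ioi (0 : ℝ), ∑' n, c n * ((t : ℂ) ^ n * Complex.exp (-(t * (θ * z)))) := ?_
  · rw [hval]; exact hsum
  refine setIntegral_congr_fun measurableSet_Ioi fun t _ => ?_
  have h2 := (Complex.hasSum_taylorSeries_of_entire hv 0 (t * θ)).mul_right
    (θ * Complex.exp (-(t * (θ * z))))
  rw [← h2.tsum_eq]
  refine tsum_congr fun n => ?_
  simp only [hc, sub_zero, smul_eq_mul, mul_pow]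
  ring

/-- The intersection of the two half-planes is convex, and far out in a common direction both
transforms equal the same series; the identity theorem does the rest. -/
theorem rayLaplace_eq_of_mem {K : Set ℂ} (hne : K.Nonempty) (hK : Bornology.IsBounded K) {v : ℂ → ℂ}
    {a : ℕ → ℂ} {B : ℝ}
    (hd : ∀ θ : ℂ, ‖θ‖ = 1 → DifferentiableOn ℂ (rayLaplace v θ) (outerHalfPlane K θ))
    (hs : ∀ θ : ℂ, ‖θ‖ = 1 → ∀ z, B < (θ * z).re →
      HasSum (fun n => a n * (z ^ (n + 1))⁻¹) (rayLaplace v θ z))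
    {θ₁ θ₂ z : ℂ} (h₁ : ‖θ₁‖ = 1) (h₂ : ‖θ₂‖ = 1) (hz₁ : z ∈ outerHalfPlane K θ₁)
    (hz₂ : z ∈ outerHalfPlane K θ₂) : rayLaplace v θ₁ z = rayLaplace v θ₂ z := by
  have hsum : θ₁ + θ₂ ≠ 0 := by
    intro h0
    obtain ⟨k, hk⟩ := hne
    have h3 := (re_mul_le_coordSupport hK hk θ₁).trans_lt hz₁
    have h4 := (re_mul_le_coordSupport hK hk θ₂).trans_lt hz₂
    rw [eq_neg_of_add_eq_zero_right h0] at h4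
    simp only [neg_mul, Complex.neg_re] at h4
    linarith
  -- The direction pointing into both half-planes: `Re(θᵢ e) = ‖θ₁ + θ₂‖² / 2`. It is nonzero
  -- because opposite half-planes are disjoint when `K` is nonempty.
  set e := (starRingEnd ℂ) (θ₁ + θ₂) with he
  have hn : 0 < ‖θ₁ + θ₂‖ := norm_pos_iff.2 hsum
  have hre : ∀ θ ∈ ({θ₁, θ₂} : Set ℂ), (θ * e).re = ‖θ₁ + θ₂‖ ^ 2 / 2 := by
    have e1 : θ₁.re ^ 2 + θ₁.im ^ 2 = 1 := by
      rw [← one_pow 2, ← h₁, Complex.sq_norm, Complex.normSq_apply]; ring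
    have e2 : θ₂.re ^ 2 + θ₂.im ^ 2 = 1 := by
      rw [← one_pow 2, ← h₂, Complex.sq_norm, Complex.normSq_apply]; ring
    rintro θ (rfl | rfl) <;> rw [Complex.sq_norm, Complex.normSq_apply, he] <;>
      simp only [map_add, Complex.mul_re, Complex.add_re, Complex.conj_re, Complex.add_im,
        Complex.conj_im] <;> linarith
  set m := max B (max (coordSupport K θ₁) (coordSupport K θ₂)) with hm
  set s := (|m| + 1) / (‖θ₁ + θ₂‖ ^ 2 / 2) with hsdef
  have hp : ∀ θ ∈ ({θ₁, θ₂} : Set ℂ), m < (θ * (s * e)).re := fun θ hθ => by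
    rw [mul_left_comm, Complex.re_ofReal_mul, hre θ hθ, hsdef, div_mul_cancel₀ _ (by positivity)]
    linarith [le_abs_self m]
  have hp₁ := hp θ₁ (by simp)
  have hp₂ := hp θ₂ (by simp)
  have hmB : B ≤ m := le_max_left _ _
  have hm₁ : coordSupport K θ₁ ≤ m := (le_max_left _ _).trans (le_max_right _ _)
  have hm₂ : coordSupport K θ₂ ≤ m := (le_max_right _ _).trans (le_max_right _ _)
  have han : ∀ θ, ‖θ‖ = 1 → AnalyticOnNhd ℂ (rayLaplace v θ) (outerHalfPlane K θ) := fun θ hθ =>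
    (hd θ hθ).analyticOnNhd (isOpen_outerHalfPlane K θ)
  refine AnalyticOnNhd.eqOn_of_preconnected_of_eventuallyEq
    (U := outerHalfPlane K θ₁ ∩ outerHalfPlane K θ₂) ((han θ₁ h₁).mono inter_subset_left)
    ((han θ₂ h₂).mono inter_subset_right)
    ((convex_setOf_lt_re_mul θ₁ _).inter (convex_setOf_lt_re_mul θ₂ _)).isPreconnected
    (z₀ := s * e) ⟨hm₁.trans_lt hp₁, hm₂.trans_lt hp₂⟩ ?_ ⟨hz₁, hz₂⟩
  have ho : ∀ θ : ℂ, IsOpen {z : ℂ | B < (θ * z).re} := fun θ =>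
    isOpen_lt continuous_const (by fun_prop)
  filter_upwards [(ho θ₁).mem_nhds (hmB.trans_lt hp₁), (ho θ₂).mem_nhds (hmB.trans_lt hp₂)]
    with y hy₁ hy₂
  exact (hs θ₁ h₁ y hy₁).unique (hs θ₂ h₂ y hy₂)

/-- Termwise integration of the series in negative powers: only the power `z⁻¹` survives. So the
moments of the Borel transform are the derivatives of `v` at `0`, up to `2πi`. -/
theorem circleIntegral_pow_mul_of_hasSum {u : ℂ → ℂ} {a : ℕ → ℂ} {C B r : ℝ} (hB : 0 ≤ B)
    (hr : B < r) (ha : ∀ n, ‖a n‖ ≤ C * B ^ n)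
    (hs : ∀ z ∈ Metric.sphere (0 : ℂ) r, HasSum (fun n => a n * (z ^ (n + 1))⁻¹) (u z)) (m : ℕ) :
    (∮ z in C(0, r), z ^ m * u z) = 2 * Real.pi * Complex.I * a m := by
  have hr0 : 0 < r := hB.trans_lt hr
  have hne : ∀ z ∈ Metric.sphere (0 : ℂ) r, z ≠ 0 := fun z hz =>
    ne_zero_of_mem_sphere hr0.ne' ⟨z, hz⟩
  have hF := hasSum_circleIntegral (c := 0) (r := r) (f := fun z => z ^ m * u z)
    (F := fun n z => z ^ m * (a n * (z ^ (n + 1))⁻¹)) (b := fun n => r ^ m * (C * r⁻¹) * (B / r) ^ n)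
    hr0.le (fun n z hz => ?_)
    ((summable_geometric_of_lt_one (by positivity) ((div_lt_one hr0).2 hr)).mul_left _)
    (fun n z hz => ?_) fun z hz => (hs z hz).mul_left _
  · have hI : ∀ n, (∮ z in C(0, r), z ^ m * (a n * (z ^ (n + 1))⁻¹)) =
        if n = m then 2 * Real.pi * Complex.I * a m else 0 := by
      intro n
      have h1 : (∮ z in C(0, r), z ^ m * (a n * (z ^ (n + 1))⁻¹)) =
          ∮ z in C(0, r), a n * (z - 0) ^ ((m : ℤ) - n - 1) := by
        refine circleIntegral.integral_congr hr0.le fun z hz => ?_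
        have hz0 := hne z hz
        simp only [sub_zero]
        rw [sub_sub, zpow_sub₀ hz0, zpow_natCast, div_eq_mul_inv]
        have : z ^ ((n : ℤ) + 1) = z ^ (n + 1) := by exact_mod_cast zpow_natCast z (n + 1)
        rw [this]; ring
      rw [h1, circleIntegral.integral_const_mul]
      split_ifs with h
      · subst h
        have : ((n : ℤ) - n - 1) = -1 := by ring
        simp_rw [this, zpow_neg_one]
        rw [circleIntegral.integral_sub_center_inv 0 hr0.ne']
        ring
      · rw [circleIntegral.integral_sub_zpow_of_ne (by omega), mul_zero]
    simp_rw [hI] at hF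
    exact hF.unique (hasSum_ite_eq m _)
  · have hz0 := hne z hz
    have h1 : ContinuousAt (fun z : ℂ => (z ^ (n + 1))⁻¹) z :=
      (continuousAt_id.pow (n + 1)).inv₀ (pow_ne_zero _ hz0)
    exact ((continuousAt_id.pow m).mul (continuousAt_const.mul h1)).continuousWithinAt
  · rw [norm_mul, norm_mul, norm_inv, norm_pow, norm_pow, mem_sphere_zero_iff_norm.1 hz]
    calc _ ≤ r ^ m * (C * B ^ n * (r ^ (n + 1))⁻¹) := by gcongr; exact ha n
      _ = _ := by rw [div_pow, pow_succ, mul_inv]; ring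

/-- Every entire function whose growth is governed by the support function of `K` is the contour
integral of a holomorphic function on the complement of `K` vanishing at infinity. -/
theorem exists_circleIntegral_exp_mul_eq {K : Set ℂ} (hne : K.Nonempty) (hconv : Convex ℝ K)
    (hK : IsCompact K) {v : ℂ → ℂ} (hv : Differentiable ℂ v)
    (hb : ∀ ε : ℝ, 0 < ε → ∃ C : ℝ, ∀ w, ‖v w‖ ≤ C * Real.exp (coordSupport K w + ε * ‖w‖)) :
    ∃ u : ℂ → ℂ, DifferentiableOn ℂ u Kᶜ ∧ Tendsto u (Bornology.cobounded ℂ) (𝓝 0) ∧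
      ∀ r : ℝ, K ⊆ Metric.ball 0 r → ∀ w : ℂ,
        (∮ z in C(0, r), Complex.exp (w * z) * u z) = v w := by
  obtain ⟨r₀, hr₀, hKr⟩ := hK.isBounded.exists_pos_norm_le
  obtain ⟨C, hC⟩ := hb 1 one_pos
  have hC0 : 0 ≤ C := nonneg_of_mul_nonneg_left ((norm_nonneg _).trans (hC 0)) (Real.exp_pos _)
  have hvA : ∀ w, ‖v w‖ ≤ C * Real.exp ((r₀ + 1) * ‖w‖) := fun w => by
    refine (hC w).trans ?_
    have := coordSupport_le_norm_mul hne hKr w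
    gcongr
    linarith
  -- The bound on `v` has exponential type `r₀ + 1`, so `iteratedDeriv n v 0` grows at most like `B
  -- ^ n` and the series at infinity converges for `|z| > B`.
  set B := Real.exp (r₀ + 1) with hB
  have hBr : r₀ < B := by linarith [Real.add_one_le_exp (r₀ + 1)]
  have hB0 : 0 ≤ B := (Real.exp_pos _).le
  have ha := exists_norm_iteratedDeriv_le_geometric hv hvA
  have hd : ∀ θ : ℂ, ‖θ‖ = 1 → DifferentiableOn ℂ (rayLaplace v θ) (outerHalfPlane K θ) := by
    intro θ hθ
    refine differentiableOn_rayLaplace hv.continuous hθ fun η hη => ?_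
    obtain ⟨D, hD⟩ := hb (η - coordSupport K θ) (by linarith)
    refine ⟨D, fun t ht => (hD _).trans_eq ?_⟩
    rw [coordSupport_real_mul ht.le, norm_mul, hθ, Complex.norm_real, Real.norm_eq_abs,
      abs_of_pos ht]
    congr 2
    ring
  have hs : ∀ θ : ℂ, ‖θ‖ = 1 → ∀ z, B < (θ * z).re →
      HasSum (fun n => iteratedDeriv n v 0 * (z ^ (n + 1))⁻¹) (rayLaplace v θ z) :=
    fun θ hθ z hz => hasSum_rayLaplace hv hB0 ha hθ hz
  have hex : ∀ z : ℂ, ∃ θ : ℂ, ‖θ‖ = 1 ∧ (z ∉ K → z ∈ outerHalfPlane K θ) := fun z => by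
    by_cases hz : z ∈ K
    · exact ⟨1, by simp, fun h => absurd hz h⟩
    · obtain ⟨θ, h1, h2⟩ := exists_mem_outerHalfPlane hne hconv hK hz
      exact ⟨θ, h1, fun _ => h2⟩
  choose Θ hΘ1 hΘ using hex
  -- The direction `Θ z` is chosen arbitrarily at each point. Since transforms agree on overlaps,
  -- near a given `z` the function `U` equals the transform along the fixed ray `Θ z`, hence is
  -- holomorphic.
  set U : ℂ → ℂ := fun z => rayLaplace v (Θ z) z with hU
  have hUeq : ∀ θ : ℂ, ‖θ‖ = 1 → ∀ z ∈ outerHalfPlane K θ, U z = rayLaplace v θ z :=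
    fun θ hθ z hz => rayLaplace_eq_of_mem hne hK.isBounded hd hs (hΘ1 z) hθ
      (hΘ z (outerHalfPlane_subset_compl hK.isBounded θ hz)) hz
  have hUd : DifferentiableOn ℂ U Kᶜ := by
    intro z hz
    have hzH := hΘ z hz
    have hnhds := (isOpen_outerHalfPlane K (Θ z)).mem_nhds hzH
    refine (((hd _ (hΘ1 z)).differentiableAt hnhds).congr_of_eventuallyEq ?_).differentiableWithinAt
    filter_upwards [hnhds] with y hy using hUeq _ (hΘ1 z) y hy
  have hUs : ∀ z, B < ‖z‖ → HasSum (fun n => iteratedDeriv n v 0 * (z ^ (n + 1))⁻¹) (U z) := by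
    intro z hz
    have hz0 : (‖z‖ : ℂ) ≠ 0 := by exact_mod_cast (hB0.trans_lt hz).ne'
    -- This direction makes `θ z = |z|`, so the series, valid for `Re(θ z) > B`, covers the whole
    -- region `|z| > B`.
    set θ := (starRingEnd ℂ) z / ‖z‖ with hθdef
    have hθ : ‖θ‖ = 1 := by
      rw [hθdef, norm_div, Complex.norm_conj, Complex.norm_real, norm_norm,
        div_self (hB0.trans_lt hz).ne']
    have hθz : (θ * z).re = ‖z‖ := by
      have : θ * z = ‖z‖ := by
        rw [hθdef, div_mul_eq_mul_div, mul_comm, Complex.mul_conj, Complex.normSq_eq_norm_sq,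
          div_eq_iff hz0]
        push_cast; ring
      rw [this, Complex.ofReal_re]
    have hmem : z ∈ outerHalfPlane K θ := by
      rw [outerHalfPlane, mem_ofPred_eq, hθz]
      have := coordSupport_le_norm_mul hne hKr θ
      rw [hθ, one_mul] at this
      linarith
    rw [hUeq θ hθ z hmem]
    exact hs θ hθ z (by rwa [hθz])
  have hUb : ∀ z, B < ‖z‖ → ‖U z‖ ≤ C * (‖z‖ - B)⁻¹ := by
    intro z hz
    have hzp : 0 < ‖z‖ := hB0.trans_lt hz
    have hg := (hasSum_geometric_of_lt_one (by positivity) ((div_lt_one hzp).2 hz)).mul_left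
      (C * ‖z‖⁻¹)
    rw [← (hUs z hz).tsum_eq]
    refine (tsum_of_norm_bounded hg fun n => ?_).trans_eq ?_
    · rw [norm_mul, norm_inv, norm_pow]
      calc _ ≤ C * B ^ n * (‖z‖ ^ (n + 1))⁻¹ := by gcongr; exact ha n
        _ = _ := by rw [div_pow, pow_succ, mul_inv]; ring
    · have h1 : 1 - B / ‖z‖ = (‖z‖ - B) * ‖z‖⁻¹ := by field_simp
      rw [h1, mul_inv, inv_inv]
      have : ‖z‖ - B ≠ 0 := by linarith
      field_simp
  have hUt : Tendsto U (Bornology.cobounded ℂ) (𝓝 0) := by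
    have h1 : Tendsto (fun z : ℂ => C * (‖z‖ - B)⁻¹) (Bornology.cobounded ℂ) (𝓝 0) := by
      have := (tendsto_inv_atTop_zero.comp (tendsto_atTop_add_const_right _ (-B)
        (tendsto_norm_cobounded_atTop (E := ℂ)))).const_mul C
      simpa [Function.comp_def, sub_eq_add_neg] using this
    refine squeeze_zero_norm' ?_ h1
    filter_upwards [setOf_lt_norm_mem_cobounded B] with z hz using hUb z hz
  have hpi : (2 * Real.pi * Complex.I : ℂ) ≠ 0 := Complex.two_pi_I_ne_zero
  refine ⟨fun z => (2 * Real.pi * Complex.I : ℂ)⁻¹ * U z, hUd.const_mul _, by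
    simpa using hUt.const_mul (2 * Real.pi * Complex.I : ℂ)⁻¹, fun r hr w => ?_⟩
  have hKB : K ⊆ Metric.ball 0 (B + 1) := fun z hz => by
    rw [mem_ball_zero_iff]; linarith [hKr z hz]
  have hFd : DifferentiableOn ℂ (fun z => Complex.exp (w * z) * U z) Kᶜ :=
    DifferentiableOn.mul (by fun_prop) hUd
  have h1 : (∮ z in C(0, r), Complex.exp (w * z) * ((2 * Real.pi * Complex.I : ℂ)⁻¹ * U z)) =
      (2 * Real.pi * Complex.I : ℂ)⁻¹ * ∮ z in C(0, r), Complex.exp (w * z) * U z := by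
    rw [← circleIntegral.integral_const_mul]
    congr 1; ext z; ring
  have hsph : ∀ z ∈ Metric.sphere (0 : ℂ) (B + 1), B < ‖z‖ := fun z hz => by
    rw [mem_sphere_zero_iff_norm.1 hz]; linarith
  rw [h1, circleIntegral_eq_of_differentiableOn_compl hK.isClosed hne hFd hr hKB]
  -- Both sides are entire in `w` and are compared through their Taylor series at `0`: the moments
  -- of `U` are `2πi` times the derivatives of `v`.
  have h2 := hasSum_circleIntegral_exp_mul (u := U) (r := B + 1) (by linarith)
    (hUd.continuousOn.mono fun z hz hzK => by linarith [hsph z hz, hKr z hzK]) w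
  simp_rw [circleIntegral_pow_mul_of_hasSum hB0 (by linarith : B < B + 1) ha
    fun z hz => hUs z (hsph z hz)] at h2
  have h3 := (Complex.hasSum_taylorSeries_of_entire hv 0 w).mul_left (2 * Real.pi * Complex.I : ℂ)
  rw [inv_mul_eq_iff_eq_mul₀ hpi]
  refine h2.unique (h3.congr_fun fun n => ?_)
  simp only [sub_zero, smul_eq_mul]
  ring

variable {V : Type*} [NormedAddCommGroup V] [NormedSpace ℂ V]

/-! ### Coordinates -/

theorem apply_symm_eq_mul (e : V ≃L[ℂ] ℂ) (w : StrongDual ℂ V) (z : ℂ) :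
    w (e.symm z) = w (e.symm 1) * z := by
  have : e.symm z = z • e.symm 1 := by rw [← map_smul, smul_eq_mul, mul_one]
  rw [this, map_smul, smul_eq_mul, mul_comm]

/-- The linear coordinate on the dual line which is dual to `e`. -/
def dualCoord (e : V ≃L[ℂ] ℂ) : StrongDual ℂ V ≃L[ℂ] ℂ :=
  ContinuousLinearEquiv.equivOfInverse (ContinuousLinearMap.apply ℂ ℂ (e.symm 1))
    (ContinuousLinearMap.toSpanSingleton ℂ (e : V →L[ℂ] ℂ))
    (fun w => by
      ext x
      have := apply_symm_eq_mul e w (e x)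
      simp only [ContinuousLinearEquiv.symm_apply_apply] at this
      simp [this])
    (fun c => by simp)

theorem dualCoord_apply (e : V ≃L[ℂ] ℂ) (w : StrongDual ℂ V) : dualCoord e w = w (e.symm 1) := rfl

theorem norm_symm_one_pos (e : V ≃L[ℂ] ℂ) : 0 < ‖e.symm 1‖ :=
  norm_pos_iff.2 (by simp)

theorem norm_eq_norm_mul_norm_symm_one (e : V ≃L[ℂ] ℂ) (x : V) : ‖x‖ = ‖e x‖ * ‖e.symm 1‖ := by
  have : x = e x • e.symm 1 := by rw [← map_smul, smul_eq_mul, mul_one, e.symm_apply_apply]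
  conv_lhs => rw [this]
  exact norm_smul _ _

theorem norm_dualCoord (e : V ≃L[ℂ] ℂ) (w : StrongDual ℂ V) :
    ‖dualCoord e w‖ = ‖w‖ * ‖e.symm 1‖ := by
  refine le_antisymm (w.le_opNorm _) ?_
  rw [← le_div_iff₀ (norm_symm_one_pos e)]
  refine w.opNorm_le_bound (by positivity) fun x => ?_
  have h1 := apply_symm_eq_mul e w (e x)
  rw [e.symm_apply_apply] at h1
  rw [h1, norm_mul, norm_eq_norm_mul_norm_symm_one e x, dualCoord_apply]
  have := (norm_symm_one_pos e).ne'
  exact le_of_eq (by field_simp)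

theorem supportFun_eq_coordSupport (e : V ≃L[ℂ] ℂ) (K : Set V) (w : StrongDual ℂ V) :
    supportFun K w = coordSupport (e '' K) (dualCoord e w) := by
  unfold supportFun coordSupport
  rw [image_image]
  congr 1
  refine image_congr fun x _ => ?_
  have h1 := apply_symm_eq_mul e w (e x)
  rw [e.symm_apply_apply] at h1
  rw [h1, dualCoord_apply]

/-- Support functions add under Minkowski sums, and that of the disc of radius `ε` is `ε * ‖w‖`,
attained at a point whose argument is opposite to that of `w`. -/
theorem supportFun_thickening (e : V ≃L[ℂ] ℂ) {K : Set V} (hne : K.Nonempty)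
    (hK : Bornology.IsBounded K) {ε : ℝ} (hε : 0 ≤ ε) (w : StrongDual ℂ V) :
    supportFun (thickening K ε) w = supportFun K w + ε * ‖w‖ := by
  have hbd : ∀ S : Set V, Bornology.IsBounded S → BddAbove ((fun z : V => (w z).re) '' S) := by
    intro S hS
    obtain ⟨r, hr⟩ := hS.exists_norm_le
    refine ⟨‖w‖ * r, ?_⟩
    rintro _ ⟨z, hz, rfl⟩
    exact (Complex.re_le_norm _).trans ((w.le_opNorm z).trans (by gcongr; exact hr z hz))
  have hadd : (fun z : V => (w z).re) '' thickening K ε =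
      (fun z : V => (w z).re) '' K + (fun z : V => (w z).re) '' Metric.closedBall 0 ε :=
    Set.image_add ((Complex.reLm.comp (w.toLinearMap.restrictScalars ℝ)) : V →ₗ[ℝ] ℝ)
  have hball : sSup ((fun z : V => (w z).re) '' Metric.closedBall 0 ε) = ε * ‖w‖ := by
    refine IsGreatest.csSup_eq ⟨?_, ?_⟩
    · obtain ⟨θ, hθ, hw⟩ := exists_norm_eq_one_mul_eq_norm (dualCoord e w)
      have hp := norm_symm_one_pos e
      refine ⟨e.symm ((starRingEnd ℂ) θ * ((ε / ‖e.symm 1‖ : ℝ) : ℂ)), ?_, ?_⟩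
      · rw [mem_closedBall_zero_iff, norm_eq_norm_mul_norm_symm_one e, e.apply_symm_apply, norm_mul,
          Complex.norm_conj, hθ, one_mul, Complex.norm_real, Real.norm_eq_abs,
          abs_of_nonneg (by positivity), div_mul_cancel₀ _ hp.ne']
      · simp only
        rw [apply_symm_eq_mul, ← dualCoord_apply, hw, mul_assoc, ← mul_assoc θ,
          mul_conj_of_norm_eq_one hθ, one_mul, Complex.re_ofReal_mul, Complex.ofReal_re,
          norm_dualCoord]
        field_simp
    · rintro _ ⟨z, hz, rfl⟩
      rw [mem_closedBall_zero_iff] at hz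
      calc (w z).re ≤ ‖w‖ * ‖z‖ := (Complex.re_le_norm _).trans (w.le_opNorm z)
        _ ≤ ‖w‖ * ε := by gcongr
        _ = _ := mul_comm _ _
  unfold supportFun
  rw [hadd, csSup_add (hne.image _) (hbd K hK) ((Metric.nonempty_closedBall.2 hε).image _)
    (hbd _ Metric.isBounded_closedBall), hball]

theorem coordSupport_le_add {K : Set ℂ} (hne : K.Nonempty) (hK : Bornology.IsBounded K) {r : ℝ}
    (hr : ∀ z ∈ K, ‖z‖ ≤ r) (w w' : ℂ) :
    coordSupport K w' ≤ coordSupport K w + ‖w' - w‖ * r :=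
  coordSupport_le hne fun z hz => by
    have h1 := re_mul_le_coordSupport hK hz w
    have h2 : ((w' - w) * z).re ≤ ‖w' - w‖ * r := by
      refine (Complex.re_le_norm _).trans ?_
      rw [norm_mul]; gcongr; exact hr z hz
    rw [sub_mul, Complex.sub_re] at h2
    linarith

/-! ### The two growth conditions on entire functions agree -/

theorem contDiffAt_cDensity {ζ : ℂ} (hζ : ζ ≠ 0) :
    cDensity ζ ≠ 0 ∧ ContDiffAt ℝ (⊤ : ℕ∞) cDensity ζ := by
  have h0 : ‖ζ‖ ≠ 0 := norm_ne_zero_iff.2 hζ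
  refine ⟨by unfold cDensity; exact_mod_cast inv_ne_zero (pow_ne_zero _ h0), ?_⟩
  have h1 : ContDiffAt ℝ (⊤ : ℕ∞) (fun ζ : ℂ => (‖ζ‖ ^ 4)⁻¹) ζ :=
    ((contDiffAt_norm ℝ hζ).pow 4).inv (pow_ne_zero _ h0)
  exact Complex.ofRealCLM.contDiff.contDiffAt.comp ζ h1

theorem contDiffAt_cAntiForm {ζ : ℂ} (hζ : ζ ≠ 0) :
    cAntiForm ζ ≠ 0 ∧ ContDiffAt ℝ (⊤ : ℕ∞) cAntiForm ζ := by
  have h0 : ((starRingEnd ℂ) ζ) ^ 2 ≠ 0 := by simpa using hζ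
  refine ⟨by unfold cAntiForm; simpa using hζ, ?_⟩
  have h1 : ContDiffAt ℝ (⊤ : ℕ∞) (fun ζ : ℂ => (starRingEnd ℂ) ζ) ζ :=
    Complex.conjCLE.contDiff.contDiffAt
  exact ((h1.pow 2).inv h0).neg

/-- An entire function which is tempered with respect to a weight satisfies pointwise bounds. -/
theorem exists_norm_le_of_extendsToProj {K : Set ℂ} (hne : K.Nonempty) (hK : Bornology.IsBounded K)
    {v : ℂ → ℂ} (hv : Differentiable ℂ v) {g : ℂ → ℝ} (hg : Continuous g) {a D : ℝ} (ha : 0 < a)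
    (hgb : ∀ z, g z ≤ coordSupport K z + a * ‖z‖ + D)
    (h : ExtendsToProj cDensity univ fun z => (Real.exp (-g z) : ℂ) * v z) :
    ∃ C : ℝ, ∀ z, ‖v z‖ ≤ C * Real.exp (coordSupport K z + 2 * a * ‖z‖) := by
  obtain ⟨r, hr0, hr⟩ := hK.exists_pos_norm_le
  -- `H` must dominate `g` on the unit disc around `z`: `r` comes from the Lipschitz bound for the
  -- support function, `a` from the norm, `D` from the comparison of `g`. The exponent of `e` is
  -- then the same up to a constant.
  obtain ⟨C, L, hC0, hC⟩ := h.exists_norm_le (R := 1) (p := v) (g := g)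
    (H := fun z => coordSupport K z + a * ‖z‖ + (r + a + D)) le_rfl (fun _ _ => mem_univ _)
    (fun ζ hζ => contDiffAt_cDensity hζ) hg hv.differentiableOn (fun z hz => by
      have hz0 : (‖z‖ : ℂ) ≠ 0 := by exact_mod_cast (by linarith : ‖z‖ ≠ 0)
      rw [cDensity, norm_inv, inv_pow, inv_inv, mul_assoc, ← Complex.ofReal_mul, inv_mul_cancel₀
        (pow_ne_zero _ (by linarith : ‖z‖ ≠ 0)), Complex.ofReal_one, mul_one])
    (fun z z' _ hzz' => by
      have h1 := coordSupport_le_add hne hK hr z z'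
      have h2 : ‖z'‖ ≤ ‖z‖ + 1 := by linarith [norm_sub_norm_le z' z]
      have h3 : ‖z' - z‖ * r ≤ 1 * r := by gcongr
      have h4 : a * ‖z'‖ ≤ a * (‖z‖ + 1) := by gcongr
      linarith [hgb z'])
  obtain ⟨M, hM⟩ := (isCompact_closedBall (0 : ℂ) 3).exists_bound_of_continuousOn
    hv.continuous.continuousOn
  have hM0 : 0 ≤ M := (norm_nonneg _).trans (hM 0 (by simp))
  set C₁ := C * (L.factorial / a ^ L) * Real.exp (r + a + D) with hC₁
  have hC₁0 : 0 ≤ C₁ := by positivity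
  refine ⟨C₁ + M * Real.exp (3 * r), fun z => ?_⟩
  rcases le_or_gt ‖z‖ 3 with hz | hz
  · have h1 : -(3 * r) ≤ coordSupport K z + 2 * a * ‖z‖ := by
      obtain ⟨k, hk⟩ := hne
      have h2 := re_mul_le_coordSupport hK hk z
      have h3 := (abs_le.1 (Complex.abs_re_le_norm (z * k))).1
      have h4 : ‖z * k‖ ≤ 3 * r := by
        rw [norm_mul]; gcongr; exact hr k hk
      have : 0 ≤ 2 * a * ‖z‖ := by positivity
      linarith
    calc ‖v z‖ ≤ M := hM z (by simpa using hz)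
      _ = M * Real.exp (3 * r) * Real.exp (-(3 * r)) := by
        rw [mul_assoc, ← Real.exp_add, add_neg_cancel, Real.exp_zero, mul_one]
      _ ≤ (C₁ + M * Real.exp (3 * r)) * Real.exp (coordSupport K z + 2 * a * ‖z‖) := by
        gcongr
        linarith
  · have h1 := hC z (by linarith)
    -- The polynomial factor is absorbed by one more `e^{a ‖z‖}`, which is why `a` doubles in the
    -- conclusion.
    have h2 : ‖z‖ ^ L ≤ L.factorial / a ^ L * Real.exp (a * ‖z‖) := by
      have := Real.pow_div_factorial_le_exp (a * ‖z‖) (by positivity) L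
      rw [div_le_iff₀ (by positivity), mul_pow] at this
      rw [div_mul_eq_mul_div, le_div_iff₀ (by positivity)]
      linarith
    calc ‖v z‖ ≤ C * ‖z‖ ^ L * Real.exp (coordSupport K z + a * ‖z‖ + (r + a + D)) := h1
      _ ≤ C * (L.factorial / a ^ L * Real.exp (a * ‖z‖)) *
          Real.exp (coordSupport K z + a * ‖z‖ + (r + a + D)) := by gcongr
      _ = C₁ * (Real.exp (a * ‖z‖) * Real.exp (coordSupport K z + a * ‖z‖)) := by
        rw [hC₁, Real.exp_add _ (r + a + D)]; ring
      _ = C₁ * Real.exp (coordSupport K z + 2 * a * ‖z‖) := by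
        rw [← Real.exp_add]; congr 2; ring
      _ ≤ _ := by
        gcongr
        have : 0 ≤ M * Real.exp (3 * r) := by positivity
        linarith

theorem mem_expType_iff_dualCoord (e : V ≃L[ℂ] ℂ) {K : Set V} {v : StrongDual ℂ V → ℂ} :
    v ∈ expType K ↔ Differentiable ℂ (fun c => v ((dualCoord e).symm c)) ∧ ∀ ε : ℝ, 0 < ε →
      ∃ C : ℝ, ∀ c, ‖v ((dualCoord e).symm c)‖ ≤
        C * Real.exp (coordSupport (e '' K) c + ε * ‖c‖) := by
  have hp := norm_symm_one_pos e
  have hexp : ∀ (ε : ℝ) (w : StrongDual ℂ V) (C : ℝ),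
      ‖v w‖ * Real.exp (-supportFun K w - ε * ‖e.symm 1‖ * ‖w‖) ≤ C ↔
      ‖v w‖ ≤ C * Real.exp (coordSupport (e '' K) (dualCoord e w) + ε * ‖dualCoord e w‖) := by
    intro ε w C
    rw [← div_le_iff₀ (Real.exp_pos _), div_eq_mul_inv, ← Real.exp_neg, norm_dualCoord,
      supportFun_eq_coordSupport e]
    have : -coordSupport (e '' K) (dualCoord e w) - ε * ‖e.symm 1‖ * ‖w‖ =
      -(coordSupport (e '' K) (dualCoord e w) + ε * (‖w‖ * ‖e.symm 1‖)) := by ring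
    rw [this]
  constructor
  · rintro ⟨hd, h⟩
    refine ⟨hd.comp (dualCoord e).symm.differentiable, fun ε hε => ?_⟩
    obtain ⟨C, hC⟩ := h (ε * ‖e.symm 1‖) (by positivity)
    refine ⟨C, fun c => ?_⟩
    simpa using (hexp ε _ C).1 (hC ((dualCoord e).symm c))
  · rintro ⟨hd, h⟩
    refine ⟨?_, fun ε hε => ?_⟩
    · have := hd.comp (dualCoord e).differentiable
      simpa [Function.comp_def] using this
    obtain ⟨C, hC⟩ := h (ε / ‖e.symm 1‖) (by positivity)
    refine ⟨C, fun w => ?_⟩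
    have := (hexp (ε / ‖e.symm 1‖) w C).2 (by simpa using hC (dualCoord e w))
    rwa [div_mul_cancel₀ _ hp.ne'] at this

/-- For `v` tempered with respect to `h_{K_{ε/2}}`, the pointwise bound loses a polynomial factor,
absorbed in the other half of `ε`. Conversely, the `Exp(K)` bound makes `e^{-g} v` a bounded
function, which extends across infinity. The hypothesis `hASA` provides the `g` to test against in
the first direction. -/
theorem expTempered_eq_expType (e : V ≃L[ℂ] ℂ) {K : Set V} (hne : K.Nonempty) (hK : IsCompact K)
    (hASA : ∀ ε : ℝ, 0 < ε → IsAlmostSmoothSubanalytic (supportFun (thickening K ε))) :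
    (expTempered K : Set (StrongDual ℂ V → ℂ)) = expType K := by
  have hp := norm_symm_one_pos e
  ext v
  constructor
  · rintro ⟨hd, h⟩
    rw [mem_expType_iff_dualCoord e]
    have hvd : Differentiable ℂ fun c => v ((dualCoord e).symm c) :=
      hd.comp (dualCoord e).symm.differentiable
    refine ⟨hvd, fun ε hε => ?_⟩
    -- The factor `‖e.symm 1‖` converts the norm of the dual line to the modulus of the dual
    -- coordinate.
    have hδ : 0 < ε / 2 * ‖e.symm 1‖ := by positivity
    obtain ⟨-, g, hg⟩ := hASA _ hδ
    obtain ⟨hgs, -, D, -, hD⟩ := id hg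
    have h1 := exists_norm_le_of_extendsToProj (hne.image e) (hK.image e.continuous).isBounded hvd
      (g := fun c => g ((dualCoord e).symm c)) (hgs.continuous.comp (dualCoord e).symm.continuous)
      (a := ε / 2) (D := D) (by positivity) (fun c => by
        have h2 := (abs_lt.1 (hD ((dualCoord e).symm c))).1
        rw [supportFun_thickening e hne hK.isBounded hδ.le, supportFun_eq_coordSupport e,
          mul_assoc, mul_comm ‖e.symm 1‖, ← norm_dualCoord, (dualCoord e).apply_symm_apply] at h2
        linarith) (h _ hδ g hg (dualCoord e))
    rwa [mul_div_cancel₀ ε two_ne_zero] at h1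
  · rintro ⟨hd, h⟩
    refine ⟨hd, fun ε hε g ⟨hgs, _, D, _, hD⟩ e' => ?_⟩
    obtain ⟨C, hC⟩ := h ε hε
    refine ExtendsToProj.of_growth measurable_cDensity (fun ζ h0 h1 => norm_inv_cDensity_le h0 h1)
      isOpen_univ ?_ (C := Real.exp D * C) (n := 0) fun z _ => ?_
    · have h1 := hgs.continuous
      have h2 := hd.continuous
      have h3 := e'.symm.continuous
      exact Continuous.continuousOn (by fun_prop)
    · set w := e'.symm z
      have h2 := (abs_lt.1 (hD w)).2
      rw [supportFun_thickening e hne hK.isBounded hε.le] at h2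
      rw [pow_zero, mul_one, norm_mul, Complex.norm_real, Real.norm_eq_abs, abs_of_pos (Real.exp_pos _)]
      calc _ ≤ Real.exp (D + (-supportFun K w - ε * ‖w‖)) * ‖v w‖ := by
            gcongr; linarith
        _ = Real.exp D * (‖v w‖ * Real.exp (-supportFun K w - ε * ‖w‖)) := by
            rw [Real.exp_add]; ring
        _ ≤ _ := by gcongr; exact hC w

/-! ### Forms in a coordinate -/

/-- The form `u(z) dz` on `U ⊆ V` in the coordinate `z = e`. -/
def formOf (e : V ≃L[ℂ] ℂ) (U : Set V) (u : ℂ → ℂ) : Forms U :=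
  fun z => u (e z) • (e : V →L[ℂ] ℂ)

theorem extForm_formOf (e : V ≃L[ℂ] ℂ) {U : Set V} (u : ℂ → ℂ) {x : V} (hx : x ∈ U) :
    extForm (formOf e U u) x = u (e x) • (e : V →L[ℂ] ℂ) := by
  rw [extForm_apply _ hx]; rfl

theorem coeff_formOf (e e' : V ≃L[ℂ] ℂ) {U : Set V} (u : ℂ → ℂ) {z : ℂ} (hz : e'.symm z ∈ U) :
    coeff e' (formOf e U u) z = u (e (e'.symm z)) * e (e'.symm 1) := by
  rw [coeff, extForm_formOf e u hz]; rfl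

theorem extForm_eq_coeff_smul (e : V ≃L[ℂ] ℂ) {U : Set V} (ω : Forms U) (x : V) :
    extForm ω x = coeff e ω (e x) • (e : V →L[ℂ] ℂ) := by
  ext y
  have := apply_symm_eq_mul e (extForm ω x) (e y)
  rw [e.symm_apply_apply] at this
  rw [this, coeff, e.symm_apply_apply]
  rfl

theorem formOf_coeff (e : V ≃L[ℂ] ℂ) {U : Set V} (ω : Forms U) : formOf e U (coeff e ω) = ω := by
  funext x
  have := extForm_eq_coeff_smul e ω x.1
  rw [extForm_apply ω x.2] at this
  exact this.symm

theorem symm_notMem_iff (e : V ≃L[ℂ] ℂ) {K : Set V} {z : ℂ} : e.symm z ∉ K ↔ z ∉ e '' K := by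
  rw [not_iff_not]
  constructor
  · intro h; exact ⟨_, h, e.apply_symm_apply z⟩
  · rintro ⟨x, hx, rfl⟩; rwa [e.symm_apply_apply]

theorem differentiableAt_coeff (e : V ≃L[ℂ] ℂ) {U : Set V} {ω : Forms U} (hω : ω ∈ holForms U)
    {z : ℂ} (hz : e.symm z ∈ U) : DifferentiableAt ℂ (coeff e ω) z := by
  have h : DifferentiableAt ℂ (fun z : ℂ => extForm ω (e.symm z)) z :=
    (hω _ hz).comp z e.symm.differentiable.differentiableAt
  exact h.clm_apply (differentiableAt_const _)

theorem differentiableOn_coeff (e : V ≃L[ℂ] ℂ) {K : Set V} {ω : Forms (Kᶜ : Set V)}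
    (hω : ω ∈ holForms Kᶜ) : DifferentiableOn ℂ (coeff e ω) (e '' K)ᶜ := fun _ hz =>
  (differentiableAt_coeff e hω ((symm_notMem_iff e).2 hz)).differentiableWithinAt

theorem formOf_mem_holForms (e : V ≃L[ℂ] ℂ) {U : Set V} (hU : IsOpen U) {u : ℂ → ℂ}
    (hu : ∀ x ∈ U, DifferentiableAt ℂ u (e x)) : formOf e U u ∈ holForms U := by
  intro x hx
  have h : DifferentiableAt ℂ (fun x => u (e x) • (e : V →L[ℂ] ℂ)) x :=
    ((hu x hx).comp x e.differentiable.differentiableAt).smul_const _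
  refine h.congr_of_eventuallyEq ?_
  filter_upwards [hU.mem_nhds hx] with y hy using extForm_formOf e u hy

theorem tendsto_symm_cobounded (e : V ≃L[ℂ] ℂ) :
    Tendsto e.symm (Bornology.cobounded ℂ) (Bornology.cobounded V) := by
  rw [← tendsto_norm_atTop_iff_cobounded]
  have h1 : (fun z : ℂ => ‖e.symm z‖) = fun z => ‖z‖ * ‖e.symm 1‖ := by
    funext z
    rw [norm_eq_norm_mul_norm_symm_one e, e.apply_symm_apply]
  rw [h1]
  exact tendsto_norm_cobounded_atTop.atTop_mul_const (norm_symm_one_pos e)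

theorem tendsto_coord_cobounded (e : V ≃L[ℂ] ℂ) :
    Tendsto e (Bornology.cobounded V) (Bornology.cobounded ℂ) := by
  rw [← tendsto_norm_atTop_iff_cobounded]
  have h1 : (fun x : V => ‖e x‖) = fun x => ‖x‖ * ‖e.symm 1‖⁻¹ := by
    funext x
    rw [norm_eq_norm_mul_norm_symm_one e x, mul_inv_cancel_right₀ (norm_symm_one_pos e).ne']
  rw [h1]
  exact tendsto_norm_cobounded_atTop.atTop_mul_const (inv_pos.2 (norm_symm_one_pos e))

theorem tendsto_coeff_of_mem_formsVanishingAtInfty (e : V ≃L[ℂ] ℂ) {K : Set V}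
    {ω : Forms (Kᶜ : Set V)} (hω : ω ∈ formsVanishingAtInfty K) :
    Tendsto (coeff e ω) (Bornology.cobounded ℂ) (𝓝 0) := by
  have h1 := hω.2.comp (tendsto_symm_cobounded e)
  have h2 := (ContinuousLinearMap.apply ℂ ℂ (e.symm 1)).continuous.tendsto 0
  rw [map_zero] at h2
  exact h2.comp h1

theorem formOf_mem_formsVanishingAtInfty (e : V ≃L[ℂ] ℂ) {K : Set V} (hK : IsCompact K) {u : ℂ → ℂ}
    (hu : DifferentiableOn ℂ u (e '' K)ᶜ) (h0 : Tendsto u (Bornology.cobounded ℂ) (𝓝 0)) :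
    formOf e Kᶜ u ∈ formsVanishingAtInfty K := by
  refine ⟨formOf_mem_holForms e hK.isClosed.isOpen_compl fun x hx => ?_, ?_⟩
  · refine hu.differentiableAt ((hK.image e.continuous).isClosed.isOpen_compl.mem_nhds ?_)
    exact (symm_notMem_iff e).1 (by rwa [e.symm_apply_apply])
  · have h1 := (h0.comp (tendsto_coord_cobounded e)).smul_const (e : V →L[ℂ] ℂ)
    have h0' : (0 : ℂ) • (e : V →L[ℂ] ℂ) = 0 :=
      ContinuousLinearMap.ext fun y => zero_mul (e y)
    replace h1 := h0' ▸ h1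
    refine h1.congr' ?_
    have h2 : Kᶜ ∈ Bornology.cobounded V := hK.isBounded
    filter_upwards [h2] with x hx using (extForm_formOf e u hx).symm

theorem formsVanishingAtInfty_le {K : Set V} (hK : IsClosed K) :
    formsVanishingAtInfty K ≤ temperedAtInftyForms K := by
  intro ω hω
  refine ⟨hω.1, fun e => ?_⟩
  obtain ⟨R, -, hR⟩ := ((Metric.hasBasis_cobounded_compl_closedBall (0 : ℂ)).eventually_iff).1
    (Metric.tendsto_nhds.1 (tendsto_coeff_of_mem_formsVanishingAtInfty e hω) 1 one_pos)
  refine ⟨R, ExtendsToProj.of_growth measurable_cAntiForm (fun ζ h0 _ => norm_inv_cAntiForm_le h0)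
    ?_ (fun z hz => (continuousAt_coeff e hω.1 hz.2).continuousWithinAt) (C := 1) (n := 0)
    fun z hz => ?_⟩
  · exact (isOpen_lt_norm R).inter (hK.isOpen_compl.preimage e.symm.continuous)
  · have := hR (x := z) (by simpa using hz.1)
    rw [dist_zero_right] at this
    simpa using this.le

theorem exists_norm_eval_le (p : Polynomial ℂ) :
    ∃ C : ℝ, 0 ≤ C ∧ ∀ z, ‖p.eval z‖ ≤ C * (1 + ‖z‖) ^ p.natDegree := by
  refine ⟨∑ i ∈ Finset.range (p.natDegree + 1), ‖p.coeff i‖,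
    Finset.sum_nonneg fun _ _ => norm_nonneg _, fun z => ?_⟩
  rw [Polynomial.eval_eq_sum_range, Finset.sum_mul]
  refine (norm_sum_le _ _).trans (Finset.sum_le_sum fun i hi => ?_)
  rw [norm_mul, norm_pow]
  have h1 : i ≤ p.natDegree := Nat.lt_succ_iff.1 (Finset.mem_range.1 hi)
  gcongr
  calc ‖z‖ ^ i ≤ (1 + ‖z‖) ^ i := by gcongr; linarith
    _ ≤ _ := pow_le_pow_right₀ (by linarith [norm_nonneg z]) h1

theorem formOf_polynomial_mem_temperedForms (e : V ≃L[ℂ] ℂ) (p : Polynomial ℂ) :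
    formOf e univ (fun z => p.eval z) ∈ temperedForms (univ : Set V) := by
  refine ⟨formOf_mem_holForms e isOpen_univ fun x _ => p.differentiable.differentiableAt,
    fun e' => ?_⟩
  obtain ⟨C, hC0, hC⟩ := exists_norm_eval_le p
  set M := max 1 ‖e (e'.symm 1)‖ with hM
  have hM1 : 1 ≤ M := le_max_left _ _
  have hco : coeff e' (formOf e univ fun z => p.eval z) =
      fun z => p.eval (e (e'.symm z)) * e (e'.symm 1) :=
    funext fun z => coeff_formOf e e' _ (mem_univ _)
  rw [hco]
  refine ExtendsToProj.of_growth measurable_cAntiForm (fun ζ h0 _ => norm_inv_cAntiForm_le h0)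
    ?_ (Continuous.continuousOn ?_) (C := C * M ^ p.natDegree * ‖e (e'.symm 1)‖)
    (n := p.natDegree) fun z _ => ?_
  · rw [image_univ, e'.surjective.range_eq]; exact isOpen_univ
  · have h1 := e.continuous
    have h2 := e'.symm.continuous
    have h3 := p.continuous
    fun_prop
  · have h1 : ‖e (e'.symm z)‖ ≤ M * ‖z‖ := by
      have : e'.symm z = z • e'.symm 1 := by rw [← map_smul, smul_eq_mul, mul_one]
      rw [this, map_smul, norm_smul, mul_comm]
      gcongr
      exact le_max_right _ _
    rw [norm_mul]
    calc _ ≤ C * (1 + ‖e (e'.symm z)‖) ^ p.natDegree * ‖e (e'.symm 1)‖ := by gcongr; exact hC _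
      _ ≤ C * (M * (1 + ‖z‖)) ^ p.natDegree * ‖e (e'.symm 1)‖ := by
        gcongr
        linarith
      _ = _ := by rw [mul_pow]; ring

/-- A form which is tempered at infinity has polynomial growth. -/
theorem isBigO_coeff_of_mem_temperedAtInftyForms (e : V ≃L[ℂ] ℂ) {K : Set V} (hK : IsCompact K)
    {ω : Forms (Kᶜ : Set V)} (hω : ω ∈ temperedAtInftyForms K) :
    (∃ R : ℝ, DifferentiableOn ℂ (coeff e ω) {z | R < ‖z‖}) ∧
      ∃ n : ℕ, coeff e ω =O[Bornology.cobounded ℂ] fun z => z ^ n := by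
  obtain ⟨R₀, hR₀⟩ := hω.2 e
  obtain ⟨r, hr0, hr⟩ := (hK.image e.continuous).isBounded.exists_pos_norm_le
  set R := max 1 (max R₀ r) with hR
  have hR1 : 1 ≤ R := le_max_left _ _
  have hRR : R₀ ≤ R := (le_max_left _ _).trans (le_max_right _ _)
  have hRr : r ≤ R := (le_max_right _ _).trans (le_max_right _ _)
  have hnot : ∀ z : ℂ, R < ‖z‖ → z ∉ e '' K := fun z hz h => by linarith [hr z h]
  have hd : DifferentiableOn ℂ (coeff e ω) {z | R < ‖z‖} :=
    (differentiableOn_coeff e hω.1).mono fun z hz => hnot z hz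
  refine ⟨⟨R, hd⟩, ?_⟩
  -- Since `dz = -z² dζ`, the function `-u z²` is the coefficient of the form in the chart at
  -- infinity, and the weight is trivial.
  obtain ⟨C, L, hC0, hC⟩ := hR₀.exists_norm_le (R := R) (p := fun z => -(coeff e ω z * z ^ 2))
    (g := fun _ => 0) (H := fun _ => 0) hR1
    (fun z hz => ⟨hRR.trans_lt hz, (symm_notMem_iff e).2 (hnot z hz)⟩)
    (fun ζ hζ => contDiffAt_cAntiForm hζ) continuous_const
    (hd.mul (by fun_prop)).neg (fun z hz => by
      have hz0 : z ≠ 0 := norm_pos_iff.1 (by linarith)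
      have hn : ((‖z‖ ^ 4 : ℝ) : ℂ) = z ^ 2 * (starRingEnd ℂ) z ^ 2 := by
        rw [← mul_pow, Complex.mul_conj, Complex.normSq_eq_norm_sq]
        push_cast; ring
      have hc0 : (starRingEnd ℂ) z ≠ 0 := by simpa using hz0
      rw [Complex.ofReal_inv, hn, cAntiForm, map_inv₀]
      simp only [neg_zero, Real.exp_zero, Complex.ofReal_one, one_mul]
      field_simp) (fun _ _ _ _ => le_rfl)
  refine ⟨L, Asymptotics.IsBigO.of_bound C ?_⟩
  filter_upwards [setOf_lt_norm_mem_cobounded (R + 2)] with z hz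
  have hz' : R + 2 < ‖z‖ := hz
  have h1 := hC z hz'
  rw [Real.exp_zero, mul_one, norm_neg, norm_mul, norm_pow] at h1
  rw [norm_pow]
  refine le_trans (le_mul_of_one_le_right (norm_nonneg _) ?_) h1
  exact one_le_pow₀ (by linarith)

/-- A form tempered at infinity is the sum of a form vanishing at infinity and the restriction of a
form with polynomial coefficient. -/
theorem exists_sub_mem_map_restrictForm (e : V ≃L[ℂ] ℂ) {K : Set V} (hK : IsCompact K)
    {ω : Forms (Kᶜ : Set V)} (hω : ω ∈ temperedAtInftyForms K) :
    ∃ η ∈ formsVanishingAtInfty K, ω - η ∈ (temperedForms (univ : Set V)).map (restrictForm K) := by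
  obtain ⟨⟨R, hR⟩, n, hn⟩ := isBigO_coeff_of_mem_temperedAtInftyForms e hK hω
  obtain ⟨p, hp⟩ := exists_polynomial_sub_isBigO_inv hR hn
  have h0 : Tendsto (fun z => coeff e ω z - p.eval z) (Bornology.cobounded ℂ) (𝓝 0) :=
    hp.trans_tendsto tendsto_inv₀_cobounded
  refine ⟨formOf e Kᶜ fun z => coeff e ω z - p.eval z, formOf_mem_formsVanishingAtInfty e hK
    ((differentiableOn_coeff e hω.1).sub p.differentiable.differentiableOn) h0,
    formOf e univ (fun z => p.eval z), formOf_polynomial_mem_temperedForms e p, ?_⟩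
  funext x
  change p.eval (e x) • (e : V →L[ℂ] ℂ) = ω x - (coeff e ω (e x) - p.eval (e x)) • (e : V →L[ℂ] ℂ)
  have hx : coeff e ω (e x) • (e : V →L[ℂ] ℂ) = ω x := congrFun (formOf_coeff e ω) x
  rw [← hx]
  ext y
  change p.eval (e x) * e y = coeff e ω (e x) * e y - (coeff e ω (e x) - p.eval (e x)) * e y
  ring

/-! ### The contour integral -/

/-- Multiplication by `a` scales the circle by `|a|` and shifts its parameter by `arg a`, which is
harmless by periodicity. For `a = 0` both sides vanish. -/
theorem circleIntegral_const_mul_comp_mul {G : ℂ → ℂ} {a : ℂ} {r : ℝ} :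
    (∮ z in C(0, r), a * G (a * z)) = ∮ z in C(0, ‖a‖ * r), G z := by
  have hmap : ∀ θ : ℝ, a * circleMap 0 r θ = circleMap 0 (‖a‖ * r) (θ + a.arg) := fun θ => by
    simp only [circleMap, zero_add]
    conv_lhs => rw [← Complex.norm_mul_exp_arg_mul_I a]
    push_cast
    rw [add_mul, Complex.exp_add]
    ring
  have h1 : (∮ z in C(0, r), a * G (a * z)) = ∫ θ in (0 : ℝ)..2 * Real.pi,
      (fun θ => deriv (circleMap 0 (‖a‖ * r)) θ • G (circleMap 0 (‖a‖ * r) θ)) (θ + a.arg) := by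
    refine intervalIntegral.integral_congr fun θ _ => ?_
    simp only [deriv_circleMap, smul_eq_mul, ← hmap]
    ring
  rw [h1, intervalIntegral.integral_comp_add_right (fun θ =>
    deriv (circleMap 0 (‖a‖ * r)) θ • G (circleMap 0 (‖a‖ * r) θ)), zero_add, add_comm (2 * Real.pi)]
  have hper : Function.Periodic (fun θ => deriv (circleMap 0 (‖a‖ * r)) θ •
      G (circleMap 0 (‖a‖ * r) θ)) (2 * Real.pi) := fun θ => by
    simp only [deriv_circleMap, periodic_circleMap 0 (‖a‖ * r) θ]
  rw [hper.intervalIntegral_add_eq a.arg 0, zero_add]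
  rfl

theorem image_subset_ball_iff {e : V ≃L[ℂ] ℂ} {K : Set V} {r : ℝ} :
    e '' K ⊆ Metric.ball 0 r ↔ ∀ z ∈ K, ‖e z‖ < r := by
  simp [Set.subset_def]

/-- The contour integral of `e^{⟨z, w⟩} ω`, as a linear map in `ω`. -/
def contourMap (e : V ≃L[ℂ] ℂ) {K : Set V} {r : ℝ} (hr0 : 0 < r) (hr : ∀ z ∈ K, ‖e z‖ < r) :
    temperedAtInftyForms K →ₗ[ℂ] (StrongDual ℂ V → ℂ) where
  toFun ω w := ∮ z in C(0, r), Complex.exp (w (e.symm z)) * coeff e ω.1 z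
  map_add' ω η := by
    have hc : ∀ (w : StrongDual ℂ V) (ω : temperedAtInftyForms K),
        CircleIntegrable (fun z => Complex.exp (w (e.symm z)) * coeff e ω.1 z) 0 r := by
      refine fun w ω => ContinuousOn.circleIntegrable hr0.le fun z hz => ?_
      have h1 : ContinuousAt (coeff e ω.1) z := continuousAt_coeff e ω.2.1 fun hK => by
        have := hr _ hK
        rw [e.apply_symm_apply, mem_sphere_zero_iff_norm.1 hz] at this
        exact lt_irrefl _ this
      have h2 : Continuous fun z => Complex.exp (w (e.symm z)) := by fun_prop
      exact (h2.continuousAt.mul h1).continuousWithinAt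
    funext w
    rw [Pi.add_apply, ← circleIntegral.integral_add (hc w ω) (hc w η)]
    simp only [Submodule.coe_add, coeff_add, Pi.add_apply, mul_add]
  map_smul' a ω := by
    funext w
    rw [RingHom.id_apply, Pi.smul_apply, smul_eq_mul, ← circleIntegral.integral_const_mul]
    simp only [Submodule.coe_smul, coeff_smul, Pi.smul_apply, smul_eq_mul, mul_left_comm]

theorem contourMap_apply (e : V ≃L[ℂ] ℂ) {K : Set V} {r : ℝ} (hr0 : 0 < r)
    (hr : ∀ z ∈ K, ‖e z‖ < r) (ω : temperedAtInftyForms K) (w : StrongDual ℂ V) :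
    contourMap e hr0 hr ω w = ∮ z in C(0, r), Complex.exp (w (e.symm z)) * coeff e ω.1 z := rfl

theorem contourMap_apply_symm_dualCoord (e : V ≃L[ℂ] ℂ) {K : Set V} {r : ℝ} (hr0 : 0 < r)
    (hr : ∀ z ∈ K, ‖e z‖ < r) (ω : temperedAtInftyForms K) (c : ℂ) :
    contourMap e hr0 hr ω ((dualCoord e).symm c) =
      ∮ z in C(0, r), Complex.exp (c * z) * coeff e ω.1 z := by
  rw [contourMap_apply]
  congr 1
  funext z
  rw [apply_symm_eq_mul, ← dualCoord_apply, (dualCoord e).apply_symm_apply]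

/-- The contour integral depends neither on the coordinate nor on the radius. -/
theorem contourMap_eq (e e' : V ≃L[ℂ] ℂ) {K : Set V} (hne : K.Nonempty) (hK : IsCompact K)
    {r r' : ℝ} (hr0 : 0 < r) (hr : ∀ z ∈ K, ‖e z‖ < r) (hr0' : 0 < r') (hr' : ∀ z ∈ K, ‖e' z‖ < r') :
    contourMap e hr0 hr = contourMap e' hr0' hr' := by
  refine LinearMap.ext fun ω => funext fun w => ?_
  rw [contourMap_apply, contourMap_apply]
  set a := e (e'.symm 1) with ha
  have hsymm : ∀ z : ℂ, e'.symm z = e.symm (a * z) := fun z => by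
    have h1 : e'.symm z = z • e'.symm 1 := by rw [← map_smul, smul_eq_mul, mul_one]
    rw [h1, mul_comm, ← smul_eq_mul, map_smul, ha, e.symm_apply_apply]
  have hcoeff : ∀ z : ℂ, coeff e' ω.1 z = a * coeff e ω.1 (a * z) := fun z => by
    have h1 : e'.symm 1 = a • e.symm 1 := by
      rw [hsymm, mul_one, ← map_smul, smul_eq_mul, mul_one]
    rw [coeff, hsymm, h1, map_smul, smul_eq_mul]
    rfl
  have h1 : (∮ z in C(0, r'), Complex.exp (w (e'.symm z)) * coeff e' ω.1 z) =
      ∮ z in C(0, r'), a * (fun ζ => Complex.exp (w (e.symm ζ)) * coeff e ω.1 ζ) (a * z) := by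
    congr 1
    funext z
    rw [hsymm, hcoeff]
    ring
  rw [h1, circleIntegral_const_mul_comp_mul
    (G := fun ζ => Complex.exp (w (e.symm ζ)) * coeff e ω.1 ζ) (a := a) (r := r')]
  refine circleIntegral_eq_of_differentiableOn_compl (hK.image e.continuous).isClosed (hne.image e)
    (F := fun ζ => Complex.exp (w (e.symm ζ)) * coeff e ω.1 ζ)
    (DifferentiableOn.mul ?_ (differentiableOn_coeff e ω.2.1)) (image_subset_ball_iff.2 hr)
    (image_subset_ball_iff.2 fun x hx => ?_)
  · have h2 : Differentiable ℂ fun ζ => Complex.exp (w (e.symm ζ)) :=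
      (w.differentiable.comp e.symm.differentiable).cexp
    exact h2.differentiableOn
  · have ha0 : 0 < ‖a‖ := by
      rw [ha, norm_pos_iff]; simp
    have h2 : e x = a * e' x := by
      rw [← e.apply_symm_apply (a * e' x), ← hsymm, e'.symm_apply_apply]
    rw [h2, norm_mul]
    exact mul_lt_mul_of_pos_left (hr' x hx) ha0

theorem contourMap_mem_expType (e : V ≃L[ℂ] ℂ) {K : Set V} (hne : K.Nonempty) (hK : IsCompact K)
    {r : ℝ} (hr0 : 0 < r) (hr : ∀ z ∈ K, ‖e z‖ < r) (ω : temperedAtInftyForms K) :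
    contourMap e hr0 hr ω ∈ expType K := by
  rw [mem_expType_iff_dualCoord e]
  simp_rw [contourMap_apply_symm_dualCoord]
  have hd := differentiableOn_coeff e ω.2.1
  refine ⟨differentiable_circleIntegral_exp_mul hr0.le (hd.continuousOn.mono fun z hz hzK => ?_),
    fun ε hε => exists_norm_circleIntegral_exp_mul_le (hne.image e) (hK.image e.continuous) hd
      (image_subset_ball_iff.2 hr) hε⟩
  have := image_subset_ball_iff.2 hr hzK
  rw [mem_ball_zero_iff, mem_sphere_zero_iff_norm.1 hz] at this
  exact lt_irrefl _ this

/-- On the circle the integrand coincides with an entire function, whose integral vanishes by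
Cauchy; so the contour integral descends to the quotient. -/
theorem contourMap_restrictForm (e : V ≃L[ℂ] ℂ) {K : Set V} {r : ℝ} (hr0 : 0 < r)
    (hr : ∀ z ∈ K, ‖e z‖ < r) (ω : temperedAtInftyForms K)
    (hω : ω.1 ∈ (temperedForms (univ : Set V)).map (restrictForm K)) :
    contourMap e hr0 hr ω = 0 := by
  obtain ⟨ξ, ⟨hξ, -⟩, hξω⟩ := hω
  funext w
  rw [contourMap_apply]
  have hd : Differentiable ℂ fun z => Complex.exp (w (e.symm z)) * coeff e ξ z := fun z =>
    DifferentiableAt.mul ((w.differentiable.comp e.symm.differentiable).cexp z)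
      (differentiableAt_coeff e hξ (mem_univ _))
  have h1 : (∮ z in C(0, r), Complex.exp (w (e.symm z)) * coeff e ω.1 z) =
      ∮ z in C(0, r), Complex.exp (w (e.symm z)) * coeff e ξ z := by
    refine circleIntegral.integral_congr hr0.le fun z hz => ?_
    have hz' : e.symm z ∉ K := fun hzK => by
      have := hr _ hzK
      rw [e.apply_symm_apply, mem_sphere_zero_iff_norm.1 hz] at this
      exact lt_irrefl _ this
    rw [← hξω, coeff, extForm_restrictForm ξ hz']
    rfl
  rw [h1]
  exact Complex.circleIntegral_eq_zero_of_differentiable_on_off_countable hr0.le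
    Set.countable_empty hd.continuous.continuousOn fun z _ => hd z

theorem eq_zero_of_contourMap_eq_zero (e : V ≃L[ℂ] ℂ) {K : Set V} (hne : K.Nonempty)
    (hconv : Convex ℝ K) (hK : IsCompact K) {r : ℝ} (hr0 : 0 < r) (hr : ∀ z ∈ K, ‖e z‖ < r)
    (ω : temperedAtInftyForms K) (hω : ω.1 ∈ formsVanishingAtInfty K)
    (h : contourMap e hr0 hr ω = 0) : ω = 0 := by
  have hconv' : Convex ℝ (e '' K) :=
    hconv.is_linear_image (f := e) ⟨map_add e, fun c x => by
      rw [← Complex.coe_smul c x, map_smul, Complex.coe_smul]⟩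
  have h1 : ∀ z ∉ e '' K, coeff e ω.1 z = 0 := fun z hz =>
    eqOn_zero_of_circleIntegral_exp_mul_eq_zero (hne.image e) hconv' (hK.image e.continuous)
      (differentiableOn_coeff e ω.2.1) (tendsto_coeff_of_mem_formsVanishingAtInfty e hω)
      (image_subset_ball_iff.2 hr) (fun c => by
        rw [← contourMap_apply_symm_dualCoord e hr0 hr, h]; rfl) hz
  refine Subtype.ext ?_
  rw [← formOf_coeff e ω.1]
  funext x
  change coeff e ω.1 (e x) • (e : V →L[ℂ] ℂ) = 0
  rw [h1 _ ((symm_notMem_iff e).1 (by rw [e.symm_apply_apply]; exact x.2))]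
  exact ContinuousLinearMap.ext fun y => zero_mul (e y)

/-- The Borel transform of `v` in the coordinate `e` supplies the coefficient of the form. -/
theorem exists_contourMap_eq (e : V ≃L[ℂ] ℂ) {K : Set V} (hne : K.Nonempty)
    (hconv : Convex ℝ K) (hK : IsCompact K) {r : ℝ} (hr0 : 0 < r) (hr : ∀ z ∈ K, ‖e z‖ < r)
    {v : StrongDual ℂ V → ℂ} (hv : v ∈ expType K) :
    ∃ ω : temperedAtInftyForms K, contourMap e hr0 hr ω = v := by
  have hconv' : Convex ℝ (e '' K) :=
    hconv.is_linear_image (f := e) ⟨map_add e, fun c x => by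
      rw [← Complex.coe_smul c x, map_smul, Complex.coe_smul]⟩
  obtain ⟨hd, hb⟩ := (mem_expType_iff_dualCoord e).1 hv
  obtain ⟨u, hu, hu0, huv⟩ := exists_circleIntegral_exp_mul_eq (hne.image e) hconv'
    (hK.image e.continuous) hd hb
  refine ⟨⟨formOf e Kᶜ u, formsVanishingAtInfty_le hK.isClosed
    (formOf_mem_formsVanishingAtInfty e hK hu hu0)⟩, funext fun w => ?_⟩
  obtain ⟨c, rfl⟩ := (dualCoord e).symm.surjective w
  rw [contourMap_apply_symm_dualCoord, ← huv r (image_subset_ball_iff.2 hr) c]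
  refine circleIntegral.integral_congr hr0.le fun z hz => ?_
  have hz' : e.symm z ∈ Kᶜ := fun hzK => by
    have := hr _ hzK
    rw [e.apply_symm_apply, mem_sphere_zero_iff_norm.1 hz] at this
    exact lt_irrefl _ this
  simp only
  rw [coeff_formOf e e u hz', e.apply_symm_apply, e.apply_symm_apply, mul_one]

end

end Polya

/-! ### The isomorphism and Pólya's theorem. -/

/-- `Φ` is the isomorphism from `Ω^{t_∞}_P(V \ K) / Ω^t_P(V)` onto `Exp^t(K)`; in every linear
coordinate `z = e` of `V` it is the contour integral `v(w) = ∫_{C(0,r)⁺} e^{zw} u(z) dz`. The last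
two conjuncts say that this is Pólya's isomorphism `Ω^0(V \ K) ≃ Exp(K)`. -/
theorem theorem7p6 {V : Type*} [NormedAddCommGroup V] [NormedSpace ℂ V]
    (hV : Module.finrank ℂ V = 1) (K : Set V) (hne : K.Nonempty) (hconv : Convex ℝ K)
    (hK : IsCompact K)
    (hASA : ∀ ε : ℝ, 0 < ε →
      Polya.IsAlmostSmoothSubanalytic (Polya.supportFun (Polya.thickening K ε))) :
    (∃ Φ : Polya.polyaQuotient K ≃ₗ[ℂ] Polya.expTempered K,
      ∀ (e : V ≃L[ℂ] ℂ) (r : ℝ), 0 < r → (∀ z ∈ K, ‖e z‖ < r) →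
        ∀ (ω : Polya.temperedAtInftyForms K) (w : StrongDual ℂ V),
          (Φ (Polya.polyaClass ω) : StrongDual ℂ V → ℂ) w =
            ∮ z in C(0, r), Complex.exp (w (e.symm z)) * Polya.coeff e ω.1 z) ∧
    (∃ hle : Polya.formsVanishingAtInfty K ≤ Polya.temperedAtInftyForms K,
      Function.Bijective fun ω : Polya.formsVanishingAtInfty K =>
        Polya.polyaClass (Submodule.inclusion hle ω)) ∧
    (Polya.expTempered K : Set (StrongDual ℂ V → ℂ)) = Polya.expType K := by
  have : FiniteDimensional ℂ V := Module.finite_of_finrank_eq_succ hV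
  obtain ⟨e⟩ : Nonempty (V ≃L[ℂ] ℂ) :=
    ⟨ContinuousLinearEquiv.ofFinrankEq (by rw [hV, Module.finrank_self])⟩
  obtain ⟨r₀, hr₀, hr₀K⟩ := (hK.image e.continuous).isBounded.exists_pos_norm_le
  have hr0 : 0 < r₀ + 1 := by linarith
  have hr : ∀ z ∈ K, ‖e z‖ < r₀ + 1 := fun z hz => by
    linarith [hr₀K (e z) (mem_image_of_mem e hz)]
  have hle := Polya.formsVanishingAtInfty_le (V := V) hK.isClosed
  have hEq := Polya.expTempered_eq_expType e hne hK hASA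
  have hmem : ∀ ω, Polya.contourMap e hr0 hr ω ∈ Polya.expTempered K := fun ω => by
    rw [← SetLike.mem_coe, hEq]
    exact Polya.contourMap_mem_expType e hne hK hr0 hr ω
  -- Stated for a pair so as to serve twice: with `ω` arbitrary it gives injectivity of `Φ`, and
  -- with `ω = 0` injectivity of `Ω^0` into the quotient.
  have hinj : ∀ (ω η : Polya.temperedAtInftyForms K), η.1 ∈ Polya.formsVanishingAtInfty K →
      Polya.contourMap e hr0 hr ω = 0 → Polya.polyaClass ω = Polya.polyaClass η → η = 0 := by
    intro ω η hη h0 hc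
    refine Polya.eq_zero_of_contourMap_eq_zero e hne hconv hK hr0 hr η hη ?_
    have h1 := Polya.contourMap_restrictForm e hr0 hr (ω - η)
      ((Submodule.Quotient.eq (((Polya.temperedForms (univ : Set V)).map
        (Polya.restrictForm K)).submoduleOf (Polya.temperedAtInftyForms K))).1 hc)
    rwa [map_sub, h0, zero_sub, neg_eq_zero] at h1
  -- Every class has a representative vanishing at infinity: subtract the polynomial part.
  have hdec : ∀ ω : Polya.temperedAtInftyForms K, ∃ η : Polya.temperedAtInftyForms K,
      η.1 ∈ Polya.formsVanishingAtInfty K ∧ Polya.polyaClass ω = Polya.polyaClass η := by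
    intro ω
    obtain ⟨η, hη, hsub⟩ := Polya.exists_sub_mem_map_restrictForm e hK ω.2
    exact ⟨⟨η, hle hη⟩, hη, (Submodule.Quotient.eq _).2 hsub⟩
  refine ⟨?_, ⟨hle, ?_, ?_⟩, hEq⟩
  · let Ψ : Polya.polyaQuotient K →ₗ[ℂ] Polya.expTempered K :=
      Submodule.liftQ _ ((Polya.contourMap e hr0 hr).codRestrict _ hmem) fun ω hω =>
        Subtype.ext (Polya.contourMap_restrictForm e hr0 hr ω hω)
    have hΨ : ∀ ω, (Ψ (Polya.polyaClass ω) : StrongDual ℂ V → ℂ) =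
        Polya.contourMap e hr0 hr ω := fun ω => rfl
    refine ⟨LinearEquiv.ofBijective Ψ ⟨?_, ?_⟩, fun e' r' hr0' hr' ω w => ?_⟩
    · rw [injective_iff_map_eq_zero]
      intro q hq
      obtain ⟨ω, rfl⟩ := Submodule.Quotient.mk_surjective _ q
      obtain ⟨η, hη, hc⟩ := hdec ω
      have h0 : Polya.contourMap e hr0 hr ω = 0 := by
        rw [← hΨ]
        exact congrArg Subtype.val hq
      have h1 := hinj ω η hη h0 hc
      rw [h1] at hc
      exact hc
    · rintro ⟨v, hv⟩
      rw [← SetLike.mem_coe, hEq] at hv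
      obtain ⟨ω, hω⟩ := Polya.exists_contourMap_eq e hne hconv hK hr0 hr hv
      exact ⟨Polya.polyaClass ω, Subtype.ext hω⟩
    · refine (congrFun (hΨ ω) w).trans ?_
      rw [Polya.contourMap_eq e e' hne hK hr0 hr hr0' hr']
      rfl
  · intro ω η h
    have h1 := hinj 0 (Submodule.inclusion hle (ω - η)) (ω - η).2 (map_zero _) (by
      rw [map_sub]
      have h2 : Polya.polyaClass (Submodule.inclusion hle ω) -
        Polya.polyaClass (Submodule.inclusion hle η) = 0 := sub_eq_zero.2 h
      exact h2.symm)
    have h2 : ω - η = 0 := Submodule.inclusion_injective hle (h1.trans (map_zero _).symm)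
    exact sub_eq_zero.1 h2
  · intro q
    obtain ⟨ω, rfl⟩ := Submodule.Quotient.mk_surjective _ q
    obtain ⟨η, hη, hc⟩ := hdec ω
    exact ⟨⟨η.1, hη⟩, hc.symm⟩
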